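/- **Setting.** For every security parameter $z\in\mathbb N$ let $\mathcal E_z$ be an elliptic curve over a prime field $\mathbb F_{p}$ ($p=p(z)$ with $\mathrm{poly}(z)$ many bits), $B\in\mathcal E_z(\mathbb F_p)$ a point of prime order $q=q(z)$, and $\mathcal M_z\subseteq\mathbb Z/q$ a plaintext space containing $0,1$. EC-ElGamal has private keys $k$ uniform in $[1,q-1]$, public keys $K=kB$, and encryption $\mathsf{Enc}_K(x;r)=(rB,\,xB+rK)$ with $r$ uniform in $[1,q-1]$. DDH says that $(aB,bB,abB)$ and $(aB,bB,cB)$, $a,b,c$ uniform modulo $q$, are computationally indistinguishable. EC-ElGamal is semantically secure if every adversary that sees $K$, chooses $x_0,x_1\in\mathcal M_z$ and receives $\mathsf{Enc}_K(x_b;r)$ has negligible advantage in guessing $b$. "Probabilistic polynomial time" (PPT) and indistinguishability are non-uniform: all adversaries and distinguishers are families of probabilistic circuits of size $\mathrm{poly}(z)$. **Common inputs** (for every $z$): a domain of $d=\mathrm{poly}(z)$ labels $\{1,\dots,d\}$, the dataset size $N$ and the partial view size $V$, with $V\le N\le d$. A dataset is a histogram $D:\{1,\dots,d\}\to\mathbb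 N$ (with multiplicities of polynomially many bits); it is *well formed* if all multiplicities are at most $1$ and they sum to $N$. The participant $P$ has a well-formed dataset $D$, the servers $S_1,S_2$ have a set $\mathcal L$ of labels (the background knowledge). **Ideal functionality $F$.** $P$ sends a dataset $D'$ to a trusted party ($D'=D$ if $P$ is honest). If $D'$ is not well formed, both servers get "invalid dataset". Otherwise the trusted party samples a uniformly random $V$-element subset $S$ of the records of $D'$ and sends both servers the bits $b_l=[\,l\in S\,]$ for $l\in\mathcal L$. Nobody receives anything else. **Protocol $\Pi$.** $S_i$ draws a key pair $(k_i,K_i)$ and publishes $K_i$; $K_{\mathcal S}=K_1+K_2$. (1) $P$ draws a uniform permutation $\sigma$ of the labels and sends $\mathsf{lbs}=\{(\sigma(i),D(i))\}_i$ to $S_1$ and $\sigma^{-1}$ to $S_2$. If the flags in $\mathsf{lbs}$ are not $0/1$ flags with exactly $N$ ones, $S_1$ announces "invalid dataset" and both servers output this. (2) $S_1$ draws a uniform vector $u\in\{0,1\}^N$ of Hamming weight $V$ and encrypts its entries under $K_{\mathcal S}$. (3) $S_1$ replaces each flag $1$ in $\mathsf{lbs}$ by the next encrypted entry of $u$, and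 each flag $0$ by a fresh encryption of $0$, and sends the result to $S_2$. (4) $S_2$ adds a fresh encryption of $0$ to every ciphertext, applies $\sigma^{-1}$ to the labels, and sends the resulting vector of ciphertexts (the partial view) to $S_1$. (5) For each $l\in\mathcal L$ the servers decrypt the ciphertext with label $l$ by threshold decryption: the first server sends $C_2-kC_1$ for its key $k$ to the last server, which removes its own share, reads off the bit, and returns it. Both servers output the bits for $l\in\mathcal L$. **Adversaries.** Any of $P$ alone, $S_1$ alone, $S_2$ alone, $P$ and $S_1$, or $P$ and $S_2$ (or nobody) is corrupted. A corrupted $P$ is malicious: given $D$, an auxiliary input and $K_1,K_2$, a PPT adversary $\mathcal B$ chooses arbitrary flags (a dataset $D'$) for the shuffled labels and an arbitrary valid permutation $\sigma$, whose inverse goes to $S_2$. A corrupted server is honest-but-curious: a PPT adversary $\mathcal C$ receives its whole view and an auxiliary input. In the ideal execution one adversary $\mathcal A$ acts for all corrupted parties: it gets their inputs and the auxiliary input, submits $D'$ if $P$ is corrupted, and sees the trusted party's answers if a server is corrupted. $\Pi$ *securely computes* $F$ if for every set of corrupted parties as above and all PPT $(\mathcal B,\mathcal C)$ there is a PPT $\mathcal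 A$ such that, for all sequences of inputs $(D,\mathcal L)$ with $D$ well formed and of auxiliary inputs of polynomial length, the joint outputs of the honest parties and the adversaries in the ideal execution of $F$ with $\mathcal A$ and in the real execution of $\Pi$ with $(\mathcal B,\mathcal C)$ are computationally indistinguishable. **Theorem.** Under the DDH assumption EC-ElGamal is semantically secure; and whenever EC-ElGamal is semantically secure, the protocol $\Pi$, with either server decrypting last, securely computes $F$. In particular, under DDH, $\Pi$ securely collects the partial view. -/

import Mathlib

open Filter

noncomputable section

namespace PartialView

/-! ### Encoding data as bit strings -/

/-- A fixed-length binary encoding of `α`: bit positions `Idx`, and an injective map to bits. -/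
class BitEnc (α : Type) where
  Idx : Type
  finite : Finite Idx
  enc : α → Idx → Bool
  inj : Function.Injective enc

namespace BitEnc

/-- Encode `α` through an injection into an encoded type. -/
@[reducible] def comap {α β : Type} [BitEnc β] (f : α → β) (hf : Function.Injective f) :
    BitEnc α where
  Idx := Idx β
  finite := BitEnc.finite
  enc a := enc (f a)
  inj := inj.comp hf

/-- Decoding, with a default value for bit strings that encode nothing. -/
def decD {α : Type} [BitEnc α] (default : α) : (Idx α → Bool) → α :=
  Function.extend enc id (fun _ => default)

instance : BitEnc Bool where
  Idx := Unit
  finite := inferInstance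
  enc b _ := b
  inj _ _ h := congrFun h ()

instance {α β : Type} [BitEnc α] [BitEnc β] : BitEnc (α × β) where
  Idx := Idx α ⊕ Idx β
  finite := by
    have := BitEnc.finite (α := α)
    have := BitEnc.finite (α := β)
    infer_instance
  enc x := Sum.elim (enc x.1) (enc x.2)
  inj x y h := Prod.ext (inj (funext fun i => congrFun h (Sum.inl i)))
    (inj (funext fun i => congrFun h (Sum.inr i)))

instance {ι α : Type} [Finite ι] [BitEnc α] : BitEnc (ι → α) where
  Idx := ι × Idx α
  finite := by
    have := BitEnc.finite (α := α)
    infer_instance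
  enc f i := enc (f i.1) i.2
  inj f g h := funext fun a => inj (funext fun i => congrFun h (a, i))

/-- One bit says whether a value is present; the other bits are zero if it is not. -/
instance {α : Type} [BitEnc α] : BitEnc (Option α) where
  Idx := Option (Idx α)
  finite := by
    have := BitEnc.finite (α := α)
    infer_instance
  enc
    | none, _ => false
    | some _, none => true
    | some a, some i => enc a i
  inj := by
    rintro (_ | a) (_ | b) h
    · rfl
    · exact absurd (congrFun h none) (by simp)
    · exact absurd (congrFun h none) (by simp)
    · exact congrArg some (inj (funext fun i => congrFun h (some i)))

/-- Numbers below `n` in binary. -/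
instance {n : ℕ} : BitEnc (Fin n) where
  Idx := Fin n.size
  finite := inferInstance
  enc k i := (k : ℕ).testBit i
  inj k l h := Fin.ext (Nat.eq_of_testBit_eq fun i => by
    by_cases hi : i < n.size
    · exact congrFun h ⟨i, hi⟩
    · have hp : n < 2 ^ i := lt_of_lt_of_le (Nat.lt_size_self n)
        (Nat.pow_le_pow_right (by norm_num) (not_lt.1 hi))
      rw [Nat.testBit_lt_two_pow (k.2.trans hp), Nat.testBit_lt_two_pow (l.2.trans hp)])

/-- Residues modulo `q` in binary. -/
instance {q : ℕ} [NeZero q] : BitEnc (ZMod q) :=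
  comap (fun k : ZMod q => (⟨k.val, k.val_lt⟩ : Fin q))
    (fun _ _ h => ZMod.val_injective q (congrArg Fin.val h))

instance {α : Type} [BitEnc α] {s : Set α} : BitEnc s :=
  comap (Subtype.val : s → α) Subtype.val_injective

/-- A set of labels as its indicator vector. -/
instance {d : ℕ} : BitEnc (Finset (Fin d)) :=
  comap (fun s : Finset (Fin d) => fun i => decide (i ∈ s))
    (fun s t h => Finset.ext fun i => by simpa using congrFun h i)

/-- A permutation as its table. -/
instance {d : ℕ} : BitEnc (Equiv.Perm (Fin d)) where
  Idx := Fin d × Fin d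
  finite := inferInstance
  enc σ i := decide (σ i.1 = i.2)
  inj σ τ h := Equiv.ext fun i => by
    have := congrFun h (i, σ i)
    simpa [eq_comm] using this

/-- An affine point by its coordinates, preceded by a bit marking the point at infinity. -/
instance {p : ℕ} [NeZero p] {W : WeierstrassCurve (ZMod p)} : BitEnc W.toAffine.Point :=
  comap (β := Option (ZMod p × ZMod p))
    (fun P => match P with
      | .zero => none
      | .some x y _ => some (x, y))
    (by
      rintro (_ | ⟨x, y, h⟩) (_ | ⟨x', y', h'⟩) e
      · rfl
      · simp at e
      · simp at e
      · simp only [Option.some.injEq, Prod.mk.injEq] at e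
        obtain ⟨rfl, rfl⟩ := e
        rfl)

end BitEnc

/-- Bit strings of length `ℓ`. -/
abbrev BitString (ℓ : ℕ) : Type := Fin ℓ → Bool

/-! ### EC-ElGamal -/

/-- A point `B` of prime order `q` on an elliptic curve over the field with `p` elements, and a
plaintext space of residues modulo `q` that contains `0` and `1`. -/
structure ECParams where
  p : ℕ
  [p_prime : Fact p.Prime]
  W : WeierstrassCurve (ZMod p)
  [elliptic : W.IsElliptic]
  B : W.toAffine.Point
  q : ℕ
  [q_prime : Fact q.Prime]
  order_B : addOrderOf B = q
  plain : Set (ZMod q)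
  zero_mem : 0 ∈ plain
  one_mem : 1 ∈ plain

attribute [instance] ECParams.p_prime ECParams.elliptic ECParams.q_prime

namespace ECParams

variable (G : ECParams)

/-- Points of the curve. -/
abbrev Pt : Type := G.W.toAffine.Point

/-- Scalars (private keys, nonces, plaintexts). -/
abbrev Scalar : Type := ZMod G.q

/-- Scalar multiplication of points. -/
def mul (k : G.Scalar) (X : G.Pt) : G.Pt := k.val • X

/-- Ciphertexts `(C₁, C₂)`. -/
abbrev Cipher : Type := G.Pt × G.Pt

/-- `Enc_K(x; r) = (r B, x B + r K)`. -/
def encrypt (K : G.Pt) (x r : G.Scalar) : G.Cipher :=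
  (G.mul r G.B, G.mul x G.B + G.mul r K)

/-- `n` independent uniform scalars from `{1, …, q - 1}`. -/
def nonces (n : ℕ) : PMF (Fin n → G.Scalar) :=
  PMF.uniformOfFinset (Fintype.piFinset fun _ => Finset.univ.filter fun k : G.Scalar => k ≠ 0)
    ⟨fun _ => 1, by simp⟩

/-- A uniform scalar from `{1, …, q - 1}`. -/
def nonce : PMF G.Scalar :=
  PMF.uniformOfFinset (Finset.univ.filter fun k : G.Scalar => k ≠ 0) ⟨1, by simp⟩

end ECParams

/-! ### Non-uniform probabilistic polynomial time -/

/-- Gates. Besides Boolean gates there are uniform random integers and the group operations of the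
curve, on encoded points. The latter are polynomial-time functions of their input bits, so counting
them as single gates changes the size of a circuit by a polynomial factor only. -/
inductive Gate (G : ECParams) : Type
  | const (b : Bool)
  | nand
  /-- a uniform integer from `{a, …, a + n}`, in binary -/
  | sample (a n : ℕ)
  | add
  | neg
  | smul

namespace Gate

variable {G : ECParams}

/-- Input ports of a gate. -/
abbrev In : Gate G → Type
  | const _ => Empty
  | nand => Bool
  | sample _ _ => Empty
  | add => BitEnc.Idx (G.Pt × G.Pt)
  | neg => BitEnc.Idx G.Pt
  | smul => BitEnc.Idx (G.Scalar × G.Pt)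

/-- Output ports of a gate. -/
abbrev Out : Gate G → Type
  | const _ => Unit
  | nand => Unit
  | sample a n => Fin (a + n).size
  | add => BitEnc.Idx G.Pt
  | neg => BitEnc.Idx G.Pt
  | smul => BitEnc.Idx G.Pt

def cost : Gate G → ℕ
  | sample a n => 1 + (a + n).size
  | _ => 1

def run : (g : Gate G) → (g.In → Bool) → PMF (g.Out → Bool)
  | const b, _ => PMF.pure fun _ => b
  | nand, x => PMF.pure fun _ => !(x false && x true)
  | sample a n, _ => (PMF.uniformOfFintype (Fin (n + 1))).map
      fun k (i : Fin (a + n).size) => (a + (k : ℕ)).testBit i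
  | add, x => PMF.pure (BitEnc.enc
      (let y : G.Pt × G.Pt := BitEnc.decD (0, 0) x; y.1 + y.2))
  | neg, x => PMF.pure (BitEnc.enc (-(BitEnc.decD (0 : G.Pt) x)))
  | smul, x => PMF.pure (BitEnc.enc
      (let y : G.Scalar × G.Pt := BitEnc.decD (0, 0) x; G.mul y.1 y.2))

end Gate

/-- Circuits with input wires `ι` and output wires `κ`: a sequence of gates, each reading existing
wires and adding its output wires, ended by a choice of the output wires. -/
inductive Circuit (G : ECParams) : Type → Type → Type 1
  | ret {ι κ : Type} (f : κ → ι) : Circuit G ι κ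
  | gate {ι κ : Type} (g : Gate G) (w : g.In → ι) (rest : Circuit G (ι ⊕ g.Out) κ) :
      Circuit G ι κ

namespace Circuit

variable {G : ECParams}

/-- Output distribution on a given input. -/
def eval : {ι κ : Type} → Circuit G ι κ → (ι → Bool) → PMF (κ → Bool)
  | _, _, ret f, x => PMF.pure (x ∘ f)
  | _, _, gate g w rest, x => (g.run (x ∘ w)).bind fun y => rest.eval (Sum.elim x y)

/-- Number of gates (weighted by their cost) plus length of the output. -/
def size : {ι κ : Type} → Circuit G ι κ → ℕ
  | _, κ, ret _ => Nat.card κ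
  | _, _, gate g _ rest => g.cost + rest.size

end Circuit

/-- `f z` is at most polynomial in `z`. -/
def PolyBounded (f : ℕ → ℕ) : Prop := ∃ c : ℕ, ∀ z, f z ≤ z ^ c + c

/-- A sequence of EC-ElGamal parameters, indexed by the security parameter `z`, over fields whose
elements have polynomially many bits. -/
structure ECFamily where
  at' : ℕ → ECParams
  poly : PolyBounded fun z => (at' z).p.size

instance : CoeFun ECFamily fun _ => ℕ → ECParams := ⟨ECFamily.at'⟩

/-- Probabilistic polynomial time with advice: the randomized functions `f z` are computed by
probabilistic circuits of size polynomial in `z`. -/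
def PPT (𝓔 : ECFamily) {α β : ℕ → Type} [∀ z, BitEnc (α z)] [∀ z, BitEnc (β z)]
    (f : ∀ z, α z → PMF (β z)) : Prop :=
  ∃ c : ∀ z, Circuit (𝓔 z) (BitEnc.Idx (α z)) (BitEnc.Idx (β z)),
    (PolyBounded fun z => (c z).size) ∧
    ∀ z a, (c z).eval (BitEnc.enc a) = (f z a).map BitEnc.enc

/-- `f` tends to zero faster than every inverse polynomial in `z`. -/
def Negligible (f : ℕ → ℝ) : Prop :=
  Asymptotics.SuperpolynomialDecay atTop (fun z : ℕ => (z : ℝ)) f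

/-- Computational indistinguishability of two ensembles. -/
def CompIndist (𝓔 : ECFamily) {α : ℕ → Type} [∀ z, BitEnc (α z)] (X Y : ∀ z, PMF (α z)) : Prop :=
  ∀ T : ∀ z, α z → PMF Bool, PPT 𝓔 T →
    Negligible fun z =>
      |(((X z).bind (T z)) true).toReal - (((Y z).bind (T z)) true).toReal|

/-! ### The assumptions -/

/-- `(a B, b B, a b B)`, with `a` and `b` uniform modulo `q`. -/
def ddhTriple (G : ECParams) : PMF (G.Pt × G.Pt × G.Pt) := do
  let a ← PMF.uniformOfFintype G.Scalar
  let b ← PMF.uniformOfFintype G.Scalar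
  return (G.mul a G.B, G.mul b G.B, G.mul (a * b) G.B)

/-- `(a B, b B, c B)`, with `a`, `b` and `c` uniform modulo `q`. -/
def randomTriple (G : ECParams) : PMF (G.Pt × G.Pt × G.Pt) := do
  let a ← PMF.uniformOfFintype G.Scalar
  let b ← PMF.uniformOfFintype G.Scalar
  let c ← PMF.uniformOfFintype G.Scalar
  return (G.mul a G.B, G.mul b G.B, G.mul c G.B)

/-- The decisional Diffie-Hellman assumption. -/
def DDH (𝓔 : ECFamily) : Prop :=
  CompIndist 𝓔 (fun z => ddhTriple (𝓔 z)) (fun z => randomTriple (𝓔 z))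

/-- The game of semantic security: the adversary sees the public key, chooses two plaintexts and
keeps a state; it then receives an encryption of the plaintext number `b` and makes a guess. -/
def semGame (G : ECParams) {ℓ : ℕ}
    (choose : G.Pt → PMF ((G.plain × G.plain) × BitString ℓ))
    (guess : BitString ℓ × G.Cipher → PMF Bool) (b : Bool) : PMF Bool := do
  let k ← G.nonce
  let K := G.mul k G.B
  let ((x₀, x₁), st) ← choose K
  let r ← G.nonce
  guess (st, G.encrypt K (if b then x₁.1 else x₀.1) r)

/-- EC-ElGamal is semantically secure. -/
def SemanticallySecure (𝓔 : ECFamily) : Prop :=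
  ∀ (ℓ : ℕ → ℕ)
    (choose : ∀ z, (𝓔 z).Pt → PMF (((𝓔 z).plain × (𝓔 z).plain) × BitString (ℓ z)))
    (guess : ∀ z, BitString (ℓ z) × (𝓔 z).Cipher → PMF Bool),
    PPT 𝓔 choose → PPT 𝓔 guess →
    Negligible fun z =>
      |((semGame (𝓔 z) (choose z) (guess z) true) true).toReal -
        ((semGame (𝓔 z) (choose z) (guess z) false) true).toReal|

/-! ### Datasets and the ideal functionality -/

/-- The common inputs: the number `d` of labels of the domain, the dataset size `N`, the partial
view size `V`. Multiplicities in submitted datasets are transmitted as numbers below `cap + 2`. -/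
structure Common where
  d : ℕ
  N : ℕ
  V : ℕ
  cap : ℕ
  V_le : V ≤ N
  N_le : N ≤ d

namespace Common

variable (c : Common)

/-- Labels of the domain, in their public enumeration. -/
abbrev Label : Type := Fin c.d

/-- Histograms over the domain; also the flags `(f_j)` of a list of labelled flags. -/
abbrev Hist : Type := c.Label → Fin (c.cap + 2)

variable {c}

/-- Exactly `N` records, without repetition. -/
def WellFormed (D : c.Hist) : Prop :=
  (∀ i, (D i : ℕ) ≤ 1) ∧ ∑ i, (D i : ℕ) = c.N

/-- The labels that occur in `D`. -/
def records (D : c.Hist) : Finset c.Label := Finset.univ.filter fun i => (D i : ℕ) = 1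

theorem WellFormed.card {D : c.Hist} (h : WellFormed D) : (records D).card = c.N := by
  rw [← h.2, records, Finset.card_filter]
  refine Finset.sum_congr rfl fun i _ => ?_
  have := h.1 i
  split_ifs <;> omega

/-- What a server outputs: `none` for the message "invalid dataset", or else the membership bits
`(b_l)` of the labels `l` in the background knowledge `L`, given as the set of all `l` in `L` with
`b_l = 1`. -/
abbrev Answer (c : Common) : Type := Option (Finset c.Label)

/-- The trusted party: it checks the submitted dataset, samples `V` of its records at random, and
answers the queries for the labels in `L`. -/
def trusted (D : c.Hist) (L : Finset c.Label) : PMF c.Answer :=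
  open Classical in
  if h : WellFormed D then
    (PMF.uniformOfFinset ((records D).powersetCard c.V)
      (Finset.powersetCard_nonempty.2 (h.card.symm ▸ c.V_le))).map fun S => some (L ∩ S)
  else PMF.pure none

end Common

/-- The two servers. -/
inductive Server
  | S₁
  | S₂
  deriving DecidableEq

/-- The outputs of `S₁`, of `S₂` (absent for a corrupted server), and of the adversary on behalf of
the participant and of the corrupted server. The honest participant has no output. -/
abbrev ExecOut (c : Common) (ℓB ℓC : ℕ) : Type :=
  (Option c.Answer × Option c.Answer) × (Option (BitString ℓB) × Option (BitString ℓC))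

/-- Assemble the outputs, when the participant is corrupted if `cP`, and the server `cS` is. -/
def mkOut {c : Common} {ℓB ℓC : ℕ} (cP : Bool) (cS : Option Server) (a₁ a₂ : c.Answer)
    (outB : BitString ℓB) (outC : BitString ℓC) : ExecOut c ℓB ℓC :=
  ((if cS = some .S₁ then none else some a₁, if cS = some .S₂ then none else some a₂),
    (if cP then some outB else none, if cS.isSome then some outC else none))

/-- The ideal execution. The adversary sees the inputs of the corrupted parties and its auxiliary
input `aux`, submits a dataset if the participant is corrupted, sees the answers of the trusted
party if a server is corrupted (which queries all labels of `L`, being honest-but-curious), and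
makes its outputs. -/
def ideal {c : Common} {ℓa ℓs ℓB ℓC : ℕ} (cP : Bool) (cS : Option Server)
    (submit : (Option c.Hist × Option (Finset c.Label)) × BitString ℓa →
      PMF (c.Hist × BitString ℓs))
    (finish : BitString ℓs × Option c.Answer → PMF (BitString ℓB × BitString ℓC))
    (D : c.Hist) (L : Finset c.Label) (aux : BitString ℓa) : PMF (ExecOut c ℓB ℓC) := do
  let (D', st) ← submit ((if cP then some D else none, if cS.isSome then some L else none), aux)
  let a ← Common.trusted (if cP then D' else D) L
  let (outB, outC) ← finish (st, if cS.isSome then some a else none)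
  return mkOut cP cS a a outB outC

/-! ### The protocol -/

section Protocol

variable (G : ECParams) (c : Common)

/-- What `P` sends: the list of flags, `flags j` being attached to the shuffled label `j`, to `S₁`,
and the inverse permutation `σ⁻¹` to `S₂`. -/
abbrev PMsg : Type := c.Hist × Equiv.Perm c.Label

/-- The honest participant: a random `σ`, the pairs `(σ i, f_i)`, and `σ⁻¹`. -/
def honestP (D : c.Hist) : PMF (PMsg c) :=
  (PMF.uniformOfFintype (Equiv.Perm c.Label)).map fun σ => (fun j => D (σ⁻¹ j), σ⁻¹)

/-- A uniform `N`-element binary vector of Hamming weight `V`. -/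
def sampleVector : PMF (Fin c.N → Bool) :=
  PMF.uniformOfFinset
    (Finset.univ.filter fun u : Fin c.N → Bool =>
      (Finset.univ.filter fun k => u k = true).card = c.V)
    (by
      obtain ⟨s, -, hs⟩ := Finset.exists_subset_card_eq
        (s := (Finset.univ : Finset (Fin c.N))) (n := c.V) (by simpa using c.V_le)
      exact ⟨fun k => decide (k ∈ s), by simpa using hs⟩)

variable {G c}

/-- How many elements of the vector are popped before the pair with label `j` is treated. -/
def popIndex (flags : c.Hist) (j : c.Label) : ℕ :=
  (Finset.univ.filter fun j' => j' < j ∧ (flags j' : ℕ) = 1).card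

/-- The list of encrypted flags that `S₁` computes from the flags, the vector `u`, the nonces `ρ` of
the encryption of `u`, and the nonces `ζ` of the encryptions of zero. -/
def encFlags (K : G.Pt) (flags : c.Hist) (u : Fin c.N → Bool) (ρ : Fin c.N → G.Scalar)
    (ζ : c.Label → G.Scalar) (j : c.Label) : G.Cipher :=
  if h : (flags j : ℕ) = 1 ∧ popIndex flags j < c.N then
    G.encrypt K (if u ⟨popIndex flags j, h.2⟩ then 1 else 0) (ρ ⟨popIndex flags j, h.2⟩)
  else G.encrypt K 0 (ζ j)

/-- The partial view: `S₂` adds fresh encryptions of zero with nonces `τ` and moves the entry with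
label `j` to the label `π j`. -/
def partialView (K : G.Pt) (lbs : c.Label → G.Cipher) (π : Equiv.Perm c.Label)
    (τ : c.Label → G.Scalar) (i : c.Label) : G.Cipher :=
  lbs (π.symm i) + G.encrypt K 0 (τ (π.symm i))

/-- A partial decryption `C₂ - k C₁`, given `C₂` (or the preceding partial decryption) and `C₁`. -/
def partialDec (k : G.Scalar) (C₂ C₁ : G.Pt) : G.Pt := C₂ - G.mul k C₁

/-- The view of `S₁`: its input, its private key and random choices, the other public key, the
flags received from `P`, and, unless the dataset is invalid, the partial view received from `S₂`,
the partial decryptions received from `S₂` (if `S₁` decrypts last), and the decrypted bits. -/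
structure View₁ (G : ECParams) (c : Common) where
  L : Finset c.Label
  k₁ : G.Scalar
  K₂ : G.Pt
  flags : c.Hist
  u : Fin c.N → Bool
  ρ : Fin c.N → G.Scalar
  ζ : c.Label → G.Scalar
  rest : Option ((c.Label → G.Cipher) × (c.Label → Option G.Pt) × Finset c.Label)

instance : BitEnc (View₁ G c) :=
  BitEnc.comap (fun v => (v.L, v.k₁, v.K₂, v.flags, v.u, v.ρ, v.ζ, v.rest)) (by
    rintro ⟨⟩ ⟨⟩ h
    simpa using h)

/-- The view of `S₂`: its input, its private key and random choices, the other public key, the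
permutation received from `P`, and, unless it is told that the dataset is invalid, the encrypted
flags received from `S₁`, the partial decryptions received from `S₁` (if `S₂` decrypts last), and
the decrypted bits. -/
structure View₂ (G : ECParams) (c : Common) where
  L : Finset c.Label
  k₂ : G.Scalar
  K₁ : G.Pt
  π : Equiv.Perm c.Label
  τ : c.Label → G.Scalar
  rest : Option ((c.Label → G.Cipher) × (c.Label → Option G.Pt) × Finset c.Label)

instance : BitEnc (View₂ G c) :=
  BitEnc.comap (fun v => (v.L, v.k₂, v.K₁, v.π, v.τ, v.rest)) (by
    rintro ⟨⟩ ⟨⟩ h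
    simpa using h)

/-- The real execution with a (possibly) malicious participant `advB`, who may deviate in its choice
of the dataset and of the permutation, and an honest-but-curious server `cS`, whose view is given to
`adv₁` or `adv₂`. In the threshold decryption the server `last` decrypts last and tells the other
server the result. -/
def real {ℓa ℓB ℓC : ℕ} (last : Server) (cP : Bool) (cS : Option Server)
    (advB : c.Hist × BitString ℓa × G.Pt × G.Pt → PMF (PMsg c × BitString ℓB))
    (adv₁ : View₁ G c × BitString ℓa → PMF (BitString ℓC))
    (adv₂ : View₂ G c × BitString ℓa → PMF (BitString ℓC))
    (D : c.Hist) (L : Finset c.Label) (aux : BitString ℓa) : PMF (ExecOut c ℓB ℓC) :=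
  open Classical in do
  let k₁ ← G.nonce
  let k₂ ← G.nonce
  let K₁ := G.mul k₁ G.B
  let K₂ := G.mul k₂ G.B
  let K := K₁ + K₂
  let ((flags, π), outB) ←
    if cP then advB (D, aux, K₁, K₂) else (honestP c D).map fun m => (m, (fun _ => false : BitString ℓB))
  let u ← sampleVector c
  let ρ ← G.nonces c.N
  let ζ ← G.nonces c.d
  let τ ← G.nonces c.d
  let lbs := encFlags K flags u ρ ζ
  let pv := partialView K lbs π τ
  let first₁ : c.Label → G.Pt := fun l => partialDec k₁ (pv l).2 (pv l).1
  let first₂ : c.Label → G.Pt := fun l => partialDec k₂ (pv l).2 (pv l).1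
  let plainPt : c.Label → G.Pt := fun l =>
    if last = .S₁ then partialDec k₁ (first₂ l) (pv l).1 else partialDec k₂ (first₁ l) (pv l).1
  let bits : Finset c.Label := L.filter fun l => plainPt l = G.B
  let answer : c.Answer := if Common.WellFormed flags then some bits else none
  let view₁ : View₁ G c := ⟨L, k₁, K₂, flags, u, ρ, ζ, answer.map fun bits =>
    (pv, fun l => if last = .S₁ ∧ l ∈ L then some (first₂ l) else none, bits)⟩
  let view₂ : View₂ G c := ⟨L, k₂, K₁, π, τ, answer.map fun bits =>
    (lbs, fun l => if last = .S₂ ∧ l ∈ L then some (first₁ l) else none, bits)⟩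
  let outC ← match cS with
    | none => PMF.pure (fun _ => false : BitString ℓC)
    | some .S₁ => adv₁ (view₁, aux)
    | some .S₂ => adv₂ (view₂, aux)
  return mkOut cP cS answer answer outB outC

end Protocol

/-- Common inputs for every value of the security parameter, of polynomial size. -/
structure CommonFamily where
  at' : ℕ → Common
  poly_d : PolyBounded fun z => (at' z).d
  poly_cap : PolyBounded fun z => (at' z).cap.size

instance : CoeFun CommonFamily fun _ => ℕ → Common := ⟨CommonFamily.at'⟩

/-- The protocol securely computes the ideal functionality: for all probabilistic polynomial time
real adversaries (any malicious participant, any one honest-but-curious server, or both) there is a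
probabilistic polynomial time ideal adversary such that, for all inputs, the two executions have
computationally indistinguishable outputs. -/
def SecurelyCollects (𝓔 : ECFamily) (C : CommonFamily) (last : Server) : Prop :=
  ∀ (cP : Bool) (cS : Option Server) (ℓa ℓB ℓC : ℕ → ℕ)
    (advB : ∀ z, (C z).Hist × BitString (ℓa z) × (𝓔 z).Pt × (𝓔 z).Pt →
      PMF (PMsg (C z) × BitString (ℓB z)))
    (adv₁ : ∀ z, View₁ (𝓔 z) (C z) × BitString (ℓa z) → PMF (BitString (ℓC z)))
    (adv₂ : ∀ z, View₂ (𝓔 z) (C z) × BitString (ℓa z) → PMF (BitString (ℓC z))),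
    PolyBounded ℓa → PPT 𝓔 advB → PPT 𝓔 adv₁ → PPT 𝓔 adv₂ →
    ∃ (ℓs : ℕ → ℕ)
      (submit : ∀ z, (Option (C z).Hist × Option (Finset (C z).Label)) × BitString (ℓa z) →
        PMF ((C z).Hist × BitString (ℓs z)))
      (finish : ∀ z, BitString (ℓs z) × Option (C z).Answer →
        PMF (BitString (ℓB z) × BitString (ℓC z))),
      PPT 𝓔 submit ∧ PPT 𝓔 finish ∧
      ∀ (D : ∀ z, (C z).Hist) (L : ∀ z, Finset (C z).Label) (aux : ∀ z, BitString (ℓa z)),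
        (∀ z, Common.WellFormed (D z)) →
        CompIndist 𝓔
          (fun z => ideal cP cS (submit z) (finish z) (D z) (L z) (aux z))
          (fun z => real last cP cS (advB z) (adv₁ z) (adv₂ z) (D z) (L z) (aux z))

end PartialView

end

open Filter

noncomputable section

namespace PartialView

section

attribute [instance] BitEnc.finite

/-! From DDH to semantic security: a challenge triple (aB, bB, Z) supplies the public key, the first
ciphertext component and the mask of the plaintext. A Diffie-Hellman triple gives the game itself,
except that the scalars may be zero, which costs O(1/q); a random triple hides the plaintext
perfectly (`DDH.semanticallySecure`). Each of the two assumptions forces 1/q to be negligible, since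
otherwise a test for the zero point would break it (`DDH.negligible_inv_q`,
`SemanticallySecure.negligible_inv_q`).

For the protocol, `real_eq` gives a normal form of the execution. The ciphertext with label i
encrypts [i ∈ S], where, for valid flags, S is a uniform V-subset of the records of the dataset
flags ∘ π⁻¹. The partial decryption sent by an honest server equals xB + kC₁, where x is the
decrypted bit and k the key of the corrupted server. So a corrupted server's view is a function of
its own key and randomness, the other public key, the answer and the ciphertexts.

The simulator draws both keys and plays or runs the participant. If the participant is malicious,
both of its messages are known, so the dataset can be extracted and submitted, and S can be
resampled exactly, conditionally on the answer (`refill_bind`). The one discrepancy is that the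
partial view carries sums of nonces instead of fresh nonzero nonces, a statistical error of at most
2d/q (`abs_pr_malicious_sub_le`).

If the participant is honest, the simulator uses a fixed dataset D₀ and encrypts the answer L ∩ S in
place of S. The permutation seen by `S₂` is independent of S; for `S₁`, a symmetry argument shows
that, for each fixed vector u, the flags and S are independent and uniform (`map_flags_chosen`), so
the flags of D₀ serve as well. What remains is to exchange plaintexts. A hybrid argument over the d
ciphertexts (`SemanticallySecure.exists_bound_vector`) reduces this to semantic security for the
honest server's key K': adding kC₁ to C₂ turns a ciphertext under K' into one under kB + K'.

Efficiency is handled by `Eff`, which is closed under the needed constructions and is stated for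
families over arbitrary index types. One polynomial serves all members, so a worst member can be
chosen for each security parameter and its data given to the circuit as advice
(`SemanticallySecure.exists_bound`). Circuits must realize output distributions exactly; this is why
permutations and subsets are generated from uniform integers by a shuffle and by `pick`. -/

theorem BitEnc.finite_type (α : Type) [BitEnc α] : Finite α :=
  Finite.of_injective (BitEnc.enc (α := α)) BitEnc.inj

theorem BitEnc.decD_enc {α : Type} [BitEnc α] (x a : α) :
    BitEnc.decD x (BitEnc.enc a) = a := by
  simp [BitEnc.decD, BitEnc.inj.extend_apply]

/-! ### Circuits -/

namespace Circuit

variable {G : ECParams}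

/-- The number of gates, without the length of the output. -/
def gates : {ι κ : Type} → Circuit G ι κ → ℕ
  | _, _, ret _ => 0
  | _, _, gate g _ rest => g.cost + rest.gates

/-- Gate counts add up exactly under composition, while sizes would count intermediate outputs
again. Efficiency is therefore measured in gates, and the output length is added only at the end. -/
theorem size_eq : {ι κ : Type} → (C : Circuit G ι κ) → C.size = C.gates + Nat.card κ
  | _, _, ret _ => by simp [size, gates]
  | _, _, gate g _ rest => by simp [size, gates, size_eq rest, add_assoc]

/-- Rename the input wires. -/
def rename : {ι κ : Type} → Circuit G ι κ → {ι' : Type} → (ι → ι') → Circuit G ι' κ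
  | _, _, ret f, _, r => ret (r ∘ f)
  | _, _, gate g w rest, _, r => gate g (r ∘ w) (rest.rename (Sum.map r id))

theorem gates_rename : {ι κ : Type} → (C : Circuit G ι κ) → {ι' : Type} → (r : ι → ι') →
    (C.rename r).gates = C.gates
  | _, _, ret _, _, _ => rfl
  | _, _, gate g w rest, _, r => by simp [rename, gates, gates_rename rest]

theorem eval_rename : {ι κ : Type} → (C : Circuit G ι κ) → {ι' : Type} → (r : ι → ι') →
    (x : ι' → Bool) → (C.rename r).eval x = C.eval (x ∘ r)
  | _, _, ret _, _, _, _ => rfl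
  | _, _, gate g w rest, _, r, x => by
    simp only [rename, eval, eval_rename rest]
    congr 1
    funext y
    congr 1
    funext i
    cases i <;> rfl

/-- Run a circuit, then a second one that reads the inputs and the outputs of the first. -/
def bind : {ι κ : Type} → Circuit G ι κ → {μ : Type} → Circuit G (ι ⊕ κ) μ → Circuit G ι μ
  | _, _, ret f, _, D => D.rename (Sum.elim id f)
  | _, _, gate g w rest, _, D => gate g w (rest.bind (D.rename (Sum.map Sum.inl id)))

theorem gates_bind : {ι κ : Type} → (C : Circuit G ι κ) → {μ : Type} →
    (D : Circuit G (ι ⊕ κ) μ) → (C.bind D).gates = C.gates + D.gates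
  | _, _, ret _, _, D => by simp [bind, gates, gates_rename]
  | _, _, gate g w rest, _, D => by
    simp [bind, gates, gates_rename, gates_bind rest, add_assoc]

theorem eval_bind : {ι κ : Type} → (C : Circuit G ι κ) → {μ : Type} →
    (D : Circuit G (ι ⊕ κ) μ) → (x : ι → Bool) →
    (C.bind D).eval x = (C.eval x).bind fun y => D.eval (Sum.elim x y)
  | _, _, ret f, _, D, x => by
    simp only [bind, eval, eval_rename, PMF.pure_bind]
    congr 1
    funext i
    cases i <;> rfl
  | _, _, gate g w rest, _, D, x => by
    simp only [bind, eval, eval_bind rest, PMF.bind_bind, eval_rename]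
    congr 1
    funext y
    congr 1
    funext y'
    congr 1
    funext i
    rcases i with i | i <;> rfl

/-- Rename the output wires. -/
def select {ι κ κ' : Type} (C : Circuit G ι κ) (r : κ' → κ) : Circuit G ι κ' :=
  C.bind (ret (Sum.inr ∘ r))

theorem gates_select {ι κ κ' : Type} (C : Circuit G ι κ) (r : κ' → κ) :
    (C.select r).gates = C.gates := by
  simp [select, gates_bind, gates]

theorem eval_select {ι κ κ' : Type} (C : Circuit G ι κ) (r : κ' → κ) (x : ι → Bool) :
    (C.select r).eval x = (C.eval x).map fun y => y ∘ r := by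
  simp only [select, eval_bind, eval, PMF.map]
  rfl

end Circuit

/-- Independent samples from distributions `p 0, …, p (n - 1)`. -/
def seqPMF {β : Type} : (n : ℕ) → (Fin n → PMF β) → PMF (Fin n → β)
  | 0, _ => PMF.pure Fin.elim0
  | n + 1, p => (p 0).bind fun a => (seqPMF n fun i => p i.succ).map (Fin.cons a)

theorem seqPMF_pure {β : Type} : (n : ℕ) → (v : Fin n → β) →
    seqPMF n (fun i => PMF.pure (v i)) = PMF.pure v
  | 0, v => by simp only [seqPMF]; congr 1; funext i; exact i.elim0
  | n + 1, v => by
    simp only [seqPMF, seqPMF_pure n, PMF.pure_bind, PMF.pure_map]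
    congr 1
    exact Fin.cons_self_tail v

theorem seqPMF_map {β γ : Type} (g : β → γ) : (n : ℕ) → (p : Fin n → PMF β) →
    (seqPMF n fun i => (p i).map g) = (seqPMF n p).map fun v => g ∘ v
  | 0, p => by
    simp only [seqPMF, PMF.pure_map]
    congr 1
    funext i
    exact i.elim0
  | n + 1, p => by
    simp only [seqPMF, seqPMF_map g n]
    simp only [PMF.map, PMF.bind_bind, PMF.pure_bind, Function.comp_def]
    congr 1
    funext a
    congr 1
    funext v
    congr 1
    funext i
    refine Fin.cases ?_ (fun i => ?_) i <;> simp

namespace Circuit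

variable {G : ECParams}

/-- Run circuits on the same input, one after the other. -/
def vec {ι κ : Type} : (n : ℕ) → (Fin n → Circuit G ι κ) → Circuit G ι (Fin n × κ)
  | 0, _ => ret fun i => i.1.elim0
  | n + 1, C => (C 0).bind (((vec n fun i => C i.succ).rename Sum.inl).bind
      (ret fun i => Fin.cases (Sum.inl (Sum.inr i.2)) (fun k => Sum.inr (k, i.2)) i.1))

theorem gates_vec_le {ι κ : Type} {s : ℕ} : (n : ℕ) → (C : Fin n → Circuit G ι κ) →
    (∀ i, (C i).gates ≤ s) → (vec n C).gates ≤ n * s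
  | 0, _, _ => by simp [vec, gates]
  | n + 1, C, h => by
    have := gates_vec_le n (fun i => C i.succ) fun i => h i.succ
    have := h 0
    simp only [vec, gates_bind, gates_rename, gates]
    linarith [Nat.succ_mul n s]

theorem eval_vec {ι κ : Type} (x : ι → Bool) : (n : ℕ) → (C : Fin n → Circuit G ι κ) →
    (vec n C).eval x = (seqPMF n fun i => (C i).eval x).map fun v i => v i.1 i.2
  | 0, _ => by
    simp only [vec, eval, seqPMF, PMF.pure_map]
    congr 1
    funext i
    exact i.1.elim0
  | n + 1, C => by
    simp only [vec, eval_bind, eval_rename, eval, seqPMF, Sum.elim_comp_inl, eval_vec x n]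
    simp only [PMF.map, PMF.bind_bind, PMF.pure_bind, Function.comp_def]
    congr 1
    funext y
    congr 1
    funext v
    congr 1
    funext ⟨i, k⟩
    refine Fin.cases ?_ (fun i => ?_) i <;> simp

/-- Run circuits that update a state. -/
def iter {ι κ : Type} (C : Circuit G ι κ) {n : ℕ} (D : Fin n → Circuit G (ι ⊕ κ) κ) :
    (m : ℕ) → m ≤ n → Circuit G ι κ
  | 0, _ => C
  | m + 1, h => (C.iter D m (Nat.le_of_succ_le h)).bind (D ⟨m, h⟩)

theorem gates_iter_le {ι κ : Type} (C : Circuit G ι κ) {n s : ℕ}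
    (D : Fin n → Circuit G (ι ⊕ κ) κ) (hD : ∀ i, (D i).gates ≤ s) :
    (m : ℕ) → (h : m ≤ n) → (C.iter D m h).gates ≤ C.gates + m * s
  | 0, _ => by simp [iter]
  | m + 1, h => by
    have := gates_iter_le C D hD m (Nat.le_of_succ_le h)
    have := hD ⟨m, h⟩
    simp only [iter, gates_bind]
    linarith [Nat.succ_mul m s]

end Circuit

/-- Iterate a randomized update of a state. -/
def iterPMF {α : Type} (p : PMF α) {n : ℕ} (step : Fin n → α → PMF α) : (m : ℕ) → m ≤ n → PMF α
  | 0, _ => p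
  | m + 1, h => (iterPMF p step m (Nat.le_of_succ_le h)).bind (step ⟨m, h⟩)

/-! ### Polynomial bounds -/

/-- `f j` is at most polynomial in the security parameter `κ j`. -/
def PB {J : Type} (κ f : J → ℕ) : Prop := ∃ c : ℕ, ∀ j, f j ≤ κ j ^ c + c

namespace PB

variable {J : Type} {κ f g : J → ℕ}

theorem mono (hg : PB κ g) (h : ∀ j, f j ≤ g j) : PB κ f :=
  hg.imp fun _ hc j => (h j).trans (hc j)

theorem const (n : ℕ) : PB κ fun _ => n := ⟨n, fun _ => Nat.le_add_left _ _⟩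

theorem of_le {a b k : ℕ} (h : ∀ j, f j ≤ a * κ j ^ k + b) : PB κ f := by
  refine ⟨a + b + k + 1, fun j => (h j).trans ?_⟩
  -- Powers of 0 and 1 do not grow, so there the additive constant must absorb everything; from 2
  -- on, a ≤ κ ^ a absorbs the factor.
  rcases Nat.lt_or_ge (κ j) 2 with h2 | h2
  · have : κ j ^ k ≤ 1 := by
      have : κ j ≤ 1 := by omega
      exact (Nat.pow_le_pow_left this k).trans (by simp)
    calc a * κ j ^ k + b ≤ a * 1 + b := by gcongr
      _ ≤ _ := by omega
  · have h3 : a ≤ κ j ^ a := (Nat.lt_two_pow_self).le.trans (Nat.pow_le_pow_left h2 a)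
    have h4 : a * κ j ^ k ≤ κ j ^ (a + b + k + 1) := by
      calc a * κ j ^ k ≤ κ j ^ a * κ j ^ k := Nat.mul_le_mul_right _ h3
        _ = κ j ^ (a + k) := (pow_add _ _ _).symm
        _ ≤ _ := Nat.pow_le_pow_right (by omega) (by omega)
    omega

/-- The base κ + 2 is at least 2, so a pure power suffices as a bound. In this form products add
exponents and a sum costs one more factor. -/
theorem exists_pow (hf : PB κ f) : ∃ c, ∀ j, f j ≤ (κ j + 2) ^ c := by
  obtain ⟨c, hc⟩ := hf
  refine ⟨c + 1, fun j => (hc j).trans ?_⟩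
  have h1 : κ j ^ c ≤ (κ j + 2) ^ c := Nat.pow_le_pow_left (by omega) c
  have h2 : c ≤ (κ j + 2) ^ c :=
    (Nat.lt_two_pow_self).le.trans (Nat.pow_le_pow_left (by omega) c)
  calc κ j ^ c + c ≤ (κ j + 2) ^ c * 2 := by omega
    _ ≤ (κ j + 2) ^ c * (κ j + 2) := Nat.mul_le_mul_left _ (by omega)
    _ = _ := (pow_succ _ _).symm

theorem of_pow {c : ℕ} (h : ∀ j, f j ≤ (κ j + 2) ^ c) : PB κ f := by
  refine of_le (a := 3 ^ c) (b := 3 ^ c) (k := c) fun j => (h j).trans ?_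
  rcases Nat.eq_zero_or_pos (κ j) with h0 | h0
  · rw [h0]
    exact (Nat.pow_le_pow_left (by omega) c).trans (Nat.le_add_left _ _)
  · calc (κ j + 2) ^ c ≤ (3 * κ j) ^ c := Nat.pow_le_pow_left (by omega) c
      _ = 3 ^ c * κ j ^ c := mul_pow _ _ _
      _ ≤ _ := Nat.le_add_right _ _

theorem mul (hf : PB κ f) (hg : PB κ g) : PB κ fun j => f j * g j := by
  obtain ⟨a, ha⟩ := hf.exists_pow
  obtain ⟨b, hb⟩ := hg.exists_pow
  exact of_pow (c := a + b) fun j => by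
    rw [pow_add]
    exact Nat.mul_le_mul (ha j) (hb j)

theorem add (hf : PB κ f) (hg : PB κ g) : PB κ fun j => f j + g j := by
  obtain ⟨a, ha⟩ := hf.exists_pow
  obtain ⟨b, hb⟩ := hg.exists_pow
  refine of_pow (c := a + b + 1) fun j => ?_
  have h1 : (κ j + 2) ^ a ≤ (κ j + 2) ^ (a + b) := Nat.pow_le_pow_right (by omega) (by omega)
  have h2 : (κ j + 2) ^ b ≤ (κ j + 2) ^ (a + b) := Nat.pow_le_pow_right (by omega) (by omega)
  calc f j + g j ≤ (κ j + 2) ^ (a + b) * 2 := by have := ha j; have := hb j; omega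
    _ ≤ (κ j + 2) ^ (a + b) * (κ j + 2) := Nat.mul_le_mul_left _ (by omega)
    _ = _ := (pow_succ _ _).symm

theorem reindex {J' : Type} (hf : PB κ f) (h : J' → J) : PB (fun i => κ (h i)) fun i => f (h i) :=
  hf.imp fun _ hc i => hc (h i)

end PB

end

section

/-! ### Efficient families of randomized functions -/

/-- The randomized functions `f j` are computed by circuits whose number of gates is polynomial in
the security parameter `κ j`. -/
def Eff {J : Type} (κ : J → ℕ) (G : J → ECParams) {α β : J → Type} [∀ j, BitEnc (α j)]
    [∀ j, BitEnc (β j)] (f : ∀ j, α j → PMF (β j)) : Prop :=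
  ∃ s : J → ℕ, PB κ s ∧ ∀ j, ∃ C : Circuit (G j) (BitEnc.Idx (α j)) (BitEnc.Idx (β j)),
    C.gates ≤ s j ∧ ∀ a, C.eval (BitEnc.enc a) = (f j a).map BitEnc.enc

/-- Efficient deterministic functions. -/
def EffD {J : Type} (κ : J → ℕ) (G : J → ECParams) {α β : J → Type} [∀ j, BitEnc (α j)]
    [∀ j, BitEnc (β j)] (f : ∀ j, α j → β j) : Prop :=
  Eff κ G fun j a => PMF.pure (f j a)

open Classical in
/-- Efficiently decidable predicates. -/
def EffP {J : Type} (κ : J → ℕ) (G : J → ECParams) {α : J → Type} [∀ j, BitEnc (α j)]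
    (P : ∀ j, α j → Prop) : Prop :=
  EffD κ G (β := fun _ => Bool) fun j a => decide (P j a)

/-- The encoding of `α j` has polynomial length. -/
def PBC {J : Type} (κ : J → ℕ) (α : J → Type) [∀ j, BitEnc (α j)] : Prop :=
  PB κ fun j => Nat.card (BitEnc.Idx (α j))

variable {J : Type} {κ : J → ℕ} {G : J → ECParams} {Γ α β γ : J → Type}
  [∀ j, BitEnc (Γ j)] [∀ j, BitEnc (α j)] [∀ j, BitEnc (β j)] [∀ j, BitEnc (γ j)]

namespace Eff

/-- The index type is arbitrary so that a sum type such as `Σ j, Fin (n j)` can index the components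
or steps of a construction, all bounded by one polynomial. Data in the index are advice, which a
circuit may depend on at will. -/
theorem reindex {J' : Type} {f : ∀ j, α j → PMF (β j)} (hf : Eff κ G f) (h : J' → J) :
    Eff (fun i => κ (h i)) (fun i => G (h i)) (α := fun i => α (h i)) (β := fun i => β (h i))
      fun i => f (h i) :=
  let ⟨s, hs, H⟩ := hf
  ⟨fun i => s (h i), hs.reindex h, fun i => H (h i)⟩

theorem bind {f : ∀ j, Γ j → PMF (α j)} {g : ∀ j, Γ j → α j → PMF (β j)} (hf : Eff κ G f)
    (hg : Eff κ G (α := fun j => Γ j × α j) fun j y => g j y.1 y.2) :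
    Eff κ G fun j x => (f j x).bind fun a => g j x a := by
  obtain ⟨s, hs, H⟩ := hf
  obtain ⟨t, ht, K⟩ := hg
  refine ⟨_, hs.add ht, fun j => ?_⟩
  obtain ⟨C, hC, hC'⟩ := H j
  obtain ⟨D, hD, hD'⟩ := K j
  refine ⟨C.bind D, by rw [Circuit.gates_bind]; exact Nat.add_le_add hC hD, fun a => ?_⟩
  rw [Circuit.eval_bind, hC', PMF.map_bind, PMF.bind_map]
  congr 1
  funext b
  exact hD' (a, b)

theorem comp {f : ∀ j, α j → PMF (β j)} {g : ∀ j, Γ j → α j} (hf : Eff κ G f)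
    (hg : EffD κ G g) : Eff κ G fun j x => f j (g j x) := by
  obtain ⟨s, hs, H⟩ := hg
  obtain ⟨t, ht, K⟩ := hf
  refine ⟨_, hs.add ht, fun j => ?_⟩
  obtain ⟨C, hC, hC'⟩ := H j
  obtain ⟨D, hD, hD'⟩ := K j
  refine ⟨C.bind (D.rename Sum.inr), by
    rw [Circuit.gates_bind, Circuit.gates_rename]; exact Nat.add_le_add hC hD, fun a => ?_⟩
  rw [Circuit.eval_bind, hC', PMF.pure_map, PMF.pure_bind, Circuit.eval_rename]
  exact hD' (g j a)

theorem iter {n : J → ℕ} (hn : PB κ n) {init : ∀ j, Γ j → PMF (α j)} (h0 : Eff κ G init)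
    {step : ∀ j, Fin (n j) → Γ j → α j → PMF (α j)}
    (hs : Eff (J := Σ j, Fin (n j)) (fun p => κ p.1) (fun p => G p.1)
      (α := fun p => Γ p.1 × α p.1) (β := fun p => α p.1) fun p y => step p.1 p.2 y.1 y.2) :
    Eff κ G fun j x => iterPMF (init j x) (fun i => step j i x) (n j) le_rfl := by
  obtain ⟨s, hs', H⟩ := h0
  obtain ⟨t, ⟨c, hc⟩, K⟩ := hs
  -- The same exponent c bounds every step circuit, since the steps form one family over the sum
  -- type.
  refine ⟨_, hs'.add (hn.mul (g := fun j => κ j ^ c + c) ⟨c, fun _ => le_rfl⟩), fun j => ?_⟩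
  obtain ⟨C, hC, hC'⟩ := H j
  choose D hD hD' using fun i => K ⟨j, i⟩
  refine ⟨C.iter D _ le_rfl, (Circuit.gates_iter_le C D (fun i => (hD i).trans (hc ⟨j, i⟩)) _
    le_rfl).trans (Nat.add_le_add_right hC _), fun a => ?_⟩
  have key : ∀ m (h : m ≤ n j), (C.iter D m h).eval (BitEnc.enc a) =
      (iterPMF (init j a) (fun i => step j i a) m h).map BitEnc.enc := by
    intro m
    induction m with
    | zero => intro h; exact hC' a
    | succ m ih =>
      intro h
      rw [Circuit.iter, Circuit.eval_bind, ih, iterPMF, PMF.map_bind, PMF.bind_map]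
      congr 1
      funext b
      exact hD' ⟨m, h⟩ (a, b)
  exact key _ _

theorem seq {n : J → ℕ} (hn : PB κ n) {f : ∀ j, Fin (n j) → Γ j → PMF (β j)}
    (hf : Eff (J := Σ j, Fin (n j)) (fun p => κ p.1) (fun p => G p.1)
      (α := fun p => Γ p.1) (β := fun p => β p.1) fun p x => f p.1 p.2 x) :
    Eff κ G (β := fun j => Fin (n j) → β j) fun j x => seqPMF (n j) fun i => f j i x := by
  obtain ⟨t, ⟨c, hc⟩, K⟩ := hf
  refine ⟨_, hn.mul (g := fun j => κ j ^ c + c) ⟨c, fun _ => le_rfl⟩, fun j => ?_⟩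
  choose D hD hD' using fun i => K ⟨j, i⟩
  refine ⟨Circuit.vec _ D,
    @Circuit.gates_vec_le (G j) (BitEnc.Idx (Γ j)) (BitEnc.Idx (β j)) _ (n j) D
      fun i => (hD i).trans (hc ⟨j, i⟩), fun a => ?_⟩
  rw [Circuit.eval_vec, show (fun i => (D i).eval (BitEnc.enc a)) =
    fun i => (f j i a).map BitEnc.enc from funext fun i => hD' i a, seqPMF_map, PMF.map_comp]
  rfl

/-- A uniform integer from `{a, …, a + n}`, in any type that encodes numbers in binary. -/
theorem sample (a n : J → ℕ) (h : PB κ fun j => (a j + n j).size)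
    (v : ∀ j, Fin (n j + 1) → β j) (r : ∀ j, BitEnc.Idx (β j) → ℕ)
    (hr : ∀ j k i, BitEnc.enc (v j k) i = (a j + (k : ℕ)).testBit (r j i)) :
    Eff κ G fun j (_ : Γ j) => (PMF.uniformOfFintype (Fin (n j + 1))).map (v j) := by
  -- The constant gate supplies the bits at positions beyond the binary length of a + n, where the
  -- sampled number has only zeros.
  refine ⟨_, (PB.const 2).add h, fun j => ⟨.gate (.const false) (fun i => i.elim)
    (.gate (.sample (a j) (n j)) (fun i => i.elim) (.ret fun i =>
      if h : r j i < (a j + n j).size then Sum.inr ⟨r j i, h⟩ else Sum.inl (Sum.inr ()))),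
      ?_, fun x => ?_⟩⟩
  · simp only [Circuit.gates, Gate.cost]
    omega
  · simp only [Circuit.eval, Gate.run, PMF.pure_bind, PMF.bind_map]
    rw [PMF.map_comp]
    change ((PMF.uniformOfFintype (Fin (n j + 1))).bind fun a => PMF.pure (a : ℕ)).bind _ = _
    rw [PMF.bind_bind]
    simp only [PMF.pure_bind, PMF.map]
    refine congrArg (PMF.bind _) ?_
    funext k
    refine congrArg PMF.pure ?_
    funext i
    simp only [Function.comp_def]
    rw [hr]
    by_cases h : r j i < (a j + n j).size
    · simp [h]
    · simp only [h, dif_neg, not_false_iff, Sum.elim_inl, Sum.elim_inr]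
      refine (Nat.testBit_lt_two_pow ?_).symm
      calc a j + (k : ℕ) ≤ a j + n j := by omega
        _ < 2 ^ (a j + n j).size := Nat.lt_size_self _
        _ ≤ 2 ^ r j i := Nat.pow_le_pow_right (by norm_num) (not_lt.1 h)

theorem map {f : ∀ j, Γ j → PMF (α j)} {g : ∀ j, Γ j → α j → β j} (hf : Eff κ G f)
    (hg : EffD κ G (α := fun j => Γ j × α j) fun j y => g j y.1 y.2) :
    Eff κ G fun j x => (f j x).map fun a => g j x a :=
  bind hf hg

end Eff

/-! ### Closure properties of efficient deterministic functions. -/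

namespace EffD

theorem reindex {J' : Type} {f : ∀ j, α j → β j} (hf : EffD κ G f) (h : J' → J) :
    EffD (fun i => κ (h i)) (fun i => G (h i)) (α := fun i => α (h i)) (β := fun i => β (h i))
      fun i => f (h i) :=
  Eff.reindex hf h

theorem comp {f : ∀ j, α j → β j} {g : ∀ j, Γ j → α j} (hf : EffD κ G f)
    (hg : EffD κ G g) : EffD κ G fun j x => f j (g j x) :=
  Eff.comp (f := fun j x => PMF.pure (f j x)) hf hg

theorem id : EffD κ G fun j (x : Γ j) => x :=
  ⟨fun _ => 0, PB.const 0, fun _ => ⟨.ret _root_.id, le_rfl, fun _ => by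
    simp [Circuit.eval, PMF.pure_map]⟩⟩

/-- Rewiring is free: projections, entries of vectors and changes of structure only select output
wires. -/
theorem of_enc {f : ∀ j, Γ j → α j} (hf : EffD κ G f) {g : ∀ j, Γ j → β j}
    (r : ∀ j, BitEnc.Idx (β j) → BitEnc.Idx (α j))
    (hr : ∀ j x, BitEnc.enc (g j x) = BitEnc.enc (f j x) ∘ r j) : EffD κ G g := by
  obtain ⟨s, hs, H⟩ := hf
  refine ⟨s, hs, fun j => ?_⟩
  obtain ⟨C, hC, hC'⟩ := H j
  refine ⟨C.select (r j), by rwa [Circuit.gates_select], fun a => ?_⟩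
  rw [Circuit.eval_select, hC', PMF.pure_map, PMF.pure_map, PMF.pure_map, hr]

theorem fst {f : ∀ j, Γ j → α j × β j} (hf : EffD κ G f) : EffD κ G fun j x => (f j x).1 :=
  hf.of_enc (fun _ => Sum.inl) fun _ _ => rfl

theorem snd {f : ∀ j, Γ j → α j × β j} (hf : EffD κ G f) : EffD κ G fun j x => (f j x).2 :=
  hf.of_enc (fun _ => Sum.inr) fun _ _ => rfl

theorem pair {f : ∀ j, Γ j → α j} {g : ∀ j, Γ j → β j} (hf : EffD κ G f) (hg : EffD κ G g) :
    EffD κ G fun j x => (f j x, g j x) := by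
  have h1 : EffD κ G (α := fun j => (Γ j × α j) × β j) (β := fun j => α j × β j)
      fun j y => (y.1.2, y.2) :=
    id.of_enc (fun _ => Sum.elim (fun i => Sum.inl (Sum.inr i)) Sum.inr) fun j x => by
      funext i
      rcases i with i | i <;> rfl
  have h2 : Eff κ G (α := fun j => Γ j × α j) (β := fun j => α j × β j)
      fun j y => (PMF.pure (g j y.1)).bind fun b => PMF.pure (y.2, b) :=
    Eff.bind (f := fun j (y : Γ j × α j) => PMF.pure (g j y.1))
      (g := fun j (y : Γ j × α j) b => PMF.pure (y.2, b)) (comp hg id.fst) h1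
  have h := Eff.bind (f := fun j x => PMF.pure (f j x))
    (g := fun j x a => (PMF.pure (g j x)).bind fun b => PMF.pure (a, b)) hf h2
  simp only [PMF.pure_bind] at h
  exact h

/-- One wire carrying 0 and one carrying 1 serve all output bits, however many there are. This is
how non-uniform advice enters. -/
theorem const (c : ∀ j, β j) : EffD κ G fun j (_ : Γ j) => c j := by
  refine ⟨fun _ => 2, PB.const 2, fun j => ⟨.gate (.const false) (fun i => i.elim)
    (.gate (.const true) (fun i => i.elim) (.ret fun i =>
      if BitEnc.enc (c j) i then Sum.inr () else Sum.inl (Sum.inr ()))), le_rfl, fun x => ?_⟩⟩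
  simp only [Circuit.eval, Gate.run, PMF.pure_bind, PMF.pure_map]
  congr 1
  funext i
  cases h : BitEnc.enc (c j) i <;> simp [h]

theorem app {ι : J → Type} [∀ j, Finite (ι j)] {f : ∀ j, Γ j → ι j → β j}
    (hf : EffD κ G (β := fun j => ι j → β j) f) (i : ∀ j, ι j) :
    EffD κ G fun j x => f j x (i j) :=
  hf.of_enc (fun j k => (i j, k)) fun _ _ => rfl

theorem pi {ι : J → Type} [∀ j, Finite (ι j)] (hι : PB κ fun j => Nat.card (ι j))
    {f : ∀ j, ι j → Γ j → β j}
    (hf : EffD (J := Σ j, ι j) (fun p => κ p.1) (fun p => G p.1) (α := fun p => Γ p.1)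
      (β := fun p => β p.1) fun p x => f p.1 p.2 x) :
    EffD κ G (β := fun j => ι j → β j) fun j x i => f j i x := by
  have h := Eff.seq (f := fun j (i : Fin (Nat.card (ι j))) x =>
      PMF.pure (f j ((Finite.equivFin (ι j)).symm i) x)) hι
    (Eff.reindex hf fun p : Σ j, Fin (Nat.card (ι j)) =>
      (⟨p.1, (Finite.equivFin (ι p.1)).symm p.2⟩ : Σ j, ι j))
  simp only [seqPMF_pure] at h
  refine of_enc (f := fun j x (i : Fin (Nat.card (ι j))) =>
    f j ((Finite.equivFin (ι j)).symm i) x) h (fun j k => (Finite.equivFin (ι j) k.1, k.2)) ?_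
  intro j x
  funext k
  show BitEnc.enc (f j k.1 x) k.2 =
    BitEnc.enc (f j ((Finite.equivFin (ι j)).symm (Finite.equivFin (ι j) k.1)) x) k.2
  rw [Equiv.symm_apply_apply]

theorem optionSome {f : ∀ j, Γ j → α j} (hf : EffD κ G f) :
    EffD κ G fun j x => some (f j x) := by
  have h := pair (const (fun _ => true)) hf
  exact h.of_enc (fun _ i => i.elim (Sum.inl ()) Sum.inr) fun j x => by
    funext i
    cases i <;> rfl

/-- Reduces the computation of a function with polynomially long output to deciding each output bit,
uniformly in its position. -/
theorem of_bits (hβ : PBC κ β) {g : ∀ j, Γ j → β j}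
    (h : EffP (J := Σ j, BitEnc.Idx (β j)) (fun p => κ p.1) (fun p => G p.1)
      (α := fun p => Γ p.1) fun p x => BitEnc.enc (g p.1 x) p.2 = true) : EffD κ G g :=
  (pi (β := fun _ => Bool) hβ (f := fun j i x => @decide (BitEnc.enc (g j x) i = true)
    (Classical.propDecidable _)) h).of_enc (fun _ i => (i, ())) fun j x => by
    funext i
    show BitEnc.enc (g j x) i = @decide _ (_)
    simp

theorem iter {n : J → ℕ} (hn : PB κ n) (a : ∀ j, Γ j → ℕ → α j)
    (step : ∀ j, Fin (n j) → Γ j → α j → α j) (h0 : EffD κ G fun j x => a j x 0)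
    (hs : EffD (J := Σ j, Fin (n j)) (fun p => κ p.1) (fun p => G p.1)
      (α := fun p => Γ p.1 × α p.1) (β := fun p => α p.1) fun p y => step p.1 p.2 y.1 y.2)
    (h : ∀ j x i, step j i x (a j x i) = a j x (i + 1)) : EffD κ G fun j x => a j x (n j) := by
  have H := Eff.iter hn (init := fun j x => PMF.pure (a j x 0))
    (step := fun j i x s => PMF.pure (step j i x s)) h0 hs
  have key : ∀ j x m (hm : m ≤ n j), iterPMF (PMF.pure (a j x 0))
      (fun i s => PMF.pure (step j i x s)) m hm = PMF.pure (a j x m) := by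
    intro j x m hm
    induction m with
    | zero => rfl
    | succ m ih => rw [iterPMF, ih, PMF.pure_bind]; exact congrArg PMF.pure (h j x ⟨m, hm⟩)
  simp only [key] at H
  exact H

theorem add {f g : ∀ j, Γ j → (G j).Pt} (hf : EffD κ G f) (hg : EffD κ G g) :
    EffD κ G fun j x => f j x + g j x := by
  refine comp (f := fun j (y : (G j).Pt × (G j).Pt) => y.1 + y.2) ?_ (hf.pair hg)
  refine ⟨fun _ => 1, PB.const 1, fun j => ⟨.gate .add _root_.id (.ret Sum.inr), le_rfl,
    fun y => ?_⟩⟩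
  simp only [Circuit.eval, Gate.run, PMF.pure_bind, PMF.pure_map, Function.comp_id,
    BitEnc.decD_enc, Sum.elim_comp_inr]

theorem mul {f : ∀ j, Γ j → (G j).Scalar} {g : ∀ j, Γ j → (G j).Pt} (hf : EffD κ G f)
    (hg : EffD κ G g) : EffD κ G fun j x => (G j).mul (f j x) (g j x) := by
  refine comp (f := fun j (y : (G j).Scalar × (G j).Pt) => (G j).mul y.1 y.2) ?_ (hf.pair hg)
  refine ⟨fun _ => 1, PB.const 1, fun j => ⟨.gate .smul _root_.id (.ret Sum.inr), le_rfl,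
    fun y => ?_⟩⟩
  simp only [Circuit.eval, Gate.run, PMF.pure_bind, PMF.pure_map, Function.comp_id,
    BitEnc.decD_enc, Sum.elim_comp_inr]

end EffD

/-! ### Efficiently decidable predicates. -/

namespace EffP

theorem congr {P Q : ∀ j, Γ j → Prop} (hP : EffP κ G P) (h : ∀ j x, Q j x ↔ P j x) :
    EffP κ G Q := by
  rwa [show Q = P from funext fun j => funext fun x => propext (h j x)]

theorem reindex {J' : Type} {P : ∀ j, α j → Prop} (hP : EffP κ G P) (h : J' → J) :
    EffP (fun i => κ (h i)) (fun i => G (h i)) (α := fun i => α (h i)) fun i => P (h i) :=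
  Eff.reindex hP h

theorem comp {P : ∀ j, α j → Prop} {g : ∀ j, Γ j → α j} (hP : EffP κ G P) (hg : EffD κ G g) :
    EffP κ G fun j x => P j (g j x) :=
  EffD.comp (β := fun _ => Bool) hP hg

theorem toEffD {P : ∀ j, Γ j → Prop} (hP : EffP κ G P) [∀ j x, Decidable (P j x)] :
    EffD κ G (β := fun _ => Bool) fun j x => decide (P j x) := by
  unfold EffP at hP
  convert hP

theorem const (P : J → Prop) : EffP κ G fun j (_ : Γ j) => P j :=
  EffD.const fun _ => @decide _ (_)

theorem bit {f : ∀ j, Γ j → β j} (hf : EffD κ G f) (i : ∀ j, BitEnc.Idx (β j)) :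
    EffP κ G fun j x => BitEnc.enc (f j x) (i j) = true :=
  EffD.of_enc hf (fun j _ => i j) fun j x => by
    funext u
    show @decide _ (_) = BitEnc.enc (f j x) (i j)
    simp

theorem isTrue {f : ∀ j, Γ j → Bool} (hf : EffD κ G f) : EffP κ G fun j x => f j x = true :=
  bit (β := fun _ => Bool) hf fun _ => ()

/-- The NAND gate, from which all other connectives are derived. -/
theorem not_and {P Q : ∀ j, Γ j → Prop} (hP : EffP κ G P) (hQ : EffP κ G Q) :
    EffP κ G fun j x => ¬(P j x ∧ Q j x) := by
  have h : EffD κ G (α := fun _ => Bool × Bool) (β := fun _ => Bool)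
      fun _ y => !(y.1 && y.2) := by
    refine ⟨fun _ => 1, PB.const 1, fun j => ⟨.gate .nand
      (fun b => if b then Sum.inr () else Sum.inl ()) (.ret fun _ => Sum.inr ()), le_rfl,
      fun y => ?_⟩⟩
    simp only [Circuit.eval, Gate.run, PMF.pure_bind, PMF.pure_map]
    rfl
  have h' := h.comp (EffD.pair hP hQ)
  unfold EffP
  convert h' using 3
  by_cases hp : P _ ‹_› <;> by_cases hq : Q _ ‹_› <;> simp [hp, hq]

theorem not {P : ∀ j, Γ j → Prop} (hP : EffP κ G P) : EffP κ G fun j x => ¬P j x :=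
  (hP.not_and hP).congr fun _ _ => by tauto

theorem and {P Q : ∀ j, Γ j → Prop} (hP : EffP κ G P) (hQ : EffP κ G Q) :
    EffP κ G fun j x => P j x ∧ Q j x :=
  (hP.not_and hQ).not.congr fun _ _ => by tauto

theorem or {P Q : ∀ j, Γ j → Prop} (hP : EffP κ G P) (hQ : EffP κ G Q) :
    EffP κ G fun j x => P j x ∨ Q j x :=
  (hP.not.not_and hQ.not).congr fun _ _ => by tauto

theorem iff {P Q : ∀ j, Γ j → Prop} (hP : EffP κ G P) (hQ : EffP κ G Q) :
    EffP κ G fun j x => (P j x ↔ Q j x) :=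
  ((hP.and hQ).or (hP.not.and hQ.not)).congr fun _ _ => by tauto

theorem existsFin {n : J → ℕ} (hn : PB κ n) {P : ∀ j, Fin (n j) → Γ j → Prop}
    (hP : EffP (J := Σ j, Fin (n j)) (fun p => κ p.1) (fun p => G p.1) (α := fun p => Γ p.1)
      fun p x => P p.1 p.2 x) : EffP κ G fun j x => ∃ i, P j i x := by
  classical
  have h := EffD.iter (G := G) (α := fun _ => Bool) hn
    (fun j x m => decide (∃ i : Fin (n j), (i : ℕ) < m ∧ P j i x))
    (fun j i x s => decide (s = true ∨ P j i x)) (by simpa using EffD.const fun _ => false)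
    (((isTrue EffD.id.snd).or (hP.comp EffD.id.fst)).toEffD)
    (fun j x i => by
      rw [decide_eq_decide, decide_eq_true_iff]
      constructor
      · rintro (⟨k, hk, h⟩ | h)
        · exact ⟨k, by omega, h⟩
        · exact ⟨i, by omega, h⟩
      · rintro ⟨k, hk, h⟩
        rcases Nat.lt_succ_iff_lt_or_eq.1 hk with hk | hk
        · exact .inl ⟨k, hk, h⟩
        · exact .inr (Fin.ext hk ▸ h))
  exact (isTrue h).congr fun j x => by simp

theorem ex {ι : J → Type} [∀ j, Finite (ι j)] (hι : PB κ fun j => Nat.card (ι j))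
    {P : ∀ j, ι j → Γ j → Prop}
    (hP : EffP (J := Σ j, ι j) (fun p => κ p.1) (fun p => G p.1) (α := fun p => Γ p.1)
      fun p x => P p.1 p.2 x) : EffP κ G fun j x => ∃ i, P j i x := by
  have h := existsFin hι (P := fun j i => P j ((Finite.equivFin (ι j)).symm i))
    (hP.reindex fun p : Σ j, Fin (Nat.card (ι j)) =>
      (⟨p.1, (Finite.equivFin (ι p.1)).symm p.2⟩ : Σ j, ι j))
  exact h.congr fun j x => 
    ((Finite.equivFin (ι j)).symm.exists_congr_right (q := fun i => P j i x)).symm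

end EffP

end

/-! ### Lengths of encodings, and constructions that work bit by bit. -/

section

variable {J : Type} {κ : J → ℕ} {G : J → ECParams} {Γ α β γ : J → Type}
  [∀ j, BitEnc (Γ j)] [∀ j, BitEnc (α j)] [∀ j, BitEnc (β j)] [∀ j, BitEnc (γ j)]

theorem PB.fin {n : J → ℕ} (hn : PB κ n) : PB κ fun j => Nat.card (Fin (n j)) := by
  simpa using hn

namespace PBC

theorem reindex {J' : Type} (h : PBC κ α) (f : J' → J) :
    PBC (fun i => κ (f i)) fun i => α (f i) :=
  PB.reindex h f

theorem bool : PBC κ fun _ => Bool := by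
  refine PB.mono (PB.const 1) fun j => ?_
  show Nat.card Unit ≤ 1
  simp

theorem prod (hα : PBC κ α) (hβ : PBC κ β) : PBC κ fun j => α j × β j :=
  PB.mono (PB.add hα hβ) fun _ => (Nat.card_sum).le

theorem pi {ι : J → Type} [∀ j, Finite (ι j)] (hι : PB κ fun j => Nat.card (ι j))
    (hβ : PBC κ β) : PBC κ fun j => ι j → β j :=
  PB.mono (PB.mul hι hβ) fun _ => (Nat.card_prod _ _).le

theorem option (hα : PBC κ α) : PBC κ fun j => Option (α j) :=
  PB.mono (PB.add hα (PB.const 1)) fun j => (Finite.card_option (α := BitEnc.Idx (α j))).le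

theorem fin {n : J → ℕ} (hn : PB κ fun j => (n j).size) : PBC κ fun j => Fin (n j) :=
  PB.mono hn fun j => (Nat.card_fin (n j).size).le

theorem finset {d : J → ℕ} (hd : PB κ d) : PBC κ fun j => Finset (Fin (d j)) :=
  pi (PB.fin hd) bool

theorem perm {d : J → ℕ} (hd : PB κ d) : PBC κ fun j => Equiv.Perm (Fin (d j)) :=
  PB.mono (PB.mul hd hd) fun j => by
    show Nat.card (Fin (d j) × Fin (d j)) ≤ _
    simp

theorem bitString {l : J → ℕ} (hl : PB κ l) : PBC κ fun j => BitString (l j) :=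
  pi (PB.fin hl) bool

theorem scalar (hq : PB κ fun j => (G j).q.size) : PBC κ fun j => (G j).Scalar :=
  PB.mono hq fun j => (Nat.card_fin (G j).q.size).le

theorem pt (hp : PB κ fun j => (G j).p.size) : PBC κ fun j => (G j).Pt := by
  refine PB.mono ((hp.add hp).add (PB.const 1)) fun j => ?_
  show Nat.card (Option (Fin _ ⊕ Fin _)) ≤ _
  rw [Finite.card_option, Nat.card_sum, Nat.card_fin]

end PBC

namespace EffP

theorem all {ι : J → Type} [∀ j, Finite (ι j)] (hι : PB κ fun j => Nat.card (ι j))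
    {P : ∀ j, ι j → Γ j → Prop}
    (hP : EffP (J := Σ j, ι j) (fun p => κ p.1) (fun p => G p.1) (α := fun p => Γ p.1)
      fun p x => P p.1 p.2 x) : EffP κ G fun j x => ∀ i, P j i x :=
  (ex hι (P := fun j i x => ¬P j i x) hP.not).not.congr fun j x => by simp

theorem eqConst (hβ : PBC κ β) {f : ∀ j, Γ j → β j} (hf : EffD κ G f) (c : ∀ j, β j) :
    EffP κ G fun j x => f j x = c j := by
  have h := all (Γ := Γ) (G := G) hβ
    (P := fun j i x => (BitEnc.enc (f j x) i = true ↔ BitEnc.enc (c j) i = true))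
    ((bit (hf.reindex fun p : Σ j, BitEnc.Idx (β j) => p.1) fun p => p.2).iff
      (const fun p : Σ j, BitEnc.Idx (β j) => BitEnc.enc (c p.1) p.2 = true))
  refine h.congr fun j x => ?_
  rw [← BitEnc.inj.eq_iff, funext_iff]
  exact forall_congr' fun i => Bool.eq_iff_iff

theorem mem {d : J → ℕ} {S : ∀ j, Γ j → Finset (Fin (d j))} (hS : EffD κ G S)
    (i : ∀ j, Fin (d j)) : EffP κ G fun j x => i j ∈ S j x :=
  (bit hS fun j => (i j, ())).congr fun j x => (decide_eq_true_iff (p := i j ∈ S j x)).symm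

theorem permEq {d : J → ℕ} {σ : ∀ j, Γ j → Equiv.Perm (Fin (d j))} (hσ : EffD κ G σ)
    (a b : ∀ j, Fin (d j)) : EffP κ G fun j x => σ j x (a j) = b j :=
  (bit hσ fun j => (a j, b j)).congr
    fun j x => (decide_eq_true_iff (p := σ j x (a j) = b j)).symm

theorem isSome {f : ∀ j, Γ j → Option (α j)} (hf : EffD κ G f) :
    EffP κ G fun j x => (f j x).isSome = true :=
  (bit hf fun _ => none).congr fun j x => by cases f j x <;> simp [BitEnc.enc]

end EffP

namespace EffD

/-- Selection between two values spends gates on every output bit, hence the bound on the length of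
the encoding. -/
theorem ite (hβ : PBC κ β) {P : ∀ j, Γ j → Prop} [∀ j x, Decidable (P j x)]
    {f g : ∀ j, Γ j → β j} (hP : EffP κ G P) (hf : EffD κ G f) (hg : EffD κ G g) :
    EffD κ G fun j x => if P j x then f j x else g j x := by
  refine of_bits hβ ?_
  let r : (Σ j, BitEnc.Idx (β j)) → J := fun p => p.1
  refine (((hP.reindex r).and (.bit (hf.reindex r) fun p => p.2)).or
    ((hP.reindex r).not.and (.bit (hg.reindex r) fun p => p.2))).congr fun p x => ?_
  by_cases h : P p.1 x <;> simp [r, h]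

theorem getD (hα : PBC κ α) {f : ∀ j, Γ j → Option (α j)} (hf : EffD κ G f) (c : ∀ j, α j) :
    EffD κ G fun j x => (f j x).getD (c j) := by
  refine of_bits hα ?_
  let r : (Σ j, BitEnc.Idx (α j)) → J := fun p => p.1
  refine (((EffP.isSome hf).reindex r).and (.bit (hf.reindex r) fun p => some p.2)).or
    (((EffP.isSome hf).reindex r).not.and (.const fun p => BitEnc.enc (c p.1) p.2 = true))
    |>.congr fun p x => ?_
  cases h : f p.1 x <;> simp [r, BitEnc.enc]

theorem finset {d : J → ℕ} (hd : PB κ d) {S : ∀ j, Γ j → Finset (Fin (d j))}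
    (h : EffP (J := Σ j, Fin (d j)) (fun p => κ p.1) (fun p => G p.1) (α := fun p => Γ p.1)
      fun p x => p.2 ∈ S p.1 x) : EffD κ G S := by
  refine of_bits (PBC.finset hd) ?_
  exact (h.reindex fun p : Σ j, BitEnc.Idx (Finset (Fin (d j))) =>
    (⟨p.1, p.2.1⟩ : Σ j, Fin (d j))).congr
      fun p x => decide_eq_true_iff (p := p.2.1 ∈ S p.1 x)

theorem perm {d : J → ℕ} (hd : PB κ d) {σ : ∀ j, Γ j → Equiv.Perm (Fin (d j))}
    (h : EffP (J := Σ j, Fin (d j) × Fin (d j)) (fun p => κ p.1) (fun p => G p.1)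
      (α := fun p => Γ p.1) fun p x => σ p.1 x p.2.1 = p.2.2) : EffD κ G σ := by
  refine of_bits (PBC.perm hd) ?_
  exact h.congr fun p x => decide_eq_true_iff (p := σ p.1 x p.2.1 = p.2.2)

end EffD

namespace EffP

/-- Counting in unary avoids binary adders: the state is a vector of d + 1 bits whose bit k says
that the count so far is k, and each element satisfying P shifts it by one place. -/
theorem card_eq {d : J → ℕ} (hd : PB κ d) {P : ∀ j, Fin (d j) → Γ j → Prop}
    [∀ j i x, Decidable (P j i x)]
    (hP : EffP (J := Σ j, Fin (d j)) (fun p => κ p.1) (fun p => G p.1) (α := fun p => Γ p.1)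
      fun p x => P p.1 p.2 x) (k : J → ℕ) :
    EffP κ G fun j x => (Finset.univ.filter fun i => P j i x).card = k j := by
  classical
  let α : J → Type := fun j => Fin (d j + 1) → Bool
  have hstep : EffD (J := Σ j, Fin (d j)) (fun p => κ p.1) (fun p => G p.1)
      (α := fun p => Γ p.1 × α p.1) (β := fun p => α p.1) fun p y (k : Fin (d p.1 + 1)) =>
        decide ((¬P p.1 p.2 y.1 ∧ y.2 k = true) ∨
          (P p.1 p.2 y.1 ∧ ∃ k' : Fin (d p.1 + 1), (k' : ℕ) + 1 = k ∧ y.2 k' = true)) := by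
    have hd1 : PB (fun p : Σ j, Fin (d j) => κ p.1) fun p => Nat.card (Fin (d p.1 + 1)) :=
      ((hd.add (PB.const 1)).fin).reindex _
    refine EffD.pi (β := fun _ => Bool) hd1 (EffP.toEffD ?_)
    have hP' := ((hP.comp (Γ := fun p => Γ p.1 × α p.1) EffD.id.fst).reindex
      fun q : (Σ p : (Σ j, Fin (d j)), Fin (d p.1 + 1)) => q.1)
    refine (hP'.not.and (isTrue (EffD.id.snd.app fun q => q.2))).or (hP'.and ?_)
    refine ex (hd1.reindex _) (.and (.const _) ?_)
    exact isTrue (EffD.id.snd.app fun q : (Σ p : (Σ p : (Σ j, Fin (d j)), Fin (d p.1 + 1)),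
      Fin (d p.1.1 + 1)) => q.2)
  have h := EffD.iter (G := G) (α := α) (Γ := Γ) hd
    (fun j x m k => decide ((Finset.univ.filter
      fun i : Fin (d j) => (i : ℕ) < m ∧ P j i x).card = k))
    (fun j i x v k => decide ((¬P j i x ∧ v k = true) ∨
      (P j i x ∧ ∃ k' : Fin (d j + 1), (k' : ℕ) + 1 = k ∧ v k' = true)))
    (by simpa using EffD.const fun j (k : Fin (d j + 1)) => decide (0 = (k : ℕ))) hstep
    (fun j x i => by
      have hc : (Finset.univ.filter fun i' : Fin (d j) => (i' : ℕ) < i + 1 ∧ P j i' x).card =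
          (Finset.univ.filter fun i' : Fin (d j) => (i' : ℕ) < i ∧ P j i' x).card +
            if P j i x then 1 else 0 := by
        split_ifs with hp
        · rw [← Finset.card_insert_of_notMem (a := i) (by simp)]
          congr 1
          ext i'
          simp only [Finset.mem_filter, Finset.mem_univ, true_and, Finset.mem_insert]
          constructor
          · rintro ⟨h1, h2⟩
            rcases Nat.lt_succ_iff_lt_or_eq.1 h1 with h | h
            · exact .inr ⟨h, h2⟩
            · exact .inl (Fin.ext h)
          · rintro (rfl | ⟨h1, h2⟩)
            · exact ⟨by omega, hp⟩
            · exact ⟨by omega, h2⟩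
        · rw [add_zero]
          congr 1
          ext i'
          simp only [Finset.mem_filter, Finset.mem_univ, true_and]
          constructor
          · rintro ⟨h1, h2⟩
            rcases Nat.lt_succ_iff_lt_or_eq.1 h1 with h | h
            · exact ⟨h, h2⟩
            · exact absurd (Fin.ext h ▸ h2) hp
          · rintro ⟨h1, h2⟩
            exact ⟨by omega, h2⟩
      funext k
      rw [decide_eq_decide, hc]
      have hle : (Finset.univ.filter fun i' : Fin (d j) => (i' : ℕ) < i ∧ P j i' x).card ≤ d j :=
        (Finset.card_le_univ _).trans (by simp)
      by_cases hp : P j i x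
      · simp only [hp, not_true, false_and, false_or, true_and, if_true, decide_eq_true_iff]
        constructor
        · rintro ⟨k', h1, h2⟩
          omega
        · intro h
          exact ⟨⟨_, Nat.lt_succ_of_le hle⟩, h, rfl⟩
      · simp [hp])
  have h' : EffP κ G fun j x => ∃ i : Fin (d j + 1), (i : ℕ) = k j ∧
      (Finset.univ.filter fun i' : Fin (d j) => (i' : ℕ) < d j ∧ P j i' x).card = i := by
    refine ex ((hd.add (PB.const 1)).fin) (.and (.const _) ?_)
    refine (isTrue ((h.reindex fun p : Σ j, Fin (d j + 1) => p.1).app fun p => p.2)).congr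
      fun p x => ?_
    rw [decide_eq_true_iff]
  refine h'.congr fun j x => ?_
  have hle : (Finset.univ.filter fun i' : Fin (d j) => P j i' x).card < d j + 1 :=
    Nat.lt_succ_of_le ((Finset.card_le_univ _).trans (by simp))
  simp only [Fin.is_lt, true_and]
  constructor
  · intro h
    exact ⟨⟨_, hle⟩, h, rfl⟩
  · rintro ⟨i, h1, h2⟩
    omega

theorem card_lt {d : J → ℕ} (hd : PB κ d) {P : ∀ j, Fin (d j) → Γ j → Prop}
    [∀ j i x, Decidable (P j i x)]
    (hP : EffP (J := Σ j, Fin (d j)) (fun p => κ p.1) (fun p => G p.1) (α := fun p => Γ p.1)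
      fun p x => P p.1 p.2 x) {k : J → ℕ} (hk : PB κ k) :
    EffP κ G fun j x => (Finset.univ.filter fun i => P j i x).card < k j := by
  have h : EffP κ G fun j x => ∃ i : Fin (k j), (Finset.univ.filter fun i => P j i x).card = i :=
    ex hk.fin (card_eq (hd.reindex _) (hP.reindex
      fun p : (Σ q : (Σ j, Fin (k j)), Fin (d q.1)) => (⟨p.1.1, p.2⟩ : Σ j, Fin (d j)))
      fun p : Σ j, Fin (k j) => (p.2 : ℕ))
  exact h.congr fun j x => ⟨fun h => ⟨⟨_, h⟩, rfl⟩, fun ⟨i, h⟩ => h ▸ i.2⟩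

end EffP

end

section

/-! ### Probabilities -/

/-- The probability that a randomized bit is `1`. -/
def pr (X : PMF Bool) : ℝ := (X true).toReal

theorem pr_nonneg (X : PMF Bool) : 0 ≤ pr X := ENNReal.toReal_nonneg

theorem pr_le_one (X : PMF Bool) : pr X ≤ 1 :=
  ENNReal.toReal_le_of_le_ofReal zero_le_one (by simpa using X.coe_le_one true)

theorem pr_pure (b : Bool) : pr (PMF.pure b) = if b then 1 else 0 := by
  cases b <;> simp [pr]

theorem summable_toReal {α : Type} (μ : PMF α) : Summable fun a => (μ a).toReal :=
  ENNReal.summable_toReal (by rw [μ.tsum_coe]; exact ENNReal.one_ne_top)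

theorem tsum_toReal {α : Type} (μ : PMF α) : ∑' a, (μ a).toReal = 1 := by
  rw [← ENNReal.tsum_toReal_eq fun a => μ.apply_ne_top a, μ.tsum_coe, ENNReal.toReal_one]

theorem pr_bind {α : Type} (μ : PMF α) (f : α → PMF Bool) :
    pr (μ.bind f) = ∑' a, (μ a).toReal * pr (f a) := by
  rw [pr, PMF.bind_apply, ENNReal.tsum_toReal_eq fun a =>
    ENNReal.mul_ne_top (μ.apply_ne_top a) ((f a).apply_ne_top _)]
  simp [pr]

theorem summable_mul_pr {α : Type} (μ : PMF α) (f : α → PMF Bool) :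
    Summable fun a => (μ a).toReal * pr (f a) :=
  (summable_toReal μ).of_nonneg_of_le (fun _ => mul_nonneg ENNReal.toReal_nonneg (pr_nonneg _))
    fun _ => mul_le_of_le_one_right ENNReal.toReal_nonneg (pr_le_one _)

/-- Averaging: a first step common to two experiments can be fixed at any value of its support.
Every comparison of executions below peels off common samples in this way. -/
theorem abs_pr_bind_sub_le {α : Type} {μ : PMF α} {f g : α → PMF Bool} {ε : ℝ}
    (h : ∀ a ∈ μ.support, |pr (f a) - pr (g a)| ≤ ε) :
    |pr (μ.bind f) - pr (μ.bind g)| ≤ ε := by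
  have hs : Summable fun a => (μ a).toReal * ε := (summable_toReal μ).mul_right ε
  rw [pr_bind, pr_bind, ← (summable_mul_pr μ f).tsum_sub (summable_mul_pr μ g)]
  have hle : ∀ a, |(μ a).toReal * pr (f a) - (μ a).toReal * pr (g a)| ≤ (μ a).toReal * ε := by
    intro a
    rw [← mul_sub, abs_mul, abs_of_nonneg ENNReal.toReal_nonneg]
    by_cases ha : a ∈ μ.support
    · exact mul_le_mul_of_nonneg_left (h a ha) ENNReal.toReal_nonneg
    · rw [PMF.mem_support_iff, not_not] at ha
      simp [ha]
  calc |∑' a, ((μ a).toReal * pr (f a) - (μ a).toReal * pr (g a))|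
      ≤ ∑' a, |(μ a).toReal * pr (f a) - (μ a).toReal * pr (g a)| := by
        have := norm_tsum_le_tsum_norm (f := fun a =>
          (μ a).toReal * pr (f a) - (μ a).toReal * pr (g a))
          (hs.of_nonneg_of_le (fun _ => norm_nonneg _) hle)
        simpa only [Real.norm_eq_abs] using this
    _ ≤ ∑' a, (μ a).toReal * ε :=
        (hs.of_nonneg_of_le (fun _ => abs_nonneg _) hle).tsum_le_tsum hle hs
    _ = ε := by rw [tsum_mul_right, tsum_toReal, one_mul]

theorem bind_congr_support {α β : Type} {μ : PMF α} {f g : α → PMF β}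
    (h : ∀ a ∈ μ.support, f a = g a) : μ.bind f = μ.bind g := by
  ext b
  rw [PMF.bind_apply, PMF.bind_apply]
  refine tsum_congr fun a => ?_
  by_cases ha : a ∈ μ.support
  · rw [h a ha]
  · rw [PMF.mem_support_iff, not_not] at ha
    simp [ha]

/-! ### Uniform distributions -/

section Uniform

variable {α β γ : Type}

theorem uniform_congr {s t : Finset α} (hs : s.Nonempty) (h : s = t) :
    PMF.uniformOfFinset s hs = PMF.uniformOfFinset t (h ▸ hs) := by
  subst h; rfl

theorem uniformOfFintype_eq [Fintype α] [Nonempty α] :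
    PMF.uniformOfFintype α = PMF.uniformOfFinset Finset.univ Finset.univ_nonempty := rfl

theorem map_uniform_apply [DecidableEq β] {s : Finset α} (hs : s.Nonempty) (f : α → β) (b : β) :
    (PMF.uniformOfFinset s hs).map f b =
      ((s.filter fun a => f a = b).card : ENNReal) * (s.card : ENNReal)⁻¹ := by
  classical
  rw [PMF.map_apply, tsum_eq_sum (s := s.filter fun a => f a = b)]
  · rw [Finset.sum_congr rfl (g := fun _ => (s.card : ENNReal)⁻¹)]
    · simp
    · intro a ha
      rw [Finset.mem_filter] at ha
      simp [ha.1, ha.2]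
  · intro a ha
    rw [Finset.mem_filter, not_and] at ha
    by_cases has : a ∈ s
    · rw [if_neg fun h => ha has h.symm]
    · simp [has]

/-- The inequality, used in both directions, makes all fibers over t equally large, so that each
carries the mass 1/|t|. -/
theorem map_uniform_of_fiber_card [DecidableEq β] {s : Finset α} (hs : s.Nonempty) {t : Finset β}
    (ht : t.Nonempty) {f : α → β} (hf : ∀ a ∈ s, f a ∈ t)
    (h : ∀ b ∈ t, ∀ b' ∈ t,
      (s.filter fun a => f a = b).card ≤ (s.filter fun a => f a = b').card) :
    (PMF.uniformOfFinset s hs).map f = PMF.uniformOfFinset t ht := by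
  ext b
  rw [map_uniform_apply, PMF.uniformOfFinset_apply]
  split_ifs with hb
  · have hc : s.card = t.card * (s.filter fun a => f a = b).card := by
      rw [Finset.card_eq_sum_card_fiberwise hf, Finset.sum_const_nat]
      exact fun b' hb' => le_antisymm (h _ hb' _ hb) (h _ hb _ hb')
    have h0 : (s.filter fun a => f a = b).card ≠ 0 := by
      intro h0
      rw [h0, mul_zero] at hc
      exact hs.card_ne_zero hc
    rw [hc, Nat.cast_mul, ENNReal.mul_inv (.inr (ENNReal.natCast_ne_top _))
      (.inl (ENNReal.natCast_ne_top _)), mul_comm, mul_assoc,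
      ENNReal.inv_mul_cancel (by simpa using h0) (ENNReal.natCast_ne_top _), mul_one]
  · rw [Finset.filter_eq_empty_iff.2 fun a ha (hab : f a = b) => hb (hab ▸ hf a ha)]
    simp

/-- A map whose fibers are permuted by bijections of the domain. -/
theorem map_uniform_of_transitive {s : Finset α} (hs : s.Nonempty) {t : Finset β}
    (ht : t.Nonempty) {f : α → β} (hf : ∀ a ∈ s, f a ∈ t)
    (h : ∀ b ∈ t, ∀ b' ∈ t, ∃ e : α → α, Function.Injective e ∧
      ∀ a ∈ s, f a = b → e a ∈ s ∧ f (e a) = b') :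
    (PMF.uniformOfFinset s hs).map f = PMF.uniformOfFinset t ht := by
  classical
  refine map_uniform_of_fiber_card hs ht hf fun b hb b' hb' => ?_
  obtain ⟨e, he, he'⟩ := h b hb b' hb'
  refine Finset.card_le_card_of_injOn e (fun a ha => ?_) he.injOn
  simp only [Finset.mem_coe, Finset.mem_filter] at ha ⊢
  exact he' a ha.1 ha.2

theorem map_uniform_of_bijOn {s : Finset α} (hs : s.Nonempty) {t : Finset β} (ht : t.Nonempty)
    {f : α → β} (hf : Set.BijOn f s t) :
    (PMF.uniformOfFinset s hs).map f = PMF.uniformOfFinset t ht := by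
  classical
  have key : ∀ b ∈ t, (s.filter fun a => f a = b).card = 1 := by
    intro b hb
    obtain ⟨a, ha, rfl⟩ := hf.surjOn hb
    rw [Finset.card_eq_one]
    refine ⟨a, ?_⟩
    ext a'
    simp only [Finset.mem_filter, Finset.mem_singleton]
    constructor
    · exact fun h => hf.injOn h.1 ha h.2
    · rintro rfl
      exact ⟨ha, rfl⟩
  exact map_uniform_of_fiber_card hs ht (fun a ha => hf.mapsTo ha)
    fun b hb b' hb' => by rw [key b hb, key b' hb']

theorem bind_uniform_prod {s : Finset α} (hs : s.Nonempty) {t : Finset β} (ht : t.Nonempty)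
    (F : α → β → PMF γ) :
    ((PMF.uniformOfFinset s hs).bind fun a => (PMF.uniformOfFinset t ht).bind fun b => F a b) =
      (PMF.uniformOfFinset (s ×ˢ t) (hs.product ht)).bind fun x => F x.1 x.2 := by
  have h : ((PMF.uniformOfFinset s hs).bind fun a => (PMF.uniformOfFinset t ht).map fun b =>
      (a, b)) = PMF.uniformOfFinset (s ×ˢ t) (hs.product ht) := by
    classical
    ext ⟨a, b⟩
    simp only [PMF.bind_apply, PMF.map_apply, PMF.uniformOfFinset_apply, Prod.mk.injEq,
      Finset.mem_product]
    rw [tsum_eq_single a (fun a' ha' => by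
      rw [ENNReal.tsum_eq_zero.2 fun b' => if_neg fun h => ha' h.1.symm, mul_zero]),
      tsum_eq_single b (fun b' hb' => if_neg fun h => hb' h.2.symm)]
    by_cases ha : a ∈ s <;> by_cases hb : b ∈ t <;>
      simp [ha, hb, ENNReal.mul_inv]
  rw [← h, PMF.bind_bind]
  simp only [PMF.bind_map]
  rfl

theorem bind_uniform_of_bijOn {δ : Type} {s : Finset α} (hs : s.Nonempty) {t : Finset β}
    (ht : t.Nonempty) {u : Finset γ} (hu : u.Nonempty) {f : α → β → γ}
    (hf : Set.BijOn (fun x : α × β => f x.1 x.2) (s ×ˢ t : Finset (α × β)) u) (F : γ → PMF δ) :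
    ((PMF.uniformOfFinset s hs).bind fun a => (PMF.uniformOfFinset t ht).bind fun b =>
      F (f a b)) = (PMF.uniformOfFinset u hu).bind F := by
  rw [bind_uniform_prod hs ht fun a b => F (f a b),
    ← map_uniform_of_bijOn (hs.product ht) hu hf, PMF.bind_map]
  rfl

/-- Resampling a uniform element, given the value of a function of it. -/
theorem bind_resample {s : Finset α} (hs : s.Nonempty) [DecidableEq β] {f : α → β}
    {k : β → PMF α}
    (hk : ∀ a ∈ s, ∃ h, k (f a) = PMF.uniformOfFinset (s.filter fun a' => f a' = f a) h) (F : β → α → PMF γ) :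
    ((PMF.uniformOfFinset s hs).bind fun a => (k (f a)).bind fun a' => F (f a) a') =
      (PMF.uniformOfFinset s hs).bind fun a => F (f a) a := by
  classical
  -- Only elements a in the fiber of a₀ contribute to its mass, each with 1/|s| times the inverse
  -- size of that fiber; summing over the fiber leaves 1/|s|.
  have h1 : (PMF.uniformOfFinset s hs).bind (fun a => k (f a)) = PMF.uniformOfFinset s hs := by
    ext a₀
    rw [PMF.bind_apply, tsum_eq_sum (s := s) fun a ha => by simp [ha],
      PMF.uniformOfFinset_apply]
    have h2 : ∀ a ∈ s, PMF.uniformOfFinset s hs a * k (f a) a₀ =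
        if a₀ ∈ s ∧ f a = f a₀ then
          (s.card : ENNReal)⁻¹ * ((s.filter fun a' => f a' = f a₀).card : ENNReal)⁻¹ else 0 := by
      intro a ha
      obtain ⟨hn, hk⟩ := hk a ha
      rw [hk, PMF.uniformOfFinset_apply, PMF.uniformOfFinset_apply, if_pos ha]
      by_cases h : a₀ ∈ s ∧ f a = f a₀
      · rw [if_pos h, if_pos (Finset.mem_filter.2 ⟨h.1, h.2.symm⟩), h.2]
      · rw [if_neg h, if_neg fun h' => h ⟨(Finset.mem_filter.1 h').1,
          (Finset.mem_filter.1 h').2.symm⟩, mul_zero]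
    rw [Finset.sum_congr rfl h2]
    by_cases h0 : a₀ ∈ s
    · simp only [h0, true_and, if_true]
      rw [← Finset.sum_filter, Finset.sum_const, nsmul_eq_mul, mul_left_comm,
        ENNReal.mul_inv_cancel _ (ENNReal.natCast_ne_top _), mul_one]
      have : (s.filter fun a' => f a' = f a₀).card ≠ 0 :=
        Finset.card_ne_zero_of_mem (Finset.mem_filter.2 ⟨h0, rfl⟩)
      exact_mod_cast this
    · simp [h0]
  -- Resampling does not change the value of f, so F may read it off the new element.
  have h3 : ((PMF.uniformOfFinset s hs).bind fun a => (k (f a)).bind fun a' => F (f a) a') =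
      (PMF.uniformOfFinset s hs).bind fun a => (k (f a)).bind fun a' => F (f a') a' := by
    refine bind_congr_support fun a ha => ?_
    rw [PMF.mem_support_uniformOfFinset_iff] at ha
    refine bind_congr_support fun a' ha' => ?_
    obtain ⟨hn, hk⟩ := hk a ha
    rw [hk, PMF.mem_support_uniformOfFinset_iff, Finset.mem_filter] at ha'
    rw [ha'.2]
  rw [h3, ← PMF.bind_bind, h1]

theorem pr_bind_uniform {s : Finset α} (hs : s.Nonempty) (F : α → PMF Bool) :
    pr ((PMF.uniformOfFinset s hs).bind F) = (∑ a ∈ s, pr (F a)) / s.card := by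
  rw [pr_bind, tsum_eq_sum (s := s) fun a ha => by simp [ha], Finset.sum_div]
  refine Finset.sum_congr rfl fun a ha => ?_
  rw [PMF.uniformOfFinset_apply_of_mem hs ha, ENNReal.toReal_inv, ENNReal.toReal_natCast,
    div_eq_inv_mul]

/-- The bound is the total variation distance of the two uniform distributions: a uniform element of
t falls outside s with this probability. -/
theorem abs_pr_uniform_sub_le_of_subset {s t : Finset α} (hs : s.Nonempty) (hst : s ⊆ t)
    (F : α → PMF Bool) :
    |pr ((PMF.uniformOfFinset s hs).bind F) - pr ((PMF.uniformOfFinset t (hs.mono hst)).bind F)|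
      ≤ 1 - (s.card : ℝ) / t.card := by
  classical
  rw [pr_bind_uniform, pr_bind_uniform, ← Finset.sum_sdiff hst]
  have h1 : ∑ a ∈ s, pr (F a) ≤ s.card := by
    simpa using Finset.sum_le_card_nsmul s _ 1 fun a _ => pr_le_one (F a)
  have h2 : ∑ a ∈ t \ s, pr (F a) ≤ t.card - s.card := by
    have := Finset.sum_le_card_nsmul (t \ s) _ 1 fun a _ => pr_le_one (F a)
    rw [Finset.card_sdiff_of_subset hst, nsmul_eq_mul, mul_one,
      Nat.cast_sub (Finset.card_le_card hst)] at this
    exact this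
  have h3 : 0 ≤ ∑ a ∈ s, pr (F a) := Finset.sum_nonneg fun a _ => pr_nonneg _
  have h4 : 0 ≤ ∑ a ∈ t \ s, pr (F a) := Finset.sum_nonneg fun a _ => pr_nonneg _
  have hm : (0 : ℝ) < s.card := by exact_mod_cast hs.card_pos
  have hn : (s.card : ℝ) ≤ t.card := by exact_mod_cast Finset.card_le_card hst
  generalize ∑ a ∈ s, pr (F a) = x at *
  generalize ∑ a ∈ t \ s, pr (F a) = y at *
  generalize (s.card : ℝ) = m at *
  generalize (t.card : ℝ) = n at *
  have hn0 : 0 < n := hm.trans_le hn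
  -- Both terms on the right lie between 0 and 1 - m/n, so their difference is at most that in
  -- absolute value.
  have e : x / m - (y + x) / n = x / m * (1 - m / n) - y / n := by
    field_simp
    ring
  have hx : x / m ≤ 1 := (div_le_one hm).2 h1
  have hx0 : 0 ≤ x / m := by positivity
  have hy : y / n ≤ 1 - m / n := by
    rw [le_sub_iff_add_le, ← add_div, div_le_one hn0]
    linarith
  have hy0 : 0 ≤ y / n := by positivity
  have hmn : 0 ≤ 1 - m / n := by linarith
  rw [e, abs_le]
  constructor
  · nlinarith
  · nlinarith

end Uniform

end

section

/-! ### Uniform permutations and random subsets -/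

section Perm

variable {d : ℕ}

/-- Lets two independent samples exchange parts of their randomness. An involution is its own
inverse, so bijectivity needs no separate argument. -/
theorem bind_uniform_of_involutive {α β γ : Type} {s : Finset α} (hs : s.Nonempty) {t : Finset β}
    (ht : t.Nonempty) {e : α × β → α × β} (he : Function.Involutive e)
    (hm : ∀ x ∈ s ×ˢ t, e x ∈ s ×ˢ t) (F : α → β → PMF γ) :
    ((PMF.uniformOfFinset s hs).bind fun a => (PMF.uniformOfFinset t ht).bind fun b =>
      F (e (a, b)).1 (e (a, b)).2) =
      (PMF.uniformOfFinset s hs).bind fun a => (PMF.uniformOfFinset t ht).bind fun b => F a b := by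
  rw [bind_uniform_prod hs ht F]
  exact bind_uniform_of_bijOn hs ht (hs.product ht) (f := fun a b => e (a, b))
    ⟨fun x hx => hm x hx, he.injective.injOn, fun x hx => ⟨e x, hm x hx, he x⟩⟩
    fun x => F x.1 x.2

theorem exists_perm_of_fiber_card {γ : Type} [DecidableEq γ] (f g : Fin d → γ)
    (h : ∀ c, (Finset.univ.filter fun i => f i = c).card =
      (Finset.univ.filter fun i => g i = c).card) :
    ∃ α : Equiv.Perm (Fin d), ∀ i, g (α i) = f i := by
  have e : ∀ c, Nonempty ({i // f i = c} ≃ {i // g i = c}) := fun c =>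
    Fintype.card_eq.1 (by rw [Fintype.card_subtype, Fintype.card_subtype, h c])
  exact ⟨Equiv.ofFiberEquiv fun c => (e c).some, fun i => Equiv.ofFiberEquiv_map _ i⟩

/-- Chains of three sets of the same sizes differ by a permutation. -/
theorem exists_perm_chain {A B C A' B' C' : Finset (Fin d)} (hAB : A ⊆ B) (hBC : B ⊆ C)
    (hAB' : A' ⊆ B') (hBC' : B' ⊆ C') (hA : A.card = A'.card) (hB : B.card = B'.card)
    (hC : C.card = C'.card) :
    ∃ α : Equiv.Perm (Fin d), (∀ i, α i ∈ A' ↔ i ∈ A) ∧ (∀ i, α i ∈ B' ↔ i ∈ B) ∧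
      ∀ i, α i ∈ C' ↔ i ∈ C := by
  -- On a chain only four of the eight membership patterns occur, and their frequencies depend only
  -- on the three cardinalities. Equal frequencies give the permutation, fiber by fiber.
  have key : ∀ {A B C : Finset (Fin d)}, A ⊆ B → B ⊆ C → ∀ c : Bool × Bool × Bool,
      (Finset.univ.filter fun i => (decide (i ∈ A), decide (i ∈ B), decide (i ∈ C)) = c).card =
      match c with
      | (true, true, true) => A.card
      | (false, true, true) => B.card - A.card
      | (false, false, true) => C.card - B.card
      | (false, false, false) => d - C.card
      | _ => 0 := by
    intro A B C hAB hBC c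
    have hAC := hAB.trans hBC
    rcases c with ⟨_ | _, _ | _, _ | _⟩ <;>
      simp only [Prod.mk.injEq, decide_eq_true_iff, decide_eq_false_iff_not]
    · refine Eq.trans ?_ ((Finset.card_compl C).trans (by rw [Fintype.card_fin]))
      congr 1
      ext i
      simp only [Finset.mem_filter, Finset.mem_univ, true_and, Finset.mem_compl]
      exact ⟨fun h => h.2.2, fun h => ⟨fun h' => h (hAC h'), fun h' => h (hBC h'), h⟩⟩
    · rw [← Finset.card_sdiff_of_subset hBC]
      congr 1
      ext i
      simp only [Finset.mem_filter, Finset.mem_univ, true_and, Finset.mem_sdiff]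
      exact ⟨fun h => ⟨h.2.2, h.2.1⟩, fun h => ⟨fun h' => h.2 (hAB h'), h.2, h.1⟩⟩
    · exact Finset.card_eq_zero.2 (Finset.filter_eq_empty_iff.2 fun i _ h => h.2.2 (hBC h.2.1))
    · rw [← Finset.card_sdiff_of_subset hAB]
      congr 1
      ext i
      simp only [Finset.mem_filter, Finset.mem_univ, true_and, Finset.mem_sdiff]
      exact ⟨fun h => ⟨h.2.1, h.1⟩, fun h => ⟨h.2, h.1, hBC h.1⟩⟩
    · exact Finset.card_eq_zero.2 (Finset.filter_eq_empty_iff.2 fun i _ h => h.2.1 (hAB h.1))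
    · exact Finset.card_eq_zero.2 (Finset.filter_eq_empty_iff.2 fun i _ h => h.2.1 (hAB h.1))
    · exact Finset.card_eq_zero.2 (Finset.filter_eq_empty_iff.2 fun i _ h => h.2.2 (hAC h.1))
    · congr 1
      ext i
      simp only [Finset.mem_filter, Finset.mem_univ, true_and]
      exact ⟨fun h => h.1, fun h => ⟨h, hAB h, hAC h⟩⟩
  obtain ⟨α, hα⟩ := exists_perm_of_fiber_card
    (fun i => (decide (i ∈ A), decide (i ∈ B), decide (i ∈ C)))
    (fun i => (decide (i ∈ A'), decide (i ∈ B'), decide (i ∈ C'))) fun c => by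
      rw [key hAB hBC, key hAB' hBC', hA, hB, hC]
  simp only [Prod.mk.injEq, decide_eq_decide] at hα
  exact ⟨α, fun i => (hα i).1, fun i => (hα i).2.1, fun i => (hα i).2.2⟩

/-- A step of the Fisher-Yates shuffle. -/
def shuffleStep (i : Fin d) (σ : Equiv.Perm (Fin d)) : PMF (Equiv.Perm (Fin d)) :=
  (PMF.uniformOfFintype (Fin ((i : ℕ) + 1))).map fun r => Equiv.swap i (Fin.castLE i.2 r) * σ

theorem fixing_nonempty (m : ℕ) : (Finset.univ.filter
    fun σ : Equiv.Perm (Fin d) => ∀ k : Fin d, m ≤ k → σ k = k).Nonempty :=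
  ⟨1, Finset.mem_filter.2 ⟨Finset.mem_univ _, fun _ _ => rfl⟩⟩

/-- Every permutation τ fixing all k > m factors uniquely as a swap of m with τ m ≤ m, times a
permutation that also fixes m. So a uniform swap and the uniform permutation of the previous stage
combine to a uniform one. -/
theorem iterPMF_shuffleStep (m : ℕ) (hm : m ≤ d) :
    iterPMF (PMF.pure 1) shuffleStep m hm = PMF.uniformOfFinset
      (Finset.univ.filter fun σ : Equiv.Perm (Fin d) => ∀ k : Fin d, m ≤ k → σ k = k)
      (fixing_nonempty m) := by
  induction m with
  | zero =>
    ext σ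
    rw [iterPMF, PMF.uniformOfFinset_apply, PMF.pure_apply]
    have : (Finset.univ.filter fun σ : Equiv.Perm (Fin d) => ∀ k : Fin d, 0 ≤ (k : ℕ) → σ k = k)
        = {1} := by
      ext σ
      simp [Equiv.ext_iff]
    rw [this]
    simp
  | succ m ih =>
    rw [iterPMF, ih]
    change ((PMF.uniformOfFinset _ (fixing_nonempty m)).bind fun σ =>
      (PMF.uniformOfFinset (Finset.univ : Finset (Fin (m + 1))) Finset.univ_nonempty).bind
        fun r => PMF.pure (Equiv.swap ⟨m, hm⟩ (Fin.castLE hm r) * σ)) = _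
    refine (bind_uniform_of_bijOn _ _ (fixing_nonempty (m + 1)) (f := fun σ r =>
      Equiv.swap ⟨m, hm⟩ (Fin.castLE hm r) * σ) ⟨?_, ?_, ?_⟩ PMF.pure).trans (PMF.bind_pure _)
    · rintro ⟨σ, r⟩ h
      simp only [Finset.coe_product, Set.mem_prod, Finset.mem_coe, Finset.mem_filter,
        Finset.mem_univ, true_and, and_true] at h ⊢
      intro k hk
      rw [Equiv.Perm.mul_apply, h k (by omega), Equiv.swap_apply_of_ne_of_ne]
      · rintro rfl
        simp at hk
      · rintro rfl
        have := r.2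
        simp at hk
        omega
    · rintro ⟨σ, r⟩ h ⟨σ', r'⟩ h' e
      simp only [Finset.coe_product, Set.mem_prod, Finset.mem_coe, Finset.mem_filter,
        Finset.mem_univ, true_and, and_true] at h h' e
      have h1 := congrArg (fun τ : Equiv.Perm (Fin d) => τ ⟨m, hm⟩) e
      simp only [Equiv.Perm.mul_apply, h ⟨m, hm⟩ le_rfl, h' ⟨m, hm⟩ le_rfl,
        Equiv.swap_apply_left] at h1
      have h2 : r = r' := by simpa [Fin.ext_iff] using h1
      subst h2
      rw [mul_right_inj] at e
      rw [e]
    · intro τ hτ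
      simp only [Finset.mem_coe, Finset.mem_filter, Finset.mem_univ, true_and] at hτ
      have hr : (τ ⟨m, hm⟩ : ℕ) < m + 1 := by
        by_contra hlt
        have h1 := hτ (τ ⟨m, hm⟩) (by omega)
        have h2 := τ.injective h1
        rw [h2] at hlt
        simp at hlt
      refine ⟨(Equiv.swap ⟨m, hm⟩ (τ ⟨m, hm⟩) * τ, ⟨τ ⟨m, hm⟩, hr⟩), ?_, ?_⟩
      · simp only [Finset.coe_product, Set.mem_prod, Finset.mem_coe, Finset.mem_filter,
          Finset.mem_univ, true_and, and_true]
        intro k hk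
        rw [Equiv.Perm.mul_apply]
        rcases hk.eq_or_lt with h | h
        · have : k = ⟨m, hm⟩ := Fin.ext h.symm
          rw [this, Equiv.swap_apply_right]
        · rw [hτ k h, Equiv.swap_apply_of_ne_of_ne]
          · rintro rfl
            simp at h
          · intro hk'
            have : τ k = τ ⟨m, hm⟩ := by rw [hτ k h, ← hk']
            have := τ.injective this
            rw [this] at h
            simp at h
      · have : Fin.castLE hm (⟨τ ⟨m, hm⟩, hr⟩ : Fin (m + 1)) = τ ⟨m, hm⟩ := Fin.ext rfl
        simp only [this]
        rw [← mul_assoc, Equiv.swap_mul_self, one_mul]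

theorem uniform_perm_eq_iterPMF :
    PMF.uniformOfFintype (Equiv.Perm (Fin d)) = iterPMF (PMF.pure 1) shuffleStep d le_rfl := by
  rw [iterPMF_shuffleStep, uniformOfFintype_eq]
  refine uniform_congr _ ?_
  ext σ
  simp only [Finset.mem_univ, Finset.mem_filter, true_and, true_iff]
  intro k hk
  exact absurd k.2 (by omega)

/-- The set `T`, filled up to `v` elements with the elements of `A` that come first in the order
given by `τ`. -/
def pick (τ : Equiv.Perm (Fin d)) (A T : Finset (Fin d)) (v : ℕ) : Finset (Fin d) :=
  Finset.univ.filter fun i => i ∈ T ∨ i ∈ A ∧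
    (Finset.univ.filter fun j => j ∈ T ∨ j ∈ A ∧ τ j < τ i).card < v

/-- The rank within A with respect to τ is injective on A, and hence takes each value below |A|
exactly once. -/
theorem card_filter_rank_lt (τ : Equiv.Perm (Fin d)) (A : Finset (Fin d)) {m : ℕ}
    (hm : m ≤ A.card) :
    (A.filter fun i => (A.filter fun j => τ j < τ i).card < m).card = m := by
  set rank : Fin d → ℕ := fun i => (A.filter fun j => τ j < τ i).card with hrank
  have hlt : ∀ i ∈ A, ∀ i' ∈ A, τ i < τ i' → rank i < rank i' := by
    intro i hi i' _ h
    refine Finset.card_lt_card (Finset.ssubset_iff_of_subset ?_ |>.2 ⟨i, by simp [hi, h], by simp⟩)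
    intro j hj
    rw [Finset.mem_filter] at hj ⊢
    exact ⟨hj.1, hj.2.trans h⟩
  have hinj : Set.InjOn rank A := by
    intro i hi i' hi' h
    rcases lt_trichotomy (τ i) (τ i') with h' | h' | h'
    · exact absurd h (hlt i hi i' hi' h').ne
    · exact τ.injective h'
    · exact absurd h (hlt i' hi' i hi h').ne'
  have himg : A.image rank = Finset.range A.card := by
    refine Finset.eq_of_subset_of_card_le ?_ (by rw [Finset.card_image_of_injOn hinj]; simp)
    intro k hk
    obtain ⟨i, hi, rfl⟩ := Finset.mem_image.1 hk
    rw [Finset.mem_range]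
    exact Finset.card_lt_card (Finset.filter_ssubset.2 ⟨i, hi, by simp⟩)
  rw [← Finset.card_image_of_injOn (f := rank) (hinj.mono (by
    intro i hi; exact (Finset.mem_filter.1 hi).1)), ← Finset.filter_image
      (p := fun k => k < m), himg]
  have : (Finset.range A.card).filter (fun k => k < m) = Finset.range m := by
    ext k
    simp only [Finset.mem_filter, Finset.mem_range]
    omega
  rw [this, Finset.card_range]

theorem card_pick (τ : Equiv.Perm (Fin d)) {A T : Finset (Fin d)} {v : ℕ} (hAT : Disjoint A T)
    (h1 : T.card ≤ v) (h2 : v ≤ A.card + T.card) : (pick τ A T v).card = v := by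
  -- All of T is counted as preceding i, so the threshold v leaves room for exactly v - |T| elements
  -- of A.
  have h3 : ∀ i, (Finset.univ.filter fun j => j ∈ T ∨ j ∈ A ∧ τ j < τ i).card =
      (A.filter fun j => τ j < τ i).card + T.card := by
    intro i
    rw [← Finset.card_union_of_disjoint (hAT.mono_left (Finset.filter_subset _ _))]
    congr 1
    ext j
    simp only [Finset.mem_filter, Finset.mem_univ, true_and, Finset.mem_union]
    tauto
  have h4 : pick τ A T v =
      (A.filter fun i => (A.filter fun j => τ j < τ i).card < v - T.card) ∪ T := by
    ext i
    simp only [pick, h3, Finset.mem_filter, Finset.mem_univ, true_and, Finset.mem_union]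
    rw [Nat.lt_sub_iff_add_lt]
    tauto
  rw [h4, Finset.card_union_of_disjoint (hAT.mono_left (Finset.filter_subset _ _)),
    card_filter_rank_lt τ A (by omega)]
  omega

/-- By symmetry: for two admissible sets S and S', some α maps the chain T ⊆ S ⊆ A ∪ T to T ⊆ S' ⊆ A
∪ T, and τ ↦ τ α⁻¹ carries the orders that yield S to orders that yield S'. All fibers are thus
equally large. -/
theorem pick_uniform {A T : Finset (Fin d)} {v : ℕ} (hAT : Disjoint A T)
    (h1 : T.card ≤ v) (h2 : v ≤ A.card + T.card)
    (hne : (((A ∪ T).powersetCard v).filter fun S => T ⊆ S).Nonempty) :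
    ((PMF.uniformOfFintype (Equiv.Perm (Fin d))).map fun τ => pick τ A T v) =
      PMF.uniformOfFinset (((A ∪ T).powersetCard v).filter fun S => T ⊆ S) hne := by
  refine map_uniform_of_transitive _ hne (fun τ _ => ?_) fun S hS S' hS' => ?_
  · rw [Finset.mem_filter, Finset.mem_powersetCard]
    refine ⟨⟨fun i hi => ?_, card_pick τ hAT h1 h2⟩, fun i hi => ?_⟩
    · rw [pick, Finset.mem_filter] at hi
      rw [Finset.mem_union]
      tauto
    · rw [pick, Finset.mem_filter]
      exact ⟨Finset.mem_univ _, .inl hi⟩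
  · rw [Finset.mem_filter, Finset.mem_powersetCard] at hS hS'
    obtain ⟨α, hT, hS₁, hU⟩ := exists_perm_chain hS.2 hS.1.1 hS'.2 hS'.1.1 rfl
      (hS.1.2.trans hS'.1.2.symm) rfl
    have hA : ∀ i, α i ∈ A ↔ i ∈ A := by
      intro i
      have h3 := hU i
      have h4 := hT i
      rw [Finset.mem_union, Finset.mem_union] at h3
      have h5 : α i ∈ A → α i ∉ T := fun h h' => Finset.disjoint_left.1 hAT h h'
      have h6 : i ∈ A → i ∉ T := fun h h' => Finset.disjoint_left.1 hAT h h'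
      tauto
    refine ⟨fun τ => τ * α⁻¹, mul_left_injective _, fun τ _ hτ => ⟨Finset.mem_univ _, ?_⟩⟩
    ext i
    obtain ⟨i, rfl⟩ := α.surjective i
    rw [hS₁, ← hτ, pick, pick, Finset.mem_filter, Finset.mem_filter]
    have h7 : (Finset.univ.filter fun j => j ∈ T ∨ j ∈ A ∧ (τ * α⁻¹) j < (τ * α⁻¹) (α i)).card =
        (Finset.univ.filter fun j => j ∈ T ∨ j ∈ A ∧ τ j < τ i).card := by
      refine (Finset.card_bij (fun j _ => α j) ?_ (fun _ _ _ _ h => α.injective h) ?_).symm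
      · intro j hj
        simpa [hT, hA] using hj
      · intro j hj
        refine ⟨α⁻¹ j, ?_, by simp⟩
        obtain ⟨j, rfl⟩ := α.surjective j
        simpa [hT, hA] using hj
    rw [h7, hT, hA]
    simp

end Perm

end

section

/-! ### Scalars and points -/

namespace ECParams

variable (G : ECParams)

instance : Finite G.Pt := BitEnc.finite_type _

theorem two_le_q : 2 ≤ G.q := G.q_prime.out.two_le

theorem nsmul_B (n : ℕ) : n • G.B = G.mul (n : G.Scalar) G.B := by
  rw [mul, ZMod.val_natCast]
  conv_lhs => rw [← mod_addOrderOf_nsmul, G.order_B]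

theorem add_mul (a b : G.Scalar) : G.mul (a + b) G.B = G.mul a G.B + G.mul b G.B := by
  conv_lhs => rw [← ZMod.natCast_zmod_val a, ← ZMod.natCast_zmod_val b, ← Nat.cast_add]
  rw [← nsmul_B, add_nsmul]
  rfl

theorem mul_mul (a b : G.Scalar) : G.mul a (G.mul b G.B) = G.mul (a * b) G.B := by
  conv_rhs => rw [← ZMod.natCast_zmod_val a, ← ZMod.natCast_zmod_val b, ← Nat.cast_mul]
  rw [← nsmul_B, mul_nsmul']
  rfl

theorem zero_mul (X : G.Pt) : G.mul 0 X = 0 := by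
  rw [mul, ZMod.val_zero, zero_nsmul]

theorem one_mul (X : G.Pt) : G.mul 1 X = X := by
  have : Fact (1 < G.q) := ⟨G.two_le_q⟩
  rw [mul, ZMod.val_one, one_nsmul]

theorem mul_add (a : G.Scalar) (X Y : G.Pt) : G.mul a (X + Y) = G.mul a X + G.mul a Y :=
  nsmul_add _ _ _

theorem neg_mul (a : G.Scalar) : G.mul (-a) G.B = -G.mul a G.B := by
  rw [eq_neg_iff_add_eq_zero, ← add_mul, neg_add_cancel, zero_mul]

theorem sub_mul (a b : G.Scalar) : G.mul (a - b) G.B = G.mul a G.B - G.mul b G.B := by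
  rw [sub_eq_add_neg, add_mul, neg_mul, sub_eq_add_neg]

theorem mul_B_eq_zero {a : G.Scalar} : G.mul a G.B = 0 ↔ a = 0 := by
  rw [mul, ← addOrderOf_dvd_iff_nsmul_eq_zero, G.order_B]
  constructor
  · intro h
    rw [← ZMod.natCast_zmod_val a]
    exact (ZMod.natCast_eq_zero_iff _ _).2 h
  · rintro rfl
    simp

theorem mul_B_injective : Function.Injective fun a : G.Scalar => G.mul a G.B := by
  intro a b h
  rw [← sub_eq_zero, ← G.mul_B_eq_zero, sub_mul]
  exact sub_eq_zero.2 h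

theorem encrypt_eq (k x r : G.Scalar) :
    G.encrypt (G.mul k G.B) x r = (G.mul r G.B, G.mul (x + r * k) G.B) := by
  rw [encrypt, mul_mul, add_mul]

theorem nonzero_nonempty : (Finset.univ.filter fun k : G.Scalar => k ≠ 0).Nonempty :=
  ⟨1, by simp⟩

theorem nonce_eq : G.nonce = PMF.uniformOfFinset _ G.nonzero_nonempty := rfl

theorem card_nonzero : (Finset.univ.filter fun k : G.Scalar => k ≠ 0).card = G.q - 1 := by
  rw [Finset.filter_ne', Finset.card_erase_of_mem (Finset.mem_univ _), Finset.card_univ, ZMod.card]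

/-- The vectors with nonzero entries. -/
def nonzeroVec (ι : Type) [Fintype ι] [DecidableEq ι] : Finset (ι → G.Scalar) :=
  Fintype.piFinset fun _ => Finset.univ.filter fun k : G.Scalar => k ≠ 0

theorem mem_nonzeroVec {ι : Type} [Fintype ι] [DecidableEq ι] {v : ι → G.Scalar} :
    v ∈ G.nonzeroVec ι ↔ ∀ i, v i ≠ 0 := by
  simp [nonzeroVec, Fintype.mem_piFinset]

theorem nonzeroVec_nonempty (ι : Type) [Fintype ι] [DecidableEq ι] : (G.nonzeroVec ι).Nonempty :=
  ⟨fun _ => 1, G.mem_nonzeroVec.2 fun _ => one_ne_zero⟩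

theorem nonces_eq (n : ℕ) :
    G.nonces n = PMF.uniformOfFinset _ (G.nonzeroVec_nonempty (Fin n)) := rfl

/-- Circuits sample the entries one after the other, which gives the same distribution as one
uniform vector. -/
theorem nonces_eq_seqPMF (n : ℕ) : G.nonces n = seqPMF n fun _ => G.nonce := by
  induction n with
  | zero =>
    rw [seqPMF, nonces_eq]
    ext v
    rw [PMF.uniformOfFinset_apply, PMF.pure_apply, if_pos (Subsingleton.elim _ _),
      if_pos (G.mem_nonzeroVec.2 fun i => i.elim0)]
    simp [nonzeroVec]
  | succ n ih =>
    rw [seqPMF, ← ih, nonces_eq, nonces_eq, nonce_eq]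
    refine ((bind_uniform_of_bijOn _ _ (G.nonzeroVec_nonempty (Fin (n + 1)))
      (f := fun (a : G.Scalar) (v : Fin n → G.Scalar) => (Fin.cons a v : Fin (n + 1) → G.Scalar))
      ⟨?_, ?_, ?_⟩ PMF.pure).trans (PMF.bind_pure _)).symm
    · rintro ⟨a, v⟩ h
      simp only [Finset.mem_coe, Finset.mem_product, Finset.mem_filter, mem_nonzeroVec] at h ⊢
      exact Fin.cases h.1.2 h.2
    · rintro ⟨a, v⟩ _ ⟨a', v'⟩ _ h
      obtain ⟨h1, h2⟩ := Fin.cons_injective2 h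
      exact Prod.ext h1 h2
    · intro v h
      refine ⟨(v 0, Fin.tail v), ?_, Fin.cons_self_tail v⟩
      simp only [Finset.mem_coe, Finset.mem_product, Finset.mem_filter, mem_nonzeroVec,
        Finset.mem_univ, true_and] at h ⊢
      exact ⟨h 0, fun i => h i.succ⟩

/-- Singling out one of the nonces. -/
theorem nonces_bind_update {γ : Type} {n : ℕ} (m : Fin n) (F : (Fin n → G.Scalar) → PMF γ) :
    ((G.nonces n).bind fun t => G.nonce.bind fun r => F (Function.update t m r)) =
      (G.nonces n).bind F := by
  rw [nonces_eq, nonce_eq]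
  -- The fresh nonce and the m-th entry change places; the displaced entry is then ignored.
  have h := bind_uniform_of_involutive (G.nonzeroVec_nonempty (Fin n)) G.nonzero_nonempty
    (e := fun x => (Function.update x.1 m x.2, x.1 m)) (fun x => by simp)
    (fun x hx => by
      simp only [Finset.mem_product, Finset.mem_filter, mem_nonzeroVec, Finset.mem_univ,
        true_and] at hx ⊢
      refine ⟨fun i => ?_, hx.1 m⟩
      by_cases hi : i = m
      · subst hi
        simpa using hx.2
      · simpa [hi] using hx.1 i) fun t _ => F t
  simpa only [PMF.bind_const] using h

/-- Nonces taken from two vectors, without repetition. -/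
theorem nonces_bind_merge {γ : Type} {m n : ℕ} {P : Fin n → Prop} [DecidablePred P]
    (e : {j // P j} ≃ Fin m) (F : (Fin n → G.Scalar) → PMF γ) :
    ((G.nonces m).bind fun ρ => (G.nonces n).bind fun ζ =>
      F fun j => if h : P j then ρ (e ⟨j, h⟩) else ζ j) = (G.nonces n).bind F := by
  -- The entries of ζ at the positions satisfying P are exchanged with the entries of ρ; what ends
  -- up in ρ is discarded.
  have h := bind_uniform_of_involutive (G.nonzeroVec_nonempty (Fin m))
    (G.nonzeroVec_nonempty (Fin n))
    (e := fun x => (fun k => x.2 (e.symm k).1,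
      fun j => if h : P j then x.1 (e ⟨j, h⟩) else x.2 j))
    (fun x => by
      refine Prod.ext (funext fun k => ?_) (funext fun j => ?_)
      · simp [(e.symm k).2]
      · by_cases hj : P j <;> simp [hj])
    (fun x hx => by
      simp only [Finset.mem_product, mem_nonzeroVec] at hx ⊢
      refine ⟨fun k => hx.2 _, fun j => ?_⟩
      by_cases hj : P j
      · simpa [hj] using hx.1 _
      · simpa [hj] using hx.2 _) fun _ ζ => F ζ
  rw [nonces_eq, nonces_eq]
  simpa only [PMF.bind_const] using h

theorem abs_pr_nonces_sub_le {n : ℕ} (F : (Fin n → G.Scalar) → PMF Bool) :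
    |pr ((G.nonces n).bind F) - pr ((PMF.uniformOfFintype (Fin n → G.Scalar)).bind F)| ≤
      n * (1 / G.q) := by
  have h := abs_pr_uniform_sub_le_of_subset (G.nonzeroVec_nonempty (Fin n))
    (Finset.subset_univ _) F
  refine h.trans ?_
  have hq : (2 : ℝ) ≤ G.q := by exact_mod_cast G.two_le_q
  have hcard : ((G.nonzeroVec (Fin n)).card : ℝ) /
      ((Finset.univ : Finset (Fin n → G.Scalar)).card : ℝ) = (1 + -(1 / G.q)) ^ n := by
    rw [nonzeroVec, Fintype.card_piFinset_const, card_nonzero, Finset.card_univ,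
      Fintype.card_fun, ZMod.card, Fintype.card_fin, Nat.cast_pow, Nat.cast_pow,
      Nat.cast_sub (by have := G.two_le_q; omega), ← div_pow]
    congr 1
    field_simp
    push_cast
    ring
  rw [hcard]
  -- Bernoulli's inequality: (1 - 1/q) ^ n ≥ 1 - n/q.
  have := one_add_mul_le_pow (a := -(1 / (G.q : ℝ))) (by
    have : 1 / (G.q : ℝ) ≤ 1 := by
      rw [div_le_one (by linarith)]
      linarith
    linarith) n
  linarith

/-- Shifting and permuting nonces is statistically hard to notice. -/
theorem abs_pr_nonces_comp_sub_le {n : ℕ} {e : (Fin n → G.Scalar) → Fin n → G.Scalar}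
    (he : Function.Bijective e) (F : (Fin n → G.Scalar) → PMF Bool) :
    |pr ((G.nonces n).bind fun t => F (e t)) - pr ((G.nonces n).bind F)| ≤
      2 * (n * (1 / G.q)) := by
  have h1 := G.abs_pr_nonces_sub_le F
  have h2 := G.abs_pr_nonces_sub_le fun t => F (e t)
  -- A uniform vector is exactly invariant under the bijection e. The factor 2 pays for passing from
  -- nonzero entries to arbitrary ones and back.
  have h3 : ((PMF.uniformOfFintype (Fin n → G.Scalar)).bind fun t => F (e t)) =
      (PMF.uniformOfFintype (Fin n → G.Scalar)).bind F := by
    have := map_uniform_of_bijOn (s := (Finset.univ : Finset (Fin n → G.Scalar)))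
      Finset.univ_nonempty Finset.univ_nonempty (f := e) (by simpa using he)
    rw [uniformOfFintype_eq]
    conv_rhs => rw [← this, PMF.bind_map]
    rfl
  rw [h3] at h2
  rw [abs_le] at *
  constructor <;> linarith [h1.1, h1.2, h2.1, h2.2]

theorem abs_pr_nonce_sub_le (F : G.Scalar → PMF Bool) :
    |pr (G.nonce.bind F) - pr ((PMF.uniformOfFintype G.Scalar).bind F)| ≤ 1 / G.q := by
  refine (abs_pr_uniform_sub_le_of_subset G.nonzero_nonempty (Finset.subset_univ _) F).trans ?_
  have hq : (2 : ℝ) ≤ G.q := by exact_mod_cast G.two_le_q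
  rw [card_nonzero, Finset.card_univ, ZMod.card, Nat.cast_sub (by have := G.two_le_q; omega)]
  refine le_of_eq ?_
  field_simp
  push_cast
  ring

/-- The order q of B is at most the number of points, and a point is encoded by two coordinates and
one bit. So the assumption on the length of p also bounds the length of scalars. -/
theorem size_q_le : G.q.size ≤ 2 * G.p.size + 2 := by
  rw [Nat.size_le]
  have h1 : G.q ≤ Nat.card G.Pt := by
    rw [← G.order_B]
    exact Nat.le_of_dvd Nat.card_pos (addOrderOf_dvd_natCard G.B)
  have h2 : Nat.card G.Pt ≤ Nat.card (BitEnc.Idx G.Pt → Bool) :=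
    Nat.card_le_card_of_injective _ BitEnc.inj
  have h3 : Nat.card (BitEnc.Idx G.Pt) = 2 * G.p.size + 1 := by
    show Nat.card (Option (Fin _ ⊕ Fin _)) = _
    rw [Finite.card_option, Nat.card_sum, Nat.card_fin]
    ring
  rw [Nat.card_fun, h3, Nat.card_eq_fintype_card (α := Bool), Fintype.card_bool] at h2
  calc G.q ≤ 2 ^ (2 * G.p.size + 1) := h1.trans h2
    _ < _ := Nat.pow_lt_pow_right (by norm_num) (by omega)

end ECParams

end

section

/-! ### Polynomial-time families -/

theorem PPT.eff {𝓔 : ECFamily} {α β : ℕ → Type} [∀ z, BitEnc (α z)] [∀ z, BitEnc (β z)]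
    {f : ∀ z, α z → PMF (β z)} (h : PPT 𝓔 f) : Eff (fun z => z) (fun z => 𝓔 z) f := by
  obtain ⟨c, hc, h⟩ := h
  exact ⟨fun z => (c z).size, hc, fun z => ⟨c z,
    (Nat.le_add_right _ _).trans (Circuit.size_eq (c z)).ge, h z⟩⟩

/-- The size of a circuit includes its output length. This bounds the lengths of the adversaries'
outputs, about which nothing is assumed directly. -/
theorem PPT.card_out {𝓔 : ECFamily} {α β : ℕ → Type} [∀ z, BitEnc (α z)] [∀ z, BitEnc (β z)]
    {f : ∀ z, α z → PMF (β z)} (h : PPT 𝓔 f) : PBC (fun z => z) β := by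
  obtain ⟨c, hc, -⟩ := h
  exact PB.mono (f := fun z => Nat.card (BitEnc.Idx (β z))) hc fun z => by
    rw [Circuit.size_eq]; omega

theorem Eff.ppt {𝓔 : ECFamily} {α β : ℕ → Type} [∀ z, BitEnc (α z)] [∀ z, BitEnc (β z)]
    {f : ∀ z, α z → PMF (β z)} (h : Eff (fun z => z) (fun z => 𝓔 z) f)
    (hβ : PBC (fun z => z) β) : PPT 𝓔 f := by
  obtain ⟨s, hs, h⟩ := h
  choose c hc h using h
  refine ⟨c, ?_, h⟩
  refine PB.mono (κ := fun z => z) (PB.add hs hβ) fun z => ?_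
  rw [Circuit.size_eq]
  exact Nat.add_le_add_right (hc z) _

/-- The encoding of `a` as a bit string. -/
def toBits {α : Type} [BitEnc α] (a : α) : BitString (Nat.card (BitEnc.Idx α)) :=
  fun i => BitEnc.enc a ((Finite.equivFin _).symm i)

section

variable {J : Type} {κ : J → ℕ} {G : J → ECParams} {Γ α β γ : J → Type}
  [∀ j, BitEnc (Γ j)] [∀ j, BitEnc (α j)] [∀ j, BitEnc (β j)] [∀ j, BitEnc (γ j)]

theorem EffD.toBits {f : ∀ j, Γ j → α j} (hf : EffD κ G f) :
    EffD κ G fun j x => toBits (f j x) :=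
  hf.of_enc (fun _ i => (Finite.equivFin _).symm i.1) fun _ _ => rfl

/-- An efficient function extends to all bit strings, in place of the encodings of arguments. -/
theorem Eff.exists_bits (hγ : ∀ j, Function.Surjective (BitEnc.enc (α := γ j)))
    {f : ∀ j, α j × β j → PMF (γ j)} (hf : Eff κ G f) :
    ∃ f' : ∀ j, BitString (Nat.card (BitEnc.Idx (α j))) × β j → PMF (γ j),
      Eff κ G f' ∧ ∀ j a b, f' j (PartialView.toBits a, b) = f j (a, b) := by
  obtain ⟨s, hs, H⟩ := hf
  choose C hC hC' using H
  let e : ∀ j, γ j ≃ (BitEnc.Idx (γ j) → Bool) :=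
    fun j => Equiv.ofBijective _ ⟨BitEnc.inj, hγ j⟩
  let r : ∀ j, BitEnc.Idx (α j × β j) →
      BitEnc.Idx (BitString (Nat.card (BitEnc.Idx (α j))) × β j) :=
    fun j => Sum.map (fun i => (Finite.equivFin _ i, ())) id
  -- On strings that encode no argument, the value is whatever the circuit outputs. It can be
  -- decoded because every bit string encodes an element of γ.
  refine ⟨fun j x => ((C j).eval (BitEnc.enc x ∘ r j)).map (e j).symm,
    ⟨s, hs, fun j => ⟨(C j).rename (r j), by rw [Circuit.gates_rename]; exact hC j,
      fun x => ?_⟩⟩, fun j a b => ?_⟩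
  · rw [Circuit.eval_rename, PMF.map_comp]
    have : BitEnc.enc ∘ (e j).symm = id := funext fun y => (e j).apply_symm_apply y
    rw [this, PMF.map_id]
  · have : BitEnc.enc (PartialView.toBits a, b) ∘ r j = BitEnc.enc (a, b) := by
      funext i
      rcases i with i | i
      · show BitEnc.enc a ((Finite.equivFin _).symm (Finite.equivFin _ i)) = BitEnc.enc a i
        rw [Equiv.symm_apply_apply]
      · rfl
    simp only [this]
    rw [hC', PMF.map_comp]
    have : (e j).symm ∘ BitEnc.enc = id := funext fun y => (e j).symm_apply_apply y
    rw [this, PMF.map_id]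

theorem Eff.nonce (hq : PB κ fun j => (G j).q.size) :
    Eff κ G fun j (_ : Γ j) => (G j).nonce := by
  -- Nonzero residues are the integers from 1 to 1 + (q - 2), where q ≥ 2.
  have h := Eff.sample (Γ := Γ) (G := G) (κ := κ) (β := fun j => (G j).Scalar) (fun _ => 1)
    (fun j => (G j).q - 2) (PB.mono hq fun j => Nat.size_le_size (by
      have := (G j).two_le_q; omega))
    (fun j k => ((1 + (k : ℕ) : ℕ) : (G j).Scalar)) (fun j i => i.1) (fun j k i => by
      show ((1 + (k : ℕ) : ℕ) : (G j).Scalar).val.testBit i.1 = _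
      rw [ZMod.val_natCast_of_lt]
      have := (G j).two_le_q
      omega)
  convert h using 3 with j x
  symm
  rw [uniformOfFintype_eq, ECParams.nonce_eq]
  have hq := (G j).two_le_q
  refine map_uniform_of_bijOn _ _ ⟨?_, ?_, ?_⟩
  · intro k _
    simp only [Finset.mem_coe, Finset.mem_filter, Finset.mem_univ, true_and]
    rw [Ne, ZMod.natCast_eq_zero_iff]
    exact fun h => absurd (Nat.le_of_dvd (by omega) h) (by omega)
  · intro k _ k' _ h
    have h' := congrArg ZMod.val h
    rw [ZMod.val_natCast_of_lt (by omega), ZMod.val_natCast_of_lt (by omega)] at h'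
    exact Fin.ext (by omega)
  · intro a ha
    simp only [Finset.mem_coe, Finset.mem_filter, Finset.mem_univ, true_and] at ha
    have h1 : a.val ≠ 0 := by rwa [Ne, ZMod.val_eq_zero]
    have h2 := a.val_lt
    refine ⟨⟨a.val - 1, by omega⟩, by simp, ?_⟩
    show ((1 + (a.val - 1) : ℕ) : (G j).Scalar) = a
    rw [show 1 + (a.val - 1) = a.val by omega, ZMod.natCast_zmod_val]

theorem Eff.nonces {n : J → ℕ} (hn : PB κ n) (hq : PB κ fun j => (G j).q.size) :
    Eff κ G fun j (_ : Γ j) => (G j).nonces (n j) := by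
  simp only [ECParams.nonces_eq_seqPMF]
  exact Eff.seq (f := fun j _ _ => (G j).nonce) hn (Eff.nonce (hq.reindex _))

theorem EffD.encrypt {K : ∀ j, Γ j → (G j).Pt} {x r : ∀ j, Γ j → (G j).Scalar}
    (hK : EffD κ G K) (hx : EffD κ G x) (hr : EffD κ G r) :
    EffD κ G fun j y => (G j).encrypt (K j y) (x j y) (r j y) :=
  (hr.mul (.const fun j => (G j).B)).pair ((hx.mul (.const fun j => (G j).B)).add (hr.mul hK))

end

theorem poly_p (𝓔 : ECFamily) : PB (fun z => z) fun z => (𝓔 z).p.size := 𝓔.poly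

theorem poly_q (𝓔 : ECFamily) : PB (fun z => z) fun z => (𝓔 z).q.size :=
  PB.mono (((PB.const 2).mul (poly_p 𝓔)).add (PB.const 2)) fun z => (𝓔 z).size_q_le

/-! ### Negligible functions -/

theorem Negligible.mono {f g : ℕ → ℝ} (hg : Negligible g) (hf : ∀ z, |f z| ≤ g z) :
    Negligible f :=
  Asymptotics.SuperpolynomialDecay.trans_abs_le hg fun z => (hf z).trans (le_abs_self _)

theorem Negligible.natCast_mul {f : ℕ → ℝ} (hf : Negligible f) {n : ℕ → ℕ}
    (hn : PB (fun z => z) n) : Negligible fun z => n z * f z := by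
  obtain ⟨c, hc⟩ := hn
  have h1 := (hf.param_pow_mul c).add (hf.const_mul (c : ℝ))
  refine Asymptotics.SuperpolynomialDecay.trans_abs_le h1 fun z => ?_
  simp only [Pi.add_apply, Pi.mul_apply, Pi.pow_apply]
  rw [← _root_.add_mul, abs_mul, abs_mul]
  refine mul_le_mul_of_nonneg_right ?_ (abs_nonneg _)
  rw [Nat.abs_cast, abs_of_nonneg (by positivity)]
  exact_mod_cast hc z

end

section

/-! ### Semantic security -/

theorem pr_bind_const {α : Type} {μ : PMF α} {f : α → PMF Bool} {c : ℝ}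
    (h : ∀ a ∈ μ.support, pr (f a) = c) : pr (μ.bind f) = c := by
  rw [pr_bind, ← one_mul c, ← tsum_toReal μ, ← tsum_mul_right]
  refine tsum_congr fun a => ?_
  by_cases ha : a ∈ μ.support
  · rw [h a ha]
  · rw [PMF.mem_support_iff, not_not] at ha
    simp [ha]

theorem pr_uniform_decide_eq {α : Type} [DecidableEq α] {s : Finset α} (hs : s.Nonempty) {a₀ : α}
    (h : a₀ ∈ s) {P : α → Prop} [DecidablePred P] (hP : ∀ a ∈ s, P a ↔ a = a₀) :
    pr ((PMF.uniformOfFinset s hs).bind fun a => PMF.pure (decide (P a))) = 1 / s.card := by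
  rw [pr_bind_uniform]
  congr 1
  rw [Finset.sum_eq_single a₀, pr_pure]
  · simp [(hP a₀ h).2 rfl]
  · intro a ha ha'
    rw [pr_pure]
    simp [(hP a ha).not.2 ha']
  · exact fun h' => absurd h h'

theorem enc_bool_surjective : Function.Surjective (BitEnc.enc (α := Bool)) :=
  fun x => ⟨x (), funext fun _ => rfl⟩

theorem enc_bitString_surjective (l : ℕ) :
    Function.Surjective (BitEnc.enc (α := BitString l)) :=
  fun x => ⟨fun i => x (i, ()), rfl⟩

/-- One bit of the game of semantic security, with fixed plaintexts and without a state. -/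
def cpaGame (G : ECParams) (x : G.Scalar) (g : G.Pt × G.Cipher → PMF Bool) : PMF Bool :=
  G.nonce.bind fun k => G.nonce.bind fun r =>
    g (G.mul k G.B, G.encrypt (G.mul k G.B) x r)

/-- Semantic security bounds the advantages in a uniformly efficient family of adversaries. -/
theorem SemanticallySecure.exists_bound {𝓔 : ECFamily} (h : SemanticallySecure 𝓔)
    {I : ℕ → Type} [∀ z, Finite (I z)] [∀ z, Nonempty (I z)]
    (x₀ x₁ : ∀ z, I z → (𝓔 z).plain)
    (g : ∀ p : (Σ z, I z), (𝓔 p.1).Pt × (𝓔 p.1).Cipher → PMF Bool)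
    (hg : Eff (fun p : (Σ z, I z) => p.1) (fun p => 𝓔 p.1) g) :
    ∃ ε : ℕ → ℝ, Negligible ε ∧ ∀ z i,
      |pr (cpaGame (𝓔 z) (x₁ z i) (g ⟨z, i⟩)) - pr (cpaGame (𝓔 z) (x₀ z i) (g ⟨z, i⟩))| ≤ ε z := by
  -- For each z a member with the greatest advantage is hard-wired, so the bound holds for all
  -- members at once.
  choose i hi using fun z => Finite.exists_max fun i : I z =>
    |pr (cpaGame (𝓔 z) (x₁ z i) (g ⟨z, i⟩)) - pr (cpaGame (𝓔 z) (x₀ z i) (g ⟨z, i⟩))|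
  have hgi := hg.reindex fun z => (⟨z, i z⟩ : Σ z, I z)
  obtain ⟨g', hg', hgg'⟩ := Eff.exists_bits (fun _ => enc_bool_surjective)
    (α := fun z => (𝓔 z).Pt) (β := fun z => (𝓔 z).Cipher) hgi
  refine ⟨_, ?_, hi⟩
  -- The guessing stage is not given the public key again, so the key is passed on as the state.
  have hn := h _ (fun z K => PMF.pure ((x₀ z (i z), x₁ z (i z)), toBits K)) g'
    (Eff.ppt (EffD.pair (EffD.const fun z => (x₀ z (i z), x₁ z (i z))) EffD.id.toBits)
      (PBC.prod (PBC.prod (PBC.scalar (poly_q 𝓔)) (PBC.scalar (poly_q 𝓔)))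
        (PBC.bitString (PBC.pt (poly_p 𝓔)))))
    (Eff.ppt hg' PBC.bool)
  refine hn.mono fun z => le_of_eq ?_
  rw [abs_abs]
  have key : ∀ b, semGame (𝓔 z) (fun K => PMF.pure ((x₀ z (i z), x₁ z (i z)), toBits K)) (g' z) b =
      cpaGame (𝓔 z) (if b then (x₁ z (i z)) else (x₀ z (i z)) : (𝓔 z).plain) (g ⟨z, i z⟩) := by
    intro b
    change ((𝓔 z).nonce.bind fun k => (PMF.pure _).bind fun p => (𝓔 z).nonce.bind fun r => _) = _
    rw [cpaGame]
    congr 1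
    funext k
    rw [PMF.pure_bind]
    congr 1
    funext r
    show g' z (toBits _, _) = _
    rw [hgg']
    cases b <;> rfl
  rw [key, key]
  rfl

/-- The adversary tests C₂ = 0. For the plaintext 0 this never happens, because r k ≠ 0; for the
plaintext 1 it happens for exactly one nonce, r = -k⁻¹, hence with probability 1/(q - 1) ≥ 1/q. -/
theorem SemanticallySecure.negligible_inv_q {𝓔 : ECFamily} (h : SemanticallySecure 𝓔) :
    Negligible fun z => 1 / ((𝓔 z).q : ℝ) := by
  classical
  obtain ⟨ε, hε, H⟩ := h.exists_bound (I := fun _ => Unit) (fun z _ => ⟨0, (𝓔 z).zero_mem⟩)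
    (fun z _ => ⟨1, (𝓔 z).one_mem⟩) (fun p y => PMF.pure (decide (y.2.2 = 0)))
    (EffP.toEffD (EffP.eqConst (PBC.pt ((poly_p 𝓔).reindex _)) EffD.id.snd.snd fun _ => 0))
  refine hε.mono fun z => ?_
  have hH := H z ()
  have h0 : pr (cpaGame (𝓔 z) 0 fun y => PMF.pure (decide (y.2.2 = 0))) = 0 := by
    refine pr_bind_const fun k hk => pr_bind_const fun r hr => ?_
    rw [ECParams.nonce_eq, PMF.mem_support_uniformOfFinset_iff, Finset.mem_filter] at hk hr
    rw [pr_pure, ECParams.encrypt_eq]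
    simp [ECParams.mul_B_eq_zero, hk.2, hr.2]
  have h1 : pr (cpaGame (𝓔 z) 1 fun y => PMF.pure (decide (y.2.2 = 0))) =
      1 / (((𝓔 z).q - 1 : ℕ) : ℝ) := by
    refine pr_bind_const fun k hk => ?_
    rw [ECParams.nonce_eq, PMF.mem_support_uniformOfFinset_iff, Finset.mem_filter] at hk
    rw [ECParams.nonce_eq, ← ECParams.card_nonzero]
    refine pr_uniform_decide_eq _ (a₀ := -k⁻¹) ?_ fun r _ => ?_
    · simpa using hk.2
    · have hk' : -k⁻¹ * k = -1 := by rw [neg_mul, inv_mul_cancel₀ hk.2]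
      rw [ECParams.encrypt_eq, ECParams.mul_B_eq_zero]
      constructor
      · exact fun h => mul_right_cancel₀ hk.2 (by rw [hk']; linear_combination h)
      · rintro rfl
        rw [hk']
        ring
  rw [h0, h1, sub_zero] at hH
  have hq : (2 : ℝ) ≤ (𝓔 z).q := by exact_mod_cast (𝓔 z).two_le_q
  refine le_trans ?_ ((le_abs_self _).trans hH)
  rw [abs_of_nonneg (by positivity), Nat.cast_sub (by have := (𝓔 z).two_le_q; omega)]
  exact one_div_le_one_div_of_le (by push_cast; linarith) (by push_cast; linarith)

/-! ### Security under the decisional Diffie-Hellman assumption -/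

/-- The test asks whether the first and the third point are zero. This has probability 1/q for a
Diffie-Hellman triple, where a = 0 suffices, and 1/q² for a random one. As 1/q ≤ 1/2, the difference
is at least half of 1/q, whence the factor 2. -/
theorem DDH.negligible_inv_q {𝓔 : ECFamily} (h : DDH 𝓔) :
    Negligible fun z => 1 / ((𝓔 z).q : ℝ) := by
  classical
  have hT : PPT 𝓔 fun z (y : (𝓔 z).Pt × (𝓔 z).Pt × (𝓔 z).Pt) =>
      PMF.pure (decide (y.1 = 0 ∧ y.2.2 = 0)) :=
    Eff.ppt (EffP.toEffD ((EffP.eqConst (PBC.pt (poly_p 𝓔)) EffD.id.fst fun _ => 0).and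
      (EffP.eqConst (PBC.pt (poly_p 𝓔)) EffD.id.snd.snd fun _ => 0))) PBC.bool
  have hn := (h _ hT).const_mul 2
  refine Negligible.mono hn fun z => ?_
  have hq : (2 : ℝ) ≤ (𝓔 z).q := by exact_mod_cast (𝓔 z).two_le_q
  have h1 : pr ((ddhTriple (𝓔 z)).bind fun y => PMF.pure (decide (y.1 = 0 ∧ y.2.2 = 0))) =
      1 / (𝓔 z).q := by
    change pr (((PMF.uniformOfFintype (𝓔 z).Scalar).bind fun a =>
      (PMF.uniformOfFintype (𝓔 z).Scalar).bind fun b => PMF.pure _).bind _) = _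
    simp only [PMF.bind_bind, PMF.pure_bind]
    rw [PMF.bind_comm]
    refine pr_bind_const fun b _ => ?_
    rw [uniformOfFintype_eq]
    refine (pr_uniform_decide_eq _ (a₀ := 0) (Finset.mem_univ _) fun a _ => ?_).trans ?_
    · simp only [ECParams.mul_B_eq_zero]
      constructor
      · exact fun h => h.1
      · rintro rfl
        simp
    · rw [Finset.card_univ, ZMod.card]
  have h2 : pr ((randomTriple (𝓔 z)).bind fun y => PMF.pure (decide (y.1 = 0 ∧ y.2.2 = 0))) =
      1 / (𝓔 z).q * (1 / (𝓔 z).q) := by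
    change pr (((PMF.uniformOfFintype (𝓔 z).Scalar).bind fun a =>
      (PMF.uniformOfFintype (𝓔 z).Scalar).bind fun b =>
      (PMF.uniformOfFintype (𝓔 z).Scalar).bind fun c => PMF.pure _).bind _) = _
    simp only [PMF.bind_bind, PMF.pure_bind]
    rw [PMF.bind_comm]
    refine pr_bind_const fun b _ => ?_
    rw [uniformOfFintype_eq, bind_uniform_prod _ _ fun a c => PMF.pure
      (decide ((𝓔 z).mul a (𝓔 z).B = 0 ∧ (𝓔 z).mul c (𝓔 z).B = 0))]
    refine (pr_uniform_decide_eq _ (a₀ := (0, 0)) (by simp) fun a _ => ?_).trans ?_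
    · simp only [ECParams.mul_B_eq_zero]
      rw [Prod.ext_iff]
    · rw [Finset.card_product, Finset.card_univ, ZMod.card, Nat.cast_mul]
      field_simp
  change |1 / ((𝓔 z).q : ℝ)| ≤ 2 * |pr _ - pr _|
  rw [h1, h2, abs_of_nonneg (by positivity)]
  have h3 : 1 / ((𝓔 z).q : ℝ) ≤ 1 / 2 := one_div_le_one_div_of_le (by norm_num) hq
  have h4 : 0 ≤ 1 / ((𝓔 z).q : ℝ) := by positivity
  refine le_trans ?_ (mul_le_mul_of_nonneg_left (le_abs_self _) (by norm_num))
  nlinarith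

theorem abs_pr_nonce_nonce_sub_le (G : ECParams) (H : G.Scalar → G.Scalar → PMF Bool) :
    |pr (G.nonce.bind fun k => G.nonce.bind fun r => H k r) -
      pr ((PMF.uniformOfFintype G.Scalar).bind fun k =>
        (PMF.uniformOfFintype G.Scalar).bind fun r => H k r)| ≤ 2 * (1 / G.q) := by
  have h1 := G.abs_pr_nonce_sub_le fun k => G.nonce.bind fun r => H k r
  have h2 : |pr ((PMF.uniformOfFintype G.Scalar).bind fun k => G.nonce.bind fun r => H k r) -
      pr ((PMF.uniformOfFintype G.Scalar).bind fun k =>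
        (PMF.uniformOfFintype G.Scalar).bind fun r => H k r)| ≤ 1 / G.q :=
    abs_pr_bind_sub_le fun k _ => G.abs_pr_nonce_sub_le _
  rw [abs_le] at *
  constructor <;> linarith [h1.1, h1.2, h2.1, h2.2]

/-- Each of the two games is compared with the random-triple experiment, which is the same for both.
In each game two nonces are replaced by uniform scalars, which gives the total error 4/q. -/
theorem DDH.semanticallySecure {𝓔 : ECFamily} (h : DDH 𝓔) : SemanticallySecure 𝓔 := by
  intro l choose guess hc hg
  let T : Bool → ∀ z, (𝓔 z).Pt × (𝓔 z).Pt × (𝓔 z).Pt → PMF Bool := fun b z y =>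
    (choose z y.1).bind fun p => guess z (p.2, y.2.1,
      (𝓔 z).mul (if b then p.1.2.1 else p.1.1.1) (𝓔 z).B + y.2.2)
  have hT : ∀ b, PPT 𝓔 (T b) := by
    intro b
    refine Eff.ppt (Eff.bind (hc.eff.comp EffD.id.fst) (hg.eff.comp ?_)) PBC.bool
    refine EffD.pair EffD.id.snd.snd (EffD.pair EffD.id.fst.snd.fst
      (EffD.add (EffD.mul ?_ (.const _)) EffD.id.fst.snd.snd))
    cases b
    · exact EffD.of_enc (α := fun z => (𝓔 z).plain) EffD.id.snd.fst.fst (fun _ => id)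
        fun _ _ => rfl
    · exact EffD.of_enc (α := fun z => (𝓔 z).plain) EffD.id.snd.fst.snd (fun _ => id)
        fun _ _ => rfl
  have hn := ((h _ (hT true)).add (h _ (hT false))).add (h.negligible_inv_q.const_mul 4)
  refine Negligible.mono hn fun z => ?_
  rw [abs_abs]
  let H : Bool → (𝓔 z).Scalar → (𝓔 z).Scalar → PMF Bool := fun b k r =>
    T b z ((𝓔 z).mul k (𝓔 z).B, (𝓔 z).mul r (𝓔 z).B, (𝓔 z).mul (k * r) (𝓔 z).B)
  have h1 : ∀ b, semGame (𝓔 z) (choose z) (guess z) b =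
      (𝓔 z).nonce.bind fun k => (𝓔 z).nonce.bind fun r => H b k r := by
    intro b
    change ((𝓔 z).nonce.bind fun k => (choose z ((𝓔 z).mul k (𝓔 z).B)).bind fun p =>
      (𝓔 z).nonce.bind fun r => guess z (p.2, (𝓔 z).encrypt ((𝓔 z).mul k (𝓔 z).B)
        (if b then p.1.2.1 else p.1.1.1) r)) = _
    congr 1
    funext k
    rw [PMF.bind_comm]
    simp only [H, T, ECParams.encrypt, ECParams.mul_mul, mul_comm k]
  have h2 : ∀ b, (ddhTriple (𝓔 z)).bind (T b z) =
      (PMF.uniformOfFintype _).bind fun k => (PMF.uniformOfFintype _).bind fun r => H b k r := by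
    intro b
    change ((PMF.uniformOfFintype (𝓔 z).Scalar).bind fun a =>
      (PMF.uniformOfFintype (𝓔 z).Scalar).bind fun b => PMF.pure _).bind _ = _
    simp only [PMF.bind_bind, PMF.pure_bind, H]
  have h3 : ∀ b, (randomTriple (𝓔 z)).bind (T b z) =
      (PMF.uniformOfFintype _).bind fun k => (PMF.uniformOfFintype _).bind fun r =>
        (choose z ((𝓔 z).mul k (𝓔 z).B)).bind fun p => (PMF.uniformOfFintype _).bind fun c =>
          guess z (p.2, (𝓔 z).mul r (𝓔 z).B, (𝓔 z).mul c (𝓔 z).B) := by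
    intro b
    change ((PMF.uniformOfFintype (𝓔 z).Scalar).bind fun a =>
      (PMF.uniformOfFintype (𝓔 z).Scalar).bind fun b =>
      (PMF.uniformOfFintype (𝓔 z).Scalar).bind fun c => PMF.pure _).bind _ = _
    simp only [PMF.bind_bind, PMF.pure_bind]
    congr 1
    funext k
    congr 1
    funext r
    simp only [T]
    rw [PMF.bind_comm]
    congr 1
    funext p
    -- Adding the plaintext permutes the uniform scalar c, so the second component is a one-time pad
    -- and the dependence on b disappears.
    have := map_uniform_of_bijOn (s := (Finset.univ : Finset (𝓔 z).Scalar))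
      Finset.univ_nonempty Finset.univ_nonempty
      (f := fun c => (if b then p.1.2.1 else p.1.1.1) + c)
      (by simpa using (Equiv.addLeft (if b then p.1.2.1 else p.1.1.1)).bijective)
    rw [uniformOfFintype_eq]
    conv_rhs => rw [← this, PMF.bind_map]
    simp only [Function.comp_def, ECParams.add_mul]
  have h4 := fun b => abs_pr_nonce_nonce_sub_le (𝓔 z) (H b)
  simp only [← h1, ← h2] at h4
  change |pr _ - pr _| ≤ |pr ((ddhTriple (𝓔 z)).bind (T true z)) -
    pr ((randomTriple (𝓔 z)).bind (T true z))| + |pr ((ddhTriple (𝓔 z)).bind (T false z)) -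
    pr ((randomTriple (𝓔 z)).bind (T false z))| + 4 * (1 / ((𝓔 z).q : ℝ))
  rw [(h3 true).trans (h3 false).symm]
  have h5 := h4 true
  have h6 := h4 false
  generalize pr ((randomTriple (𝓔 z)).bind (T false z)) = w at *
  have h7 := le_abs_self (pr ((ddhTriple (𝓔 z)).bind (T true z)) - w)
  have h8 := neg_abs_le (pr ((ddhTriple (𝓔 z)).bind (T true z)) - w)
  have h9 := le_abs_self (pr ((ddhTriple (𝓔 z)).bind (T false z)) - w)
  have h10 := neg_abs_le (pr ((ddhTriple (𝓔 z)).bind (T false z)) - w)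
  rw [abs_le] at h5 h6 ⊢
  constructor <;> linarith [h5.1, h5.2, h6.1, h6.2]

end

section

/-! ### The sampled subset and the views -/

variable {G : ECParams} {c : Common}

open Common

/-- The labels whose ciphertexts in the partial view contain `1`. -/
def chosen (flags : c.Hist) (π : Equiv.Perm c.Label) (u : Fin c.N → Bool) : Finset c.Label :=
  Finset.univ.filter fun i =>
    (if h : (flags (π.symm i) : ℕ) = 1 ∧ popIndex flags (π.symm i) < c.N then
      u ⟨popIndex flags (π.symm i), h.2⟩ else false) = true

/-- The vector from which the subset `S` results. -/
def unchosen (flags : c.Hist) (π : Equiv.Perm c.Label) (S : Finset c.Label) (k : Fin c.N) : Bool :=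
  decide (∃ j, ((flags j : ℕ) = 1 ∧ popIndex flags j = k) ∧ π j ∈ S)

/-- The nonce of the ciphertext with label `j`. -/
def mergeNonces (flags : c.Hist) (ρ : Fin c.N → G.Scalar) (ζ : c.Label → G.Scalar)
    (j : c.Label) : G.Scalar :=
  if h : (flags j : ℕ) = 1 ∧ popIndex flags j < c.N then ρ ⟨popIndex flags j, h.2⟩ else ζ j

variable (G) in
/-- The plaintext of the ciphertext with label `i`. -/
def bit (S : Finset c.Label) (i : c.Label) : G.Scalar := if i ∈ S then 1 else 0

theorem encFlags_eq (K : G.Pt) (flags : c.Hist) (π : Equiv.Perm c.Label) (u : Fin c.N → Bool)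
    (ρ : Fin c.N → G.Scalar) (ζ : c.Label → G.Scalar) (j : c.Label) :
    encFlags K flags u ρ ζ j =
      G.encrypt K (bit G (chosen flags π u) (π j)) (mergeNonces flags ρ ζ j) := by
  rw [encFlags, bit, chosen, mergeNonces]
  by_cases h : (flags j : ℕ) = 1 ∧ popIndex flags j < c.N <;> simp [h]

/-- The view of `S₁`, given the decrypted bits and the partial view. -/
def view₁Of (last : Server) (L : Finset c.Label) (k₁ : G.Scalar) (K₂ : G.Pt) (flags : c.Hist)
    (u : Fin c.N → Bool) (ρ : Fin c.N → G.Scalar) (ζ : c.Label → G.Scalar) (a : c.Answer)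
    (pv : c.Label → G.Cipher) : View₁ G c :=
  ⟨L, k₁, K₂, flags, u, ρ, ζ, a.map fun bits => (pv, fun l =>
    if last = .S₁ ∧ l ∈ L then some (G.mul (bit G bits l) G.B + G.mul k₁ (pv l).1) else none,
    bits)⟩

/-- The view of `S₂`, given the decrypted bits and the encrypted flags. -/
def view₂Of (last : Server) (L : Finset c.Label) (k₂ : G.Scalar) (K₁ : G.Pt)
    (π : Equiv.Perm c.Label) (τ : c.Label → G.Scalar) (a : c.Answer)
    (lbs : c.Label → G.Cipher) : View₂ G c :=
  ⟨L, k₂, K₁, π, τ, a.map fun bits => (lbs, fun l =>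
    if last = .S₂ ∧ l ∈ L then some (G.mul (bit G bits l) G.B +
      G.mul k₂ ((lbs (π.symm l)).1 + G.mul (τ (π.symm l)) G.B)) else none, bits)⟩

open Classical in
/-- The answer of the servers, when the subset `S` results. -/
def answerOf (flags : c.Hist) (L S : Finset c.Label) : c.Answer :=
  if WellFormed flags then some (L ∩ S) else none

/-- The honest-but-curious server's output. -/
def advC {ℓa ℓC : ℕ} (cS : Option Server) (adv₁ : View₁ G c × BitString ℓa → PMF (BitString ℓC))
    (adv₂ : View₂ G c × BitString ℓa → PMF (BitString ℓC)) (aux : BitString ℓa)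
    (v₁ : View₁ G c) (v₂ : View₂ G c) : PMF (BitString ℓC) :=
  match cS with
  | none => PMF.pure (fun _ => false : BitString ℓC)
  | some .S₁ => adv₁ (v₁, aux)
  | some .S₂ => adv₂ (v₂, aux)

/-- The message of the participant, and the output of a corrupted one. -/
def sendP {ℓa ℓB : ℕ} (cP : Bool)
    (advB : c.Hist × BitString ℓa × G.Pt × G.Pt → PMF (PMsg c × BitString ℓB))
    (D : c.Hist) (aux : BitString ℓa) (K₁ K₂ : G.Pt) : PMF (PMsg c × BitString ℓB) :=
  if cP then advB (D, aux, K₁, K₂) else (honestP c D).map fun m => (m, fun _ => false)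

theorem mul_B_eq_B {a : G.Scalar} : G.mul a G.B = G.B ↔ a = 1 := by
  constructor
  · intro h
    exact G.mul_B_injective (h.trans (G.one_mul _).symm)
  · rintro rfl
    exact G.one_mul _

/-- The normal form on which all comparisons rest: the threshold decryption has been carried out,
and in `view₁Of` and `view₂Of` the other server's partial decryptions are expressed through the own
key and the decrypted bits. No secret key of the other server occurs in a view any more. -/
theorem real_eq {ℓa ℓB ℓC : ℕ} (last : Server) (cP : Bool) (cS : Option Server)
    (advB : c.Hist × BitString ℓa × G.Pt × G.Pt → PMF (PMsg c × BitString ℓB))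
    (adv₁ : View₁ G c × BitString ℓa → PMF (BitString ℓC))
    (adv₂ : View₂ G c × BitString ℓa → PMF (BitString ℓC))
    (D : c.Hist) (L : Finset c.Label) (aux : BitString ℓa) :
    real last cP cS advB adv₁ adv₂ D L aux =
      G.nonce.bind fun k₁ => G.nonce.bind fun k₂ =>
      (sendP cP advB D aux (G.mul k₁ G.B) (G.mul k₂ G.B)).bind fun m =>
      (sampleVector c).bind fun u => (G.nonces c.N).bind fun ρ => (G.nonces c.d).bind fun ζ =>
      (G.nonces c.d).bind fun τ =>
      (advC cS adv₁ adv₂ aux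
        (view₁Of last L k₁ (G.mul k₂ G.B) m.1.1 u ρ ζ
          (answerOf m.1.1 L (chosen m.1.1 m.1.2 u)) fun i =>
            G.encrypt (G.mul k₁ G.B + G.mul k₂ G.B) (bit G (chosen m.1.1 m.1.2 u) i)
              (mergeNonces m.1.1 ρ ζ (m.1.2.symm i) + τ (m.1.2.symm i)))
        (view₂Of last L k₂ (G.mul k₁ G.B) m.1.2 τ
          (answerOf m.1.1 L (chosen m.1.1 m.1.2 u)) fun j =>
            G.encrypt (G.mul k₁ G.B + G.mul k₂ G.B) (bit G (chosen m.1.1 m.1.2 u) (m.1.2 j))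
              (mergeNonces m.1.1 ρ ζ j))).bind fun outC =>
      PMF.pure (mkOut cP cS (answerOf m.1.1 L (chosen m.1.1 m.1.2 u))
        (answerOf m.1.1 L (chosen m.1.1 m.1.2 u)) m.2 outC) := by
  unfold real
  refine congrArg (PMF.bind _) (funext fun k₁ => ?_)
  refine congrArg (PMF.bind _) (funext fun k₂ => ?_)
  have hite : ∀ {α β : Type} (A B : PMF α) (f : α → PMF β),
      (if cP = true then A >>= f else B >>= f) = (if cP = true then A else B).bind f := by
    intros
    split_ifs <;> rfl
  refine (hite _ _ _).trans (congrArg (PMF.bind _) (funext fun ⟨⟨flags, π⟩, outB⟩ => ?_))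
  refine congrArg (PMF.bind _) (funext fun u => ?_)
  refine congrArg (PMF.bind _) (funext fun ρ => ?_)
  refine congrArg (PMF.bind _) (funext fun ζ => ?_)
  refine congrArg (PMF.bind _) (funext fun τ => ?_)
  simp only [← G.add_mul]
  set K := G.mul (k₁ + k₂) G.B with hK
  have hlbs : encFlags K flags u ρ ζ = fun j =>
      G.encrypt K (bit G (chosen flags π u) (π j)) (mergeNonces flags ρ ζ j) :=
    funext fun j => encFlags_eq K flags π u ρ ζ j
  have hpv : partialView K (encFlags K flags u ρ ζ) π τ = fun i =>
      G.encrypt K (bit G (chosen flags π u) i)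
        (mergeNonces flags ρ ζ (π.symm i) + τ (π.symm i)) := by
    funext i
    rw [partialView, hlbs, hK]
    beta_reduce
    rw [ECParams.encrypt_eq, ECParams.encrypt_eq, ECParams.encrypt_eq, Prod.mk_add_mk, ← G.add_mul, ← G.add_mul, Equiv.apply_symm_apply]
    congr 2
    ring
  simp only [hpv]
  rw [hlbs]
  generalize hS : chosen flags π u = S
  generalize mergeNonces flags ρ ζ = r
  -- Removing the share k₁ from (x + t(k₁ + k₂))B leaves (x + t k₂)B, which is xB + k₂C₁ with C₁ =
  -- tB.
  have hdec₁ : ∀ l, partialDec k₁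
      (G.encrypt K (bit G S l) (r (π.symm l) + τ (π.symm l))).2
      (G.encrypt K (bit G S l) (r (π.symm l) + τ (π.symm l))).1 =
      G.mul (bit G S l + (r (π.symm l) + τ (π.symm l)) * k₂) G.B := by
    intro l
    rw [partialDec, hK, ECParams.encrypt_eq, ECParams.mul_mul, ← ECParams.sub_mul]
    congr 1
    ring
  have hdec₂ : ∀ l, partialDec k₂
      (G.encrypt K (bit G S l) (r (π.symm l) + τ (π.symm l))).2
      (G.encrypt K (bit G S l) (r (π.symm l) + τ (π.symm l))).1 =
      G.mul (bit G S l + (r (π.symm l) + τ (π.symm l)) * k₁) G.B := by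
    intro l
    rw [partialDec, hK, ECParams.encrypt_eq, ECParams.mul_mul, ← ECParams.sub_mul]
    congr 1
    ring
  have hplain₁ : ∀ l, partialDec k₁
      (G.mul (bit G S l + (r (π.symm l) + τ (π.symm l)) * k₁) G.B)
      (G.encrypt K (bit G S l) (r (π.symm l) + τ (π.symm l))).1 = G.mul (bit G S l) G.B := by
    intro l
    rw [partialDec, hK, ECParams.encrypt_eq, ECParams.mul_mul, ← ECParams.sub_mul]
    congr 1
    ring
  have hplain₂ : ∀ l, partialDec k₂
      (G.mul (bit G S l + (r (π.symm l) + τ (π.symm l)) * k₂) G.B)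
      (G.encrypt K (bit G S l) (r (π.symm l) + τ (π.symm l))).1 = G.mul (bit G S l) G.B := by
    intro l
    rw [partialDec, hK, ECParams.encrypt_eq, ECParams.mul_mul, ← ECParams.sub_mul]
    congr 1
    ring
  simp only [hdec₁, hdec₂, hplain₁, hplain₂, ite_self]
  have hbits : ∀ [DecidablePred fun l : c.Label => G.mul (bit G S l) G.B = G.B],
      (L.filter fun l => G.mul (bit G S l) G.B = G.B) = L ∩ S := by
    intro _
    ext l
    rw [Finset.mem_filter, Finset.mem_inter, mul_B_eq_B, bit]
    split_ifs with h <;> simp [h]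
  simp only [hbits]
  -- Partial decryptions are sent for labels in L only, where the answer determines the bits of S.
  have hb : ∀ l ∈ L, bit G (L ∩ S) l = bit G S l := fun l hl => by simp [bit, hl]
  have hview₁ : (⟨L, k₁, G.mul k₂ G.B, flags, u, ρ, ζ, (answerOf flags L S).map fun bits =>
      (fun i => G.encrypt K (bit G S i) (r (π.symm i) + τ (π.symm i)),
        fun l => if last = .S₁ ∧ l ∈ L then
          some (G.mul (bit G S l + (r (π.symm l) + τ (π.symm l)) * k₁) G.B) else none, bits)⟩ :
      View₁ G c) = view₁Of last L k₁ (G.mul k₂ G.B) flags u ρ ζ (answerOf flags L S) fun i =>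
        G.encrypt K (bit G S i) (r (π.symm i) + τ (π.symm i)) := by
    rw [view₁Of, answerOf]
    split_ifs
    · simp only [Option.map_some, View₁.mk.injEq, true_and, Option.some.injEq, Prod.mk.injEq,
        and_true]
      funext l
      split_ifs with h
      · rw [hb l h.2, hK, ECParams.encrypt_eq, ECParams.mul_mul, ECParams.add_mul,
          _root_.mul_comm k₁]
      · rfl
    · rfl
  have hview₂ : (⟨L, k₂, G.mul k₁ G.B, π, τ, (answerOf flags L S).map fun bits =>
      (fun j => G.encrypt K (bit G S (π j)) (r j),
        fun l => if last = .S₂ ∧ l ∈ L then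
          some (G.mul (bit G S l + (r (π.symm l) + τ (π.symm l)) * k₂) G.B) else none, bits)⟩ :
      View₂ G c) = view₂Of last L k₂ (G.mul k₁ G.B) π τ (answerOf flags L S) fun j =>
        G.encrypt K (bit G S (π j)) (r j) := by
    rw [view₂Of, answerOf]
    split_ifs
    · simp only [Option.map_some, View₂.mk.injEq, true_and, Option.some.injEq, Prod.mk.injEq,
        and_true]
      funext l
      split_ifs with h
      · rw [hb l h.2, hK, ECParams.encrypt_eq, ← ECParams.add_mul, ECParams.mul_mul,
          ECParams.add_mul, _root_.mul_comm k₂]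
      · rfl
    · rfl
  rw [← hview₁, ← hview₂]
  rcases cS with _ | _ | _ <;> rfl

/-! ### The distribution of the sampled subset -/

theorem card_flagged {flags : c.Hist} (h : WellFormed flags) :
    (Finset.univ.filter fun j => (flags j : ℕ) = 1).card = c.N := h.card

theorem popIndex_lt {flags : c.Hist} (h : WellFormed flags) {j : c.Label}
    (hj : (flags j : ℕ) = 1) : popIndex flags j < c.N := by
  rw [← card_flagged h, popIndex]
  refine Finset.card_lt_card ((Finset.ssubset_iff_of_subset fun j' hj' => ?_).2
    ⟨j, by simp [hj], by simp⟩)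
  simp only [Finset.mem_filter, Finset.mem_univ, true_and] at hj' ⊢
  exact hj'.2

theorem popIndex_lt_popIndex {flags : c.Hist} {i j : c.Label} (hi : (flags i : ℕ) = 1)
    (h : i < j) : popIndex flags i < popIndex flags j := by
  refine Finset.card_lt_card ((Finset.ssubset_iff_of_subset fun j' hj' => ?_).2
    ⟨i, by simp [hi, h], by simp⟩)
  simp only [Finset.mem_filter, Finset.mem_univ, true_and] at hj' ⊢
  exact ⟨hj'.1.trans h, hj'.2⟩

/-- The position of a flag among the flags that are set. -/
def flagIndex {flags : c.Hist} (h : WellFormed flags) :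
    {j // (flags j : ℕ) = 1 ∧ popIndex flags j < c.N} ≃ Fin c.N :=
  Equiv.ofBijective (fun j => ⟨popIndex flags j.1, j.2.2⟩) <| by
    rw [Fintype.bijective_iff_injective_and_card]
    constructor
    · rintro ⟨i, hi⟩ ⟨j, hj⟩ e
      have e' : popIndex flags i = popIndex flags j := congrArg Fin.val e
      rcases lt_trichotomy i j with h' | h' | h'
      · exact absurd e' (popIndex_lt_popIndex hi.1 h').ne
      · exact Subtype.ext h'
      · exact absurd e' (popIndex_lt_popIndex hj.1 h').ne'
    · rw [Fintype.card_subtype, Fintype.card_fin, ← card_flagged h]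
      congr 1
      ext j
      simp only [Finset.mem_filter, Finset.mem_univ, true_and]
      exact ⟨fun h' => h'.1, fun h' => ⟨h', (popIndex_lt h h').trans_le (card_flagged h).ge⟩⟩

theorem flagIndex_apply {flags : c.Hist} (h : WellFormed flags)
    (j : {j // (flags j : ℕ) = 1 ∧ popIndex flags j < c.N}) :
    flagIndex h j = ⟨popIndex flags j.1, j.2.2⟩ := rfl

/-- The label, in the domain, of the flag number `k`. -/
def flagLabel {flags : c.Hist} (h : WellFormed flags) (π : Equiv.Perm c.Label) (k : Fin c.N) :
    c.Label := π ((flagIndex h).symm k).1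

theorem flagLabel_injective {flags : c.Hist} (h : WellFormed flags) (π : Equiv.Perm c.Label) :
    Function.Injective (flagLabel h π) := fun _ _ e =>
  (flagIndex h).symm.injective (Subtype.ext (π.injective e))

theorem mem_chosen {flags : c.Hist} (h : WellFormed flags) {π : Equiv.Perm c.Label}
    {u : Fin c.N → Bool} {i : c.Label} :
    i ∈ chosen flags π u ↔ ∃ k, u k = true ∧ flagLabel h π k = i := by
  rw [chosen, Finset.mem_filter]
  constructor
  · rintro ⟨-, hi⟩
    by_cases h' : (flags (π.symm i) : ℕ) = 1 ∧ popIndex flags (π.symm i) < c.N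
    · rw [dif_pos h'] at hi
      refine ⟨_, hi, ?_⟩
      rw [← flagIndex_apply h ⟨_, h'⟩, flagLabel, Equiv.symm_apply_apply, Equiv.apply_symm_apply]
    · rw [dif_neg h'] at hi
      exact absurd hi (by simp)
  · rintro ⟨k, hk, rfl⟩
    refine ⟨Finset.mem_univ _, ?_⟩
    have e : π.symm (flagLabel h π k) = ((flagIndex h).symm k).1 := by simp [flagLabel]
    have e2 := flagIndex_apply h ((flagIndex h).symm k)
    rw [Equiv.apply_symm_apply] at e2
    simp only [e]
    rw [dif_pos ((flagIndex h).symm k).2, ← e2, hk]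

theorem mem_records_comp {flags : c.Hist} (h : WellFormed flags) {π : Equiv.Perm c.Label}
    {i : c.Label} : i ∈ records (fun i => flags (π.symm i)) ↔ ∃ k, flagLabel h π k = i := by
  rw [records, Finset.mem_filter]
  constructor
  · rintro ⟨-, hi⟩
    refine ⟨flagIndex h ⟨π.symm i, hi, popIndex_lt h hi⟩, ?_⟩
    simp [flagLabel]
  · rintro ⟨k, rfl⟩
    refine ⟨Finset.mem_univ _, ?_⟩
    simpa [flagLabel] using ((flagIndex h).symm k).2.1

theorem unchosen_eq {flags : c.Hist} (h : WellFormed flags) (π : Equiv.Perm c.Label)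
    (S : Finset c.Label) (k : Fin c.N) :
    unchosen flags π S k = decide (flagLabel h π k ∈ S) := by
  rw [unchosen, decide_eq_decide, flagLabel]
  constructor
  · rintro ⟨j, ⟨h1, h2⟩, h3⟩
    have : flagIndex h ⟨j, h1, popIndex_lt h h1⟩ = k := Fin.ext h2
    rw [← this, Equiv.symm_apply_apply]
    exact h3
  · intro hS
    refine ⟨_, ⟨((flagIndex h).symm k).2.1, ?_⟩, hS⟩
    have := flagIndex_apply h ((flagIndex h).symm k)
    rw [Equiv.apply_symm_apply] at this
    exact (congrArg Fin.val this).symm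

/-- The vectors of Hamming weight `V`. -/
def weightVec (c : Common) : Finset (Fin c.N → Bool) :=
  Finset.univ.filter fun u => (Finset.univ.filter fun k => u k = true).card = c.V

theorem weightVec_nonempty : (weightVec c).Nonempty := by
  obtain ⟨s, -, hs⟩ := Finset.exists_subset_card_eq
    (s := (Finset.univ : Finset (Fin c.N))) (n := c.V) (by simpa using c.V_le)
  exact ⟨fun k => decide (k ∈ s), Finset.mem_filter.2 ⟨Finset.mem_univ _, by simpa using hs⟩⟩

theorem sampleVector_eq : sampleVector c = PMF.uniformOfFinset _ (weightVec_nonempty (c := c)) :=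
  rfl

theorem wellFormed_comp {D : c.Hist} (h : WellFormed D) (π : Equiv.Perm c.Label) :
    WellFormed fun i => D (π i) :=
  ⟨fun _ => h.1 _, (Equiv.sum_comp π fun i => (D i : ℕ)).trans h.2⟩

theorem wellFormed_comp_iff {D : c.Hist} (π : Equiv.Perm c.Label) :
    WellFormed (fun i => D (π i)) ↔ WellFormed D :=
  ⟨fun h => by simpa using wellFormed_comp h π.symm, fun h => wellFormed_comp h π⟩

theorem subsets_nonempty {D : c.Hist} (h : WellFormed D) :
    ((records D).powersetCard c.V).Nonempty :=
  Finset.powersetCard_nonempty.2 (h.card.symm ▸ c.V_le)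

theorem trusted_eq {D : c.Hist} (h : WellFormed D) (L : Finset c.Label) :
    trusted D L = (PMF.uniformOfFinset _ (subsets_nonempty h)).map fun S => some (L ∩ S) := by
  rw [trusted, dif_pos h]

theorem trusted_of_not {D : c.Hist} (h : ¬WellFormed D) (L : Finset c.Label) :
    trusted D L = PMF.pure none := by
  rw [trusted, dif_neg h]

theorem chosen_unchosen {flags : c.Hist} (h : WellFormed flags) (π : Equiv.Perm c.Label)
    {S : Finset c.Label} (hS : S ⊆ records fun i => flags (π.symm i)) :
    chosen flags π (unchosen flags π S) = S := by
  ext i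
  simp only [mem_chosen h, unchosen_eq h, decide_eq_true_iff]
  constructor
  · rintro ⟨k, hk, rfl⟩
    exact hk
  · intro hi
    obtain ⟨k, rfl⟩ := (mem_records_comp h).1 (hS hi)
    exact ⟨k, hi, rfl⟩

theorem unchosen_chosen {flags : c.Hist} (h : WellFormed flags) (π : Equiv.Perm c.Label)
    (u : Fin c.N → Bool) : unchosen flags π (chosen flags π u) = u := by
  funext k
  rw [unchosen_eq h, Bool.eq_iff_iff, decide_eq_true_iff, mem_chosen h]
  constructor
  · rintro ⟨k', hk', e⟩
    rwa [← flagLabel_injective h π e]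
  · exact fun hk => ⟨k, hk, rfl⟩

theorem card_chosen {flags : c.Hist} (h : WellFormed flags) (π : Equiv.Perm c.Label)
    (u : Fin c.N → Bool) :
    (chosen flags π u).card = (Finset.univ.filter fun k => u k = true).card := by
  rw [← Finset.card_image_of_injective _ (flagLabel_injective h π)]
  congr 1
  ext i
  simp [mem_chosen h]

theorem chosen_subset {flags : c.Hist} (h : WellFormed flags) (π : Equiv.Perm c.Label)
    (u : Fin c.N → Bool) : chosen flags π u ⊆ records fun i => flags (π.symm i) := by
  intro i hi
  obtain ⟨k, -, rfl⟩ := (mem_chosen h).1 hi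
  exact (mem_records_comp h).2 ⟨k, rfl⟩

/-- The sampled subset is uniform, and determines the vector. -/
theorem sampleVector_bind {γ : Type} {flags : c.Hist} (h : WellFormed flags)
    (π : Equiv.Perm c.Label) (F : Finset c.Label → (Fin c.N → Bool) → PMF γ) :
    ((sampleVector c).bind fun u => F (chosen flags π u) u) =
      (PMF.uniformOfFinset _ (subsets_nonempty (wellFormed_comp h π.symm))).bind fun S =>
        F S (unchosen flags π S) := by
  -- For valid flags, `flagLabel` matches positions of the vector with records, so vectors of weight
  -- V correspond to V-subsets; `unchosen` is the inverse.
  have hb : Set.BijOn (chosen flags π) (weightVec c)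
      ((records fun i => flags (π.symm i)).powersetCard c.V) := by
    refine ⟨fun u hu => ?_, fun u _ u' _ e => ?_, fun S hS => ?_⟩
    · rw [Finset.mem_coe, weightVec, Finset.mem_filter] at hu
      rw [Finset.mem_coe, Finset.mem_powersetCard, card_chosen h]
      exact ⟨chosen_subset h π u, hu.2⟩
    · rw [← unchosen_chosen h π u, e, unchosen_chosen h π u']
    · rw [Finset.mem_coe, Finset.mem_powersetCard] at hS
      refine ⟨unchosen flags π S, ?_, chosen_unchosen h π hS.1⟩
      rw [Finset.mem_coe, weightVec, Finset.mem_filter, ← card_chosen h π, chosen_unchosen h π hS.1]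
      exact ⟨Finset.mem_univ _, hS.2⟩
  rw [← map_uniform_of_bijOn (weightVec_nonempty (c := c)) _ hb, PMF.bind_map, sampleVector_eq]
  simp only [Function.comp_def, unchosen_chosen h]

end

section

open Common

/-! ### Efficient sampling -/

section Sampling

variable {J : Type} {κ : J → ℕ} {G : J → ECParams} {Γ α β γ : J → Type}
  [∀ j, BitEnc (Γ j)] [∀ j, BitEnc (α j)] [∀ j, BitEnc (β j)] [∀ j, BitEnc (γ j)]

theorem PB.finProd {d : J → ℕ} (hd : PB κ d) :
    PB κ fun j => Nat.card (Fin (d j) × Fin (d j)) :=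
  PB.mono (hd.mul hd) fun j => by simp

/-- Select an entry of a vector. -/
theorem EffD.select {n : J → ℕ} (hn : PB κ n) (hβ : PBC κ β) {v : ∀ j, Γ j → Fin (n j) → β j}
    (hv : EffD κ G (β := fun j => Fin (n j) → β j) v) {f : ∀ j, Γ j → Fin (n j)}
    (hf : EffP (J := Σ j, Fin (n j)) (fun p => κ p.1) (fun p => G p.1) (α := fun p => Γ p.1)
      fun p x => f p.1 x = p.2) : EffD κ G fun j x => v j x (f j x) := by
  refine EffD.of_bits hβ ?_
  have h := EffP.ex (κ := fun p : (Σ j, BitEnc.Idx (β j)) => κ p.1) (G := fun p => G p.1)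
    (Γ := fun p => Γ p.1) (ι := fun p => Fin (n p.1)) (hn.fin.reindex _)
    (P := fun p k x => f p.1 x = k ∧ BitEnc.enc (v p.1 x k) p.2 = true)
    ((hf.reindex fun q : (Σ p : (Σ j, BitEnc.Idx (β j)), Fin (n p.1)) =>
      (⟨q.1.1, q.2⟩ : Σ j, Fin (n j))).and
      (EffP.bit ((hv.reindex fun q : (Σ p : (Σ j, BitEnc.Idx (β j)), Fin (n p.1)) => q.1.1).app
        fun q => q.2) fun q => q.1.2))
  exact h.congr fun p x => ⟨fun h => ⟨_, rfl, h⟩, fun ⟨k, h1, h2⟩ => h1 ▸ h2⟩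

theorem EffD.compPerm {n : J → ℕ} (hn : PB κ n) (hβ : PBC κ β) {v : ∀ j, Γ j → Fin (n j) → β j}
    (hv : EffD κ G (β := fun j => Fin (n j) → β j) v) {π : ∀ j, Γ j → Equiv.Perm (Fin (n j))}
    (hπ : EffD κ G π) :
    EffD κ G (β := fun j => Fin (n j) → β j) fun j x i => v j x (π j x i) :=
  EffD.pi hn.fin (EffD.select (hn.reindex _) (hβ.reindex _)
    (hv.reindex fun p : (Σ j, Fin (n j)) => p.1)
    (f := fun p x => π p.1 x p.2) (EffP.permEq
      (hπ.reindex fun q : (Σ p : (Σ j, Fin (n j)), Fin (n p.1)) => q.1.1) (fun q => q.1.2)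
      fun q => q.2))

theorem EffD.compPermSymm {n : J → ℕ} (hn : PB κ n) (hβ : PBC κ β)
    {v : ∀ j, Γ j → Fin (n j) → β j} (hv : EffD κ G (β := fun j => Fin (n j) → β j) v)
    {π : ∀ j, Γ j → Equiv.Perm (Fin (n j))} (hπ : EffD κ G π) :
    EffD κ G (β := fun j => Fin (n j) → β j) fun j x i => v j x ((π j x).symm i) :=
  EffD.pi hn.fin (EffD.select (hn.reindex _) (hβ.reindex _)
    (hv.reindex fun p : (Σ j, Fin (n j)) => p.1)
    (f := fun p x => (π p.1 x).symm p.2) ((EffP.permEq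
      (hπ.reindex fun q : (Σ p : (Σ j, Fin (n j)), Fin (n p.1)) => q.1.1) (fun q => q.2)
      fun q => q.1.2).congr fun q x => by rw [Equiv.symm_apply_eq, eq_comm]))

theorem Eff.perm {d : J → ℕ} (hd : PB κ d) :
    Eff κ G fun j (_ : Γ j) => PMF.uniformOfFintype (Equiv.Perm (Fin (d j))) := by
  simp only [uniform_perm_eq_iterPMF]
  refine Eff.iter hd (init := fun j _ => PMF.pure 1) (step := fun j i _ σ => shuffleStep i σ)
    (EffD.const fun _ => 1) ?_
  have hs : PB (fun p : (Σ j, Fin (d j)) => κ p.1) fun p => d p.1 := hd.reindex _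
  have h1 := Eff.sample (G := fun p : (Σ j, Fin (d j)) => G p.1)
    (κ := fun p : (Σ j, Fin (d j)) => κ p.1) (β := fun p => Fin (d p.1))
    (Γ := fun p => Γ p.1 × Equiv.Perm (Fin (d p.1))) (fun _ => 0) (fun p => (p.2 : ℕ))
    (PB.mono hs fun p => by
      rw [zero_add]
      exact (Nat.size_le.2 (Nat.lt_two_pow_self)).trans p.2.2.le)
    (fun p r => Fin.castLE p.2.2 r) (fun _ i => i.1) (fun p k i => by rw [zero_add]; rfl)
  have h2 : EffD (J := Σ j, Fin (d j)) (fun p => κ p.1) (fun p => G p.1)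
      (α := fun p => (Γ p.1 × Equiv.Perm (Fin (d p.1))) × Fin (d p.1))
      (β := fun p => Equiv.Perm (Fin (d p.1))) fun p y => Equiv.swap p.2 y.2 * y.1.2 := by
    refine EffD.perm hs ?_
    let Q := Σ p : (Σ j, Fin (d j)), Fin (d p.1) × Fin (d p.1)
    let κ' := fun q : Q => κ q.1.1
    let G' := fun q : Q => G q.1.1
    have hd' : PB κ' fun q => d q.1.1 := hd.reindex _
    have hs' : PBC κ' fun q => Fin (d q.1.1) :=
      PBC.fin (PB.mono hd' fun j => Nat.size_le.2 (Nat.lt_two_pow_self))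
    let Γ' := fun q : Q => (Γ q.1.1 × Equiv.Perm (Fin (d q.1.1))) × Fin (d q.1.1)
    have e1 : EffP κ' G' (α := Γ') fun q y => y.1.2 q.2.1 = q.2.2 :=
      EffP.permEq EffD.id.fst.snd (fun q : Q => q.2.1) fun q : Q => q.2.2
    have e2 : EffP κ' G' (α := Γ') fun q y => y.1.2 q.2.1 = q.1.2 :=
      EffP.permEq EffD.id.fst.snd (fun q : Q => q.2.1) fun q : Q => q.1.2
    have e3 : EffP κ' G' (α := Γ') fun q y => y.2 = q.2.2 :=
      EffP.eqConst hs' EffD.id.snd fun q : Q => q.2.2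
    have e4 : EffP κ' G' (α := Γ') fun q y => ∃ k, y.1.2 q.2.1 = k ∧ y.2 = k :=
      EffP.ex hd'.fin ((EffP.permEq EffD.id.fst.snd (fun q : (Σ q : Q, Fin (d q.1.1)) => q.1.2.1) fun q => q.2).and
        (EffP.eqConst (hs'.reindex _) EffD.id.snd fun q : (Σ q : Q, Fin (d q.1.1)) => q.2))
    have e5 : EffP κ' G' (α := Γ') fun q _ => q.2.2 = q.1.2 := EffP.const _
    -- The product of the swap of i and r with σ sends a to b iff σ a is the swapped image of b: r
    -- if b = i, i if b = r, and b otherwise.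
    refine ((e5.and e4).or (e5.not.and ((e3.and e2).or (e3.not.and e1)))).congr fun q y => ?_
    rw [Equiv.Perm.mul_apply, Equiv.swap_apply_eq_iff]
    by_cases h5 : q.2.2 = q.1.2
    · simp [h5, eq_comm]
    · by_cases h3 : y.2 = q.2.2
      · simp [h5, h3]
      · rw [Equiv.swap_apply_of_ne_of_ne h5 (Ne.symm h3)]
        simp [h5, h3]
  have h3 := Eff.map h1 (g := fun (p : Σ j, Fin (d j))
    (y : Γ p.1 × Equiv.Perm (Fin (d p.1))) (r : Fin (d p.1)) => Equiv.swap p.2 r * y.2) h2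
  simp only [PMF.map_comp] at h3
  exact h3

theorem EffD.pick {d v : J → ℕ} (hd : PB κ d) (hv : PB κ v)
    {τ : ∀ j, Γ j → Equiv.Perm (Fin (d j))} {A T : ∀ j, Γ j → Finset (Fin (d j))}
    (hτ : EffD κ G τ) (hA : EffD κ G A) (hT : EffD κ G T) :
    EffD κ G fun j x => pick (τ j x) (A j x) (T j x) (v j) := by
  refine EffD.finset hd ?_
  let r : (Σ j, Fin (d j)) → J := fun p => p.1
  let r' : (Σ p : (Σ j, Fin (d j)), Fin (d p.1)) → J := fun p => p.1.1
  have h : EffP (J := Σ j, Fin (d j)) (fun p => κ p.1) (fun p => G p.1) (α := fun p => Γ p.1)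
      fun p x => (Finset.univ.filter fun i => i ∈ T p.1 x ∨ i ∈ A p.1 x ∧
        τ p.1 x i < τ p.1 x p.2).card < v p.1 := by
    refine EffP.card_lt (hd.reindex _) ?_ (hv.reindex _)
    refine (EffP.mem (hT.reindex r') fun p => p.2).or ((EffP.mem (hA.reindex r') fun p => p.2).and ?_)
    -- Two values of τ are compared by searching through all pairs of constants a < b, so no
    -- comparison circuit is needed.
    have := EffP.ex (κ := fun p => κ (r' p)) (G := fun p => G (r' p)) (Γ := fun p => Γ (r' p))
      (ι := fun p => Fin (d (r' p)) × Fin (d (r' p))) (hd.finProd.reindex r')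
      (P := fun p ab x => ab.1 < ab.2 ∧ τ (r' p) x p.2 = ab.1 ∧ τ (r' p) x p.1.2 = ab.2)
      ((EffP.const _).and ((EffP.permEq (hτ.reindex fun q : (Σ p, Fin (d (r' p)) × Fin (d (r' p))) =>
        r' q.1) (fun q => q.1.2) fun q => q.2.1).and
        (EffP.permEq (hτ.reindex fun q : (Σ p, Fin (d (r' p)) × Fin (d (r' p))) => r' q.1)
          (fun q => q.1.1.2) fun q => q.2.2)))
    exact this.congr fun p x => ⟨fun h => ⟨(_, _), h, rfl, rfl⟩,
      fun ⟨ab, h, h1, h2⟩ => by rw [← h1, ← h2] at h; exact h⟩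
  refine ((EffP.mem (hT.reindex r) fun p => p.2).or
    ((EffP.mem (hA.reindex r) fun p => p.2).and h)).congr fun p x => ?_
  simp only [PartialView.pick, Finset.mem_filter, Finset.mem_univ, true_and, r]

end Sampling

/-- The first V positions in a uniformly random order form a uniform V-subset; this is how circuits
sample the vector exactly. -/
theorem sampleVector_eq_map_pick (c : Common) :
    sampleVector c = (PMF.uniformOfFintype (Equiv.Perm (Fin c.N))).map fun τ k =>
      decide (k ∈ pick τ Finset.univ ∅ c.V) := by
  have hne : (((Finset.univ ∪ ∅ : Finset (Fin c.N)).powersetCard c.V).filter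
      fun S => ∅ ⊆ S).Nonempty := by
    obtain ⟨s, -, hs⟩ := Finset.exists_subset_card_eq
      (s := (Finset.univ : Finset (Fin c.N))) (n := c.V) (by simpa using c.V_le)
    exact ⟨s, by simp [hs]⟩
  have h1 := pick_uniform (A := (Finset.univ : Finset (Fin c.N))) (T := ∅) (v := c.V)
    (by simp) (by simp) (by simpa using c.V_le) hne
  have h2 := map_uniform_of_bijOn hne (weightVec_nonempty (c := c))
    (f := fun S k => decide (k ∈ S)) ⟨fun S hS => by
      simp only [Finset.coe_filter, Set.mem_ofPred_eq, Finset.mem_powersetCard] at hS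
      simpa [weightVec] using hS.1.2, fun S _ S' _ h => by
      ext k
      simpa using congrFun h k, fun u hu => by
      refine ⟨Finset.univ.filter fun k => u k = true, ?_, by simp⟩
      simpa [weightVec] using hu⟩
  rw [sampleVector_eq, ← h2, ← h1, PMF.map_comp]
  rfl

/-! ### The simulator -/

variable {J : Type} {κ : J → ℕ} {G : J → ECParams} {c : J → Common} {Γ : J → Type}
  [∀ j, BitEnc (Γ j)]

/-- The parameters have polynomial size. -/
structure PolyParams (κ : J → ℕ) (G : J → ECParams) (c : J → Common) : Prop where
  p : PB κ fun j => (G j).p.size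
  q : PB κ fun j => (G j).q.size
  d : PB κ fun j => (c j).d
  cap : PB κ fun j => (c j).cap.size

namespace PolyParams

theorem reindex (P : PolyParams κ G c) {J' : Type} (h : J' → J) :
    PolyParams (fun i => κ (h i)) (fun i => G (h i)) fun i => c (h i) :=
  ⟨P.p.reindex h, P.q.reindex h, P.d.reindex h, P.cap.reindex h⟩

theorem N (P : PolyParams κ G c) : PB κ fun j => (c j).N := PB.mono P.d fun j => (c j).N_le

theorem V (P : PolyParams κ G c) : PB κ fun j => (c j).V := PB.mono P.d fun j => (c j).V_le.trans (c j).N_le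

theorem flag (P : PolyParams κ G c) : PBC κ fun j => Fin ((c j).cap + 2) :=
  PBC.fin (PB.mono (P.cap.add (PB.const 2)) fun j => by
    rw [Nat.size_le]
    have h1 := Nat.lt_size_self (c j).cap
    have h2 : 0 < 2 ^ (c j).cap.size := by positivity
    rw [pow_add]
    omega)

theorem hist (P : PolyParams κ G c) : PBC κ fun j => (c j).Hist := PBC.pi P.d.fin P.flag

theorem labels (P : PolyParams κ G c) : PBC κ fun j => Finset (c j).Label := PBC.finset P.d

theorem cipher (P : PolyParams κ G c) : PBC κ fun j => (G j).Cipher := (PBC.pt P.p).prod (PBC.pt P.p)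

end PolyParams

end

section

open Common

section Simulator

variable {G : ECParams} {c : Common} {ℓa ℓB ℓC : ℕ}

/-- A subset and a vector that agree with the answer `a`. If the participant is honest, they need
not agree with the dataset. -/
def refill (cP : Bool) (m : PMsg c) (L : Finset c.Label) (a : c.Answer) :
    PMF (Finset c.Label × (Fin c.N → Bool)) :=
  (sampleVector c).bind fun u =>
    if cP then (PMF.uniformOfFintype (Equiv.Perm c.Label)).map fun τ =>
      (pick τ (records (fun i => m.1 (m.2.symm i)) \ L) (a.getD ∅) c.V,
        if a.isSome then unchosen m.1 m.2
          (pick τ (records (fun i => m.1 (m.2.symm i)) \ L) (a.getD ∅) c.V) else u)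
    else PMF.pure (a.getD ∅, u)

/-- The output of a corrupted server in the simulation. -/
def simC (last : Server) (cP : Bool) (cS : Option Server)
    (adv₁ : View₁ G c × BitString ℓa → PMF (BitString ℓC))
    (adv₂ : View₂ G c × BitString ℓa → PMF (BitString ℓC))
    (L : Finset c.Label) (aux : BitString ℓa) (k₁ k₂ : G.Scalar) (m : PMsg c) (a : c.Answer) :
    PMF (BitString ℓC) :=
  match cS with
  | none => PMF.pure fun _ => false
  | some .S₁ => (refill cP m L a).bind fun Su => (G.nonces c.N).bind fun ρ =>
      (G.nonces c.d).bind fun ζ => (G.nonces c.d).bind fun t =>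
      adv₁ (view₁Of last L k₁ (G.mul k₂ G.B) m.1 Su.2 ρ ζ a fun i =>
        G.encrypt (G.mul k₁ G.B + G.mul k₂ G.B) (bit G Su.1 i) (t i), aux)
  | some .S₂ => (refill cP m L a).bind fun Su => (G.nonces c.d).bind fun r =>
      (G.nonces c.d).bind fun τ =>
      adv₂ (view₂Of last L k₂ (G.mul k₁ G.B) m.2 τ a fun j =>
        G.encrypt (G.mul k₁ G.B + G.mul k₂ G.B) (bit G Su.1 (m.2 j)) (r j), aux)

variable (G c ℓa ℓB) in
/-- The state of the simulator. -/
abbrev SimState : Type :=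
  ((Finset c.Label × BitString ℓa) × (G.Scalar × G.Scalar)) × (PMsg c × BitString ℓB)

/-- The dataset that the simulator submits, and its state. -/
def simSubmit (cP : Bool)
    (advB : c.Hist × BitString ℓa × G.Pt × G.Pt → PMF (PMsg c × BitString ℓB)) (D₀ : c.Hist)
    (x : (Option c.Hist × Option (Finset c.Label)) × BitString ℓa) :
    PMF (c.Hist × SimState G c ℓa ℓB) :=
  G.nonce.bind fun k₁ => G.nonce.bind fun k₂ =>
    -- The dataset is visible only if the participant is corrupted; otherwise `D₀` stands in for it.
    (sendP cP advB (x.1.1.getD D₀) x.2 (G.mul k₁ G.B) (G.mul k₂ G.B)).bind fun m =>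
      PMF.pure (fun i => m.1.1 (m.1.2.symm i), (((x.1.2.getD ∅, x.2), (k₁, k₂)), m))

/-- The output of the simulator. -/
def simFinish (last : Server) (cP : Bool) (cS : Option Server)
    (adv₁ : View₁ G c × BitString ℓa → PMF (BitString ℓC))
    (adv₂ : View₂ G c × BitString ℓa → PMF (BitString ℓC))
    (y : SimState G c ℓa ℓB × Option c.Answer) : PMF (BitString ℓB × BitString ℓC) :=
  (simC last cP cS adv₁ adv₂ y.1.1.1.1 y.1.1.1.2 y.1.1.2.1 y.1.1.2.2 y.1.2.1
    -- An answer is missing only if no server is corrupted, and then `simC` does not look at it.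
    (y.2.getD none)).bind fun o => PMF.pure (y.1.2.2, o)

theorem honestP_eq (D : c.Hist) :
    honestP c D = (PMF.uniformOfFintype (Equiv.Perm c.Label)).map fun π => (fun j => D (π j), π) := by
  have h := map_uniform_of_bijOn (s := (Finset.univ : Finset (Equiv.Perm c.Label)))
    Finset.univ_nonempty Finset.univ_nonempty (f := fun σ : Equiv.Perm c.Label => σ⁻¹)
    (by simpa using (Equiv.inv (Equiv.Perm c.Label)).bijective)
  rw [honestP, uniformOfFintype_eq]
  conv_rhs => rw [← h, PMF.map_comp]
  rfl

end Simulator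

/-! ### The simulator is efficient -/

section Efficient

variable {J : Type} {κ : J → ℕ} {G : J → ECParams} {c : J → Common} {Γ : J → Type}
  [∀ j, BitEnc (Γ j)]

theorem Eff.sampleVector (P : PolyParams κ G c) :
    Eff κ G fun j (_ : Γ j) => sampleVector (c j) := by
  simp only [sampleVector_eq_map_pick]
  refine Eff.map (Eff.perm P.N) (EffD.pi (β := fun _ => Bool) P.N.fin (EffP.toEffD ?_))
  exact EffP.mem (EffD.pick (P.N.reindex _) (P.V.reindex _) EffD.id.snd (EffD.const _)
    (EffD.const _)) fun p : (Σ j, Fin (c j).N) => p.2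

theorem EffP.flagged (P : PolyParams κ G c) {flags : ∀ j, Γ j → (c j).Hist}
    (hf : EffD κ G flags) (i : ∀ j, (c j).Label) :
    EffP κ G fun j x => (flags j x (i j) : ℕ) = 1 :=
  (EffP.eqConst P.flag (hf.app i) fun j => ⟨1, by omega⟩).congr fun j x => by rw [Fin.ext_iff]

theorem EffD.unchosen (P : PolyParams κ G c) {flags : ∀ j, Γ j → (c j).Hist}
    (hf : EffD κ G flags) {π : ∀ j, Γ j → Equiv.Perm (c j).Label} (hπ : EffD κ G π)
    {S : ∀ j, Γ j → Finset (c j).Label} (hS : EffD κ G S) :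
    EffD κ G (β := fun j => Fin (c j).N → Bool)
      fun j x => unchosen (flags j x) (π j x) (S j x) := by
  refine EffD.pi (β := fun _ => Bool) P.N.fin (EffP.toEffD ?_)
  refine EffP.ex (P.d.fin.reindex _) (.and (.and ?_ ?_) ?_)
  · exact EffP.flagged (P.reindex _)
      (hf.reindex fun q : (Σ p : (Σ j, Fin (c j).N), (c p.1).Label) => q.1.1) fun q => q.2
  · refine EffP.card_eq (P.d.reindex _) ((EffP.const _).and ?_) _
    exact EffP.flagged (P.reindex _) (hf.reindex fun q : (Σ q : (Σ p : (Σ j, Fin (c j).N),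
      (c p.1).Label), (c q.1.1).Label) => q.1.1.1) fun q => q.2
  · refine (EffP.ex (Γ := fun q : (Σ p : (Σ j, Fin (c j).N), (c p.1).Label) => Γ q.1.1)
      (ι := fun q => (c q.1.1).Label) (P.d.fin.reindex _)
      (P := fun q k x => π q.1.1 x q.2 = k ∧ k ∈ S q.1.1 x) (.and ?_ ?_)).congr
      fun q x => ⟨fun h => ⟨_, rfl, h⟩, fun ⟨k, h1, h2⟩ => h1 ▸ h2⟩
    · exact EffP.permEq (hπ.reindex fun q : (Σ q : (Σ p : (Σ j, Fin (c j).N),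
        (c p.1).Label), (c q.1.1).Label) => q.1.1.1) (fun q => q.1.2) fun q => q.2
    · exact EffP.mem (hS.reindex fun q : (Σ q : (Σ p : (Σ j, Fin (c j).N),
        (c p.1).Label), (c q.1.1).Label) => q.1.1.1) fun q => q.2

theorem EffD.bit (P : PolyParams κ G c) {S : ∀ j, Γ j → Finset (c j).Label} (hS : EffD κ G S)
    (i : ∀ j, (c j).Label) : EffD κ G fun j x => bit (G j) (S j x) (i j) :=
  EffD.ite (PBC.scalar P.q) (EffP.mem hS i) (EffD.const fun _ => 1) (EffD.const fun _ => 0)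

theorem EffD.bitPerm (P : PolyParams κ G c) {S : ∀ j, Γ j → Finset (c j).Label}
    (hS : EffD κ G S) {π : ∀ j, Γ j → Equiv.Perm (c j).Label} (hπ : EffD κ G π) :
    EffD κ G (β := fun j => (c j).Label → (G j).Scalar)
      fun j x i => PartialView.bit (G j) (S j x) (π j x i) :=
  EffD.compPerm (v := fun j x i => PartialView.bit (G j) (S j x) i) P.d (PBC.scalar P.q)
    (EffD.pi P.d.fin (EffD.bit (P.reindex _)
    (hS.reindex fun p : (Σ j, (c j).Label) => p.1) fun p => p.2)) hπ

/-- The record is computed in any case, with ∅ in place of a missing answer, and is then replaced by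
`none` if the answer is missing. -/
theorem EffD.rest (P : PolyParams κ G c) {a : ∀ j, Γ j → (c j).Answer}
    {v : ∀ j, Γ j → (c j).Label → (G j).Cipher}
    {f : ∀ j, Γ j → Finset (c j).Label → (c j).Label → Option (G j).Pt}
    (ha : EffD κ G a) (hv : EffD κ G (β := fun j => (c j).Label → (G j).Cipher) v)
    (hf : EffD κ G (β := fun j => (c j).Label → Option (G j).Pt)
      fun j x => f j x ((a j x).getD ∅)) :
    EffD κ G (β := fun j => Option (((c j).Label → (G j).Cipher) ×
      ((c j).Label → Option (G j).Pt) × Finset (c j).Label))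
      fun j x => (a j x).map fun bits => (v j x, f j x bits, bits) := by
  have ha' := EffD.getD P.labels ha fun _ => ∅
  have h := EffD.ite (((PBC.pi P.d.fin P.cipher).prod ((PBC.pi P.d.fin (PBC.pt P.p).option).prod
    P.labels)).option) (EffP.isSome ha) (hv.pair (hf.pair ha')).optionSome
    (EffD.const fun _ => none)
  convert h using 3 with j x
  cases a j x <;> rfl

theorem EffD.view₁Of (P : PolyParams κ G c) (last : Server) {L : ∀ j, Γ j → Finset (c j).Label}
    {k₁ : ∀ j, Γ j → (G j).Scalar} {K₂ : ∀ j, Γ j → (G j).Pt} {flags : ∀ j, Γ j → (c j).Hist}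
    {u : ∀ j, Γ j → Fin (c j).N → Bool} {ρ : ∀ j, Γ j → Fin (c j).N → (G j).Scalar}
    {ζ : ∀ j, Γ j → (c j).Label → (G j).Scalar} {a : ∀ j, Γ j → (c j).Answer}
    {pv : ∀ j, Γ j → (c j).Label → (G j).Cipher} (hL : EffD κ G L) (hk : EffD κ G k₁)
    (hK : EffD κ G K₂) (hf : EffD κ G flags) (hu : EffD κ G (β := fun j => Fin (c j).N → Bool) u)
    (hρ : EffD κ G (β := fun j => Fin (c j).N → (G j).Scalar) ρ)
    (hζ : EffD κ G (β := fun j => (c j).Label → (G j).Scalar) ζ) (ha : EffD κ G a)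
    (hpv : EffD κ G (β := fun j => (c j).Label → (G j).Cipher) pv) :
    EffD κ G (β := fun j => View₁ (G j) (c j)) fun j x =>
      view₁Of last (L j x) (k₁ j x) (K₂ j x) (flags j x) (u j x) (ρ j x) (ζ j x) (a j x)
        (pv j x) := by
  let r : (Σ j, (c j).Label) → J := fun p => p.1
  have hrest := EffD.rest (f := fun j x bits l => if last = .S₁ ∧ l ∈ L j x then
    some ((G j).mul (PartialView.bit (G j) bits l) (G j).B + (G j).mul (k₁ j x) (pv j x l).1)
    else none) P ha hpv (EffD.pi P.d.fin (EffD.ite ((PBC.pt P.p).option.reindex _)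
      ((EffP.const _).and (EffP.mem (hL.reindex r) fun p => p.2))
      (EffD.optionSome (EffD.add (EffD.mul (EffD.bit (P.reindex _)
        (EffD.getD (P.labels.reindex _) (ha.reindex r) fun _ => ∅) fun p => p.2)
        (EffD.const fun p : (Σ j, (c j).Label) => (G p.1).B)) (EffD.mul (hk.reindex r)
        (EffD.fst ((hpv.reindex r).app fun p => p.2))))) (EffD.const fun _ => none)))
  exact (hL.pair (hk.pair (hK.pair (hf.pair (hu.pair (hρ.pair (hζ.pair hrest))))))).of_enc
    (fun _ => _root_.id) fun _ _ => rfl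

theorem EffD.view₂Of (P : PolyParams κ G c) (last : Server) {L : ∀ j, Γ j → Finset (c j).Label}
    {k₂ : ∀ j, Γ j → (G j).Scalar} {K₁ : ∀ j, Γ j → (G j).Pt}
    {π : ∀ j, Γ j → Equiv.Perm (c j).Label}
    {τ : ∀ j, Γ j → (c j).Label → (G j).Scalar} {a : ∀ j, Γ j → (c j).Answer}
    {lbs : ∀ j, Γ j → (c j).Label → (G j).Cipher} (hL : EffD κ G L) (hk : EffD κ G k₂)
    (hK : EffD κ G K₁) (hπ : EffD κ G π)
    (hτ : EffD κ G (β := fun j => (c j).Label → (G j).Scalar) τ) (ha : EffD κ G a)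
    (hlbs : EffD κ G (β := fun j => (c j).Label → (G j).Cipher) lbs) :
    EffD κ G (β := fun j => View₂ (G j) (c j)) fun j x =>
      view₂Of last (L j x) (k₂ j x) (K₁ j x) (π j x) (τ j x) (a j x) (lbs j x) := by
  let r : (Σ j, (c j).Label) → J := fun p => p.1
  have hw : EffD κ G (β := fun j => (c j).Label → (G j).Pt) fun j x l =>
      (lbs j x ((π j x).symm l)).1 + (G j).mul (τ j x ((π j x).symm l)) (G j).B :=
    EffD.compPermSymm (v := fun j x i => (lbs j x i).1 + (G j).mul (τ j x i) (G j).B) P.d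
      (PBC.pt P.p) (EffD.pi P.d.fin (EffD.add (EffD.fst ((hlbs.reindex r).app fun p => p.2))
        (EffD.mul ((hτ.reindex r).app fun p => p.2) (EffD.const fun p : (Σ j, (c j).Label) => (G p.1).B)))) hπ
  have hrest := EffD.rest (f := fun j x bits l => if last = .S₂ ∧ l ∈ L j x then
    some ((G j).mul (PartialView.bit (G j) bits l) (G j).B + (G j).mul (k₂ j x)
      ((lbs j x ((π j x).symm l)).1 + (G j).mul (τ j x ((π j x).symm l)) (G j).B))
    else none) P ha hlbs (EffD.pi P.d.fin (EffD.ite ((PBC.pt P.p).option.reindex _)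
      ((EffP.const _).and (EffP.mem (hL.reindex r) fun p => p.2))
      (EffD.optionSome (EffD.add (EffD.mul (EffD.bit (P.reindex _)
        (EffD.getD (P.labels.reindex _) (ha.reindex r) fun _ => ∅) fun p => p.2)
        (EffD.const fun p : (Σ j, (c j).Label) => (G p.1).B)) (EffD.mul (hk.reindex r)
        ((hw.reindex r).app fun p => p.2)))) (EffD.const fun _ => none)))
  exact (hL.pair (hk.pair (hK.pair (hπ.pair (hτ.pair hrest))))).of_enc
    (fun _ => _root_.id) fun _ _ => rfl

theorem Eff.refill (P : PolyParams κ G c) (cP : Bool) {m : ∀ j, Γ j → PMsg (c j)}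
    {L : ∀ j, Γ j → Finset (c j).Label} {a : ∀ j, Γ j → (c j).Answer} (hm : EffD κ G m)
    (hL : EffD κ G L) (ha : EffD κ G a) :
    Eff κ G fun j x => refill cP (m j x) (L j x) (a j x) := by
  refine Eff.bind (Eff.sampleVector P) ?_
  have hm' := hm.comp (Γ := fun j => Γ j × (Fin (c j).N → Bool)) EffD.id.fst
  have hL' := hL.comp (Γ := fun j => Γ j × (Fin (c j).N → Bool)) EffD.id.fst
  have ha' := ha.comp (Γ := fun j => Γ j × (Fin (c j).N → Bool)) EffD.id.fst
  cases cP
  · exact (EffD.getD P.labels ha' fun _ => ∅).pair EffD.id.snd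
  · refine Eff.map (α := fun j => Equiv.Perm (c j).Label) (Eff.perm P.d) ?_
    let Γ' : J → Type := fun j => (Γ j × (Fin (c j).N → Bool)) × Equiv.Perm (c j).Label
    have hm'' := hm'.comp (Γ := Γ') EffD.id.fst
    have hL'' := hL'.comp (Γ := Γ') EffD.id.fst
    have ha'' := ha'.comp (Γ := Γ') EffD.id.fst
    have hD : EffD κ G (α := Γ') (β := fun j => (c j).Hist) fun j y i =>
        (m j y.1.1).1 ((m j y.1.1).2.symm i) :=
      EffD.compPermSymm P.d P.flag hm''.fst hm''.snd
    have hA : EffD κ G (α := Γ') fun j y =>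
        records (fun i => (m j y.1.1).1 ((m j y.1.1).2.symm i)) \ L j y.1.1 := by
      refine EffD.finset P.d ((EffP.and (EffP.flagged (P.reindex _)
        (hD.reindex fun p : (Σ j, (c j).Label) => p.1) fun p => p.2) (EffP.not
        (EffP.mem (hL''.reindex fun p : (Σ j, (c j).Label) => p.1) fun p => p.2))).congr
          fun p y => ?_)
      rw [Finset.mem_sdiff, records, Finset.mem_filter]
      simp
    have hS := EffD.pick P.d P.V (EffD.id (κ := κ) (G := G) (Γ := Γ')).snd hA
      (EffD.getD P.labels ha'' fun _ => ∅)
    exact hS.pair (EffD.ite (PBC.pi P.N.fin PBC.bool) (EffP.isSome ha'')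
      (EffD.unchosen P hm''.fst hm''.snd hS) EffD.id.fst.snd)

theorem Eff.sendP (P : PolyParams κ G c) (cP : Bool) {ℓa ℓB : J → ℕ}
    {advB : ∀ j, (c j).Hist × BitString (ℓa j) × (G j).Pt × (G j).Pt →
      PMF (PMsg (c j) × BitString (ℓB j))} (hB : Eff κ G advB) {D : ∀ j, Γ j → (c j).Hist}
    {aux : ∀ j, Γ j → BitString (ℓa j)} {K₁ K₂ : ∀ j, Γ j → (G j).Pt} (hD : EffD κ G D)
    (haux : EffD κ G aux) (h₁ : EffD κ G K₁) (h₂ : EffD κ G K₂) :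
    Eff κ G fun j x => sendP cP (advB j) (D j x) (aux j x) (K₁ j x) (K₂ j x) := by
  cases cP
  · simp only [PartialView.sendP, honestP_eq, PMF.map_comp]
    refine Eff.map (α := fun j => Equiv.Perm (c j).Label) (Eff.perm P.d) ?_
    exact ((EffD.compPerm P.d P.flag (hD.comp EffD.id.fst) EffD.id.snd).pair EffD.id.snd).pair
      (EffD.const _)
  · exact hB.comp (hD.pair (haux.pair (h₁.pair h₂)))

theorem Eff.simSubmit (P : PolyParams κ G c) (cP : Bool) {ℓa ℓB : J → ℕ}
    {advB : ∀ j, (c j).Hist × BitString (ℓa j) × (G j).Pt × (G j).Pt →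
      PMF (PMsg (c j) × BitString (ℓB j))} (hB : Eff κ G advB) (D₀ : ∀ j, (c j).Hist) :
    Eff κ G fun j x => simSubmit cP (advB j) (D₀ j) x := by
  refine Eff.bind (Eff.nonce P.q) (Eff.bind (Eff.nonce P.q) (Eff.bind (Eff.sendP P cP hB
    (EffD.getD P.hist EffD.id.fst.fst.fst.fst D₀) EffD.id.fst.fst.snd
    (EffD.id.fst.snd.mul (EffD.const _)) (EffD.id.snd.mul (EffD.const _))) ?_))
  exact (EffD.compPermSymm P.d P.flag EffD.id.snd.fst.fst EffD.id.snd.fst.snd).pair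
    ((((EffD.getD P.labels EffD.id.fst.fst.fst.fst.snd fun _ => ∅).pair
      EffD.id.fst.fst.fst.snd).pair (EffD.id.fst.fst.snd.pair EffD.id.fst.snd)).pair EffD.id.snd)

theorem Eff.simFinish (P : PolyParams κ G c) (last : Server) (cP : Bool) (cS : Option Server)
    {ℓa ℓB ℓC : J → ℕ}
    {adv₁ : ∀ j, View₁ (G j) (c j) × BitString (ℓa j) → PMF (BitString (ℓC j))}
    {adv₂ : ∀ j, View₂ (G j) (c j) × BitString (ℓa j) → PMF (BitString (ℓC j))}
    (h₁ : Eff κ G adv₁) (h₂ : Eff κ G adv₂) :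
    Eff κ G (α := fun j => SimState (G j) (c j) (ℓa j) (ℓB j) × Option (c j).Answer)
      fun j y => simFinish last cP cS (adv₁ j) (adv₂ j) y := by
  let Γ : J → Type := fun j => SimState (G j) (c j) (ℓa j) (ℓB j) × Option (c j).Answer
  refine Eff.bind ?_ (EffD.id.fst.fst.snd.snd.pair EffD.id.snd)
  have ha : EffD κ G (α := Γ) fun j y => y.2.getD none :=
    EffD.getD P.labels.option EffD.id.snd _
  have hr : Eff κ G (α := Γ) fun j y => PartialView.refill cP y.1.2.1 y.1.1.1.1 (y.2.getD none) :=
    Eff.refill P cP EffD.id.fst.snd.fst EffD.id.fst.fst.fst.fst ha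
  rcases cS with _ | _ | _
  · exact EffD.const fun _ _ => false
  · refine Eff.bind hr (Eff.bind (Eff.nonces P.N P.q) (Eff.bind (Eff.nonces P.d P.q)
      (Eff.bind (Eff.nonces P.d P.q) (h₁.comp (EffD.pair (EffD.view₁Of P last
        EffD.id.fst.fst.fst.fst.fst.fst.fst.fst
        EffD.id.fst.fst.fst.fst.fst.fst.snd.fst
        (EffD.id.fst.fst.fst.fst.fst.fst.snd.snd.mul (EffD.const _))
        EffD.id.fst.fst.fst.fst.fst.snd.fst.fst
        EffD.id.fst.fst.fst.snd.snd EffD.id.fst.fst.snd EffD.id.fst.snd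
        (ha.comp EffD.id.fst.fst.fst.fst) (EffD.pi P.d.fin ?_))
        EffD.id.fst.fst.fst.fst.fst.fst.fst.snd)))))
    exact EffD.encrypt
      ((EffD.id.fst.fst.fst.fst.fst.fst.snd.fst.mul (EffD.const _)).add
        (EffD.id.fst.fst.fst.fst.fst.fst.snd.snd.mul (EffD.const _)))
      (EffD.bit (P.reindex _) EffD.id.fst.fst.fst.snd.fst _)
      (EffD.id.snd.app fun p : (Σ j, (c j).Label) => p.2)
  · refine Eff.bind hr (Eff.bind (Eff.nonces P.d P.q) (Eff.bind (Eff.nonces P.d P.q)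
      (h₂.comp (EffD.pair (EffD.view₂Of P last
        EffD.id.fst.fst.fst.fst.fst.fst.fst
        EffD.id.fst.fst.fst.fst.fst.snd.snd
        (EffD.id.fst.fst.fst.fst.fst.snd.fst.mul (EffD.const _))
        EffD.id.fst.fst.fst.fst.snd.fst.snd
        EffD.id.snd (ha.comp EffD.id.fst.fst.fst) (EffD.pi P.d.fin ?_))
        EffD.id.fst.fst.fst.fst.fst.fst.snd))))
    have hb := EffD.bitPerm P (Γ := fun j => ((Γ j × (Finset (c j).Label × (Fin (c j).N → Bool))) ×
      (Fin (c j).d → (G j).Scalar)) × (Fin (c j).d → (G j).Scalar)) (κ := κ)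
      EffD.id.fst.fst.snd.fst EffD.id.fst.fst.fst.fst.snd.fst.snd
    exact EffD.encrypt
      ((EffD.id.fst.fst.fst.fst.fst.snd.fst.mul (EffD.const _)).add
        (EffD.id.fst.fst.fst.fst.fst.snd.snd.mul (EffD.const _)))
      ((hb.reindex fun p : (Σ j, (c j).Label) => p.1).app fun p => p.2)
      (EffD.id.fst.snd.app fun p : (Σ j, (c j).Label) => p.2)

end Efficient

end

section

open Common

/-! ### The distribution of the simulated subset -/

section Subset

variable {G : ECParams} {c : Common} {γ : Type}

/-- Filling up the answer with records outside L produces precisely the V-subsets with the same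
trace on L, that is, the fiber over which S has to be resampled. -/
theorem filter_inter_eq {R L S : Finset c.Label} (hS : S ⊆ R) :
    (((R \ L) ∪ (L ∩ S)).powersetCard c.V).filter (fun S' => L ∩ S ⊆ S') =
      (R.powersetCard c.V).filter fun S' => L ∩ S' = L ∩ S := by
  ext S'
  simp only [Finset.mem_filter, Finset.mem_powersetCard]
  constructor
  · rintro ⟨⟨h1, h2⟩, h3⟩
    refine ⟨⟨fun i hi => ?_, h2⟩, Finset.Subset.antisymm (fun i hi => ?_) fun i hi => ?_⟩
    · rcases Finset.mem_union.1 (h1 hi) with h | h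
      · exact (Finset.mem_sdiff.1 h).1
      · exact hS (Finset.mem_inter.1 h).2
    · rw [Finset.mem_inter] at hi
      rcases Finset.mem_union.1 (h1 hi.2) with h | h
      · exact absurd hi.1 (Finset.mem_sdiff.1 h).2
      · exact h
    · exact Finset.mem_inter.2 ⟨(Finset.mem_inter.1 hi).1, h3 hi⟩
  · rintro ⟨⟨h1, h2⟩, h3⟩
    refine ⟨⟨fun i hi => ?_, h2⟩, h3 ▸ Finset.inter_subset_right⟩
    by_cases hL : i ∈ L
    · exact Finset.mem_union_right _ (h3 ▸ Finset.mem_inter.2 ⟨hL, hi⟩)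
    · exact Finset.mem_union_left _ (Finset.mem_sdiff.2 ⟨h1 hi, hL⟩)

/-- Sampling S, publishing L ∩ S and resampling S given L ∩ S yields the same joint law as S with
its own answer; the vector follows, as S determines it. When the dataset is invalid, `refill` still
outputs a subset, which is meaningless; hence the condition on `F none`. -/
theorem refill_bind (m : PMsg c) (L : Finset c.Label)
    (F : c.Answer → Finset c.Label → (Fin c.N → Bool) → PMF γ)
    (hF : ∀ S S' u, F none S u = F none S' u) :
    ((trusted (fun i => m.1 (m.2.symm i)) L).bind fun a =>
      (refill true m L a).bind fun Su => F a Su.1 Su.2) =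
    (sampleVector c).bind fun u =>
      F (answerOf m.1 L (chosen m.1 m.2 u)) (chosen m.1 m.2 u) u := by
  by_cases h : WellFormed m.1
  · have h' := wellFormed_comp h m.2.symm
    set R := records fun i => m.1 (m.2.symm i) with hR
    have hr : ∀ B : Finset c.Label, ((refill true m L (some B)).bind fun Su =>
        F (some B) Su.1 Su.2) = ((PMF.uniformOfFintype (Equiv.Perm c.Label)).map fun τ =>
          pick τ (R \ L) B c.V).bind fun S => F (some B) S (unchosen m.1 m.2 S) := by
      intro B
      simp only [refill, if_true, Option.isSome_some, PMF.bind_const, PMF.bind_map]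
      rfl
    have ha : ∀ S, answerOf m.1 L S = some (L ∩ S) := fun S => by rw [answerOf, if_pos h]
    rw [trusted_eq h', PMF.bind_map]
    simp only [Function.comp_def, hr, ha]
    -- The vector is replaced by the uniform subset that it yields, so that the resampling argument
    -- applies.
    rw [sampleVector_bind h m.2 fun S u => F (some (L ∩ S)) S u]
    refine bind_resample (f := fun S => L ∩ S)
      (F := fun B S => F (some B) S (unchosen m.1 m.2 S))
      (k := fun B => (PMF.uniformOfFintype (Equiv.Perm c.Label)).map fun τ =>
          pick τ (R \ L) B c.V) _ fun S hS => ?_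
    have hS' := Finset.mem_powersetCard.1 hS
    have hne : ((((R \ L) ∪ (L ∩ S)).powersetCard c.V).filter fun S' => L ∩ S ⊆ S').Nonempty := by
      rw [filter_inter_eq hS'.1]
      exact ⟨S, Finset.mem_filter.2 ⟨hS, rfl⟩⟩
    have hd : Disjoint (R \ L) (L ∩ S) := Finset.disjoint_left.2 fun i hi hi' =>
      (Finset.mem_sdiff.1 hi).2 (Finset.mem_inter.1 hi').1
    have hV : c.V ≤ (R \ L).card + (L ∩ S).card := by
      rw [← hS'.2, ← Finset.card_union_of_disjoint hd]
      refine Finset.card_le_card fun i hi => ?_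
      by_cases hL : i ∈ L
      · exact Finset.mem_union_right _ (Finset.mem_inter.2 ⟨hL, hi⟩)
      · exact Finset.mem_union_left _ (Finset.mem_sdiff.2 ⟨hS'.1 hi, hL⟩)
    have hp := pick_uniform hd ((Finset.card_le_card Finset.inter_subset_right).trans hS'.2.le)
      hV hne
    refine ⟨filter_inter_eq hS'.1 ▸ hne, hp.trans (uniform_congr hne (filter_inter_eq hS'.1))⟩
  -- Invalid dataset: `refill` keeps its freshly sampled vector, as `S₁` does, and `hF` disposes of
  -- the subset.
  · rw [trusted_of_not fun h' => h ((wellFormed_comp_iff m.2.symm).1 h'), PMF.pure_bind]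
    have ha : ∀ S, answerOf m.1 L S = none := fun S => by rw [answerOf, if_neg h]
    simp only [refill, if_true, ha, PMF.bind_bind, PMF.bind_map]
    refine congrArg (PMF.bind _) (funext fun u => ?_)
    simp only [Function.comp_def]
    simp only [Option.isSome_none, Bool.false_eq_true, if_false]
    simp only [hF _ (chosen m.1 m.2 u), PMF.bind_const]

/-- The flags that are set correspond bijectively to the entries of ρ, so no nonce is used twice. -/
theorem mergeNonces_bind {flags : c.Hist} (h : WellFormed flags)
    (F : (c.Label → G.Scalar) → PMF γ) :
    ((G.nonces c.N).bind fun ρ => (G.nonces c.d).bind fun ζ => F (mergeNonces flags ρ ζ)) =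
      (G.nonces c.d).bind F :=
  G.nonces_bind_merge (flagIndex h) F

theorem mem_chosen_iff {flags : c.Hist} {π : Equiv.Perm c.Label} {u : Fin c.N → Bool}
    {i : c.Label} : i ∈ chosen flags π u ↔ π.symm i ∈ chosen flags 1 u := by
  rw [chosen, chosen, Finset.mem_filter, Finset.mem_filter]
  simp only [Finset.mem_univ, true_and]
  rfl

theorem eq_of_wellFormed_of_iff {D D' : c.Hist} (h : WellFormed D) (h' : WellFormed D')
    (hr : ∀ i, (D i : ℕ) = 1 ↔ (D' i : ℕ) = 1) : D = D' := by
  funext i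
  have h1 := h.1 i
  have h2 := h'.1 i
  have h3 := hr i
  refine Fin.ext ?_
  omega

open Classical in
/-- The flags that an honest participant sends, and the subset that results from a fixed vector. -/
theorem map_flags_chosen {D : c.Hist} (h : WellFormed D) {u : Fin c.N → Bool}
    (hu : u ∈ weightVec c) :
    ((PMF.uniformOfFintype (Equiv.Perm c.Label)).map fun π =>
      ((fun j => D (π j), chosen (fun j => D (π j)) π u) : c.Hist × Finset c.Label)) =
    PMF.uniformOfFinset ((Finset.univ.filter WellFormed) ×ˢ ((records D).powersetCard c.V))
      (Finset.Nonempty.product ⟨D, by simpa using h⟩ (subsets_nonempty h)) := by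
  rw [uniformOfFintype_eq]
  have hcard : ∀ {f : c.Hist} (_ : WellFormed f) (π : Equiv.Perm c.Label),
      (chosen f π u).card = c.V := fun hf π => by
    rw [card_chosen hf]
    exact (Finset.mem_filter.1 hu).2
  have hsub : ∀ {f : c.Hist} (_ : WellFormed f), chosen f 1 u ⊆ records f :=
    fun hf => chosen_subset hf 1 u
  refine map_uniform_of_transitive _ _ (fun π _ => ?_) ?_
  · have hD := wellFormed_comp h π
    simp only [Finset.mem_product, Finset.mem_filter, Finset.mem_univ, true_and,
      Finset.mem_powersetCard]
    refine ⟨hD, fun i hi => ?_, hcard hD π⟩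
    simpa using chosen_subset hD π u hi
  · rintro ⟨f, S⟩ hfS ⟨f', S'⟩ hfS'
    simp only [Finset.mem_product, Finset.mem_filter, Finset.mem_univ, true_and,
      Finset.mem_powersetCard] at hfS hfS'
    obtain ⟨hf, hS, hSV⟩ := hfS
    obtain ⟨hf', hS', hSV'⟩ := hfS'
    -- Transitivity comes from π ↦ α π β. On shuffled labels, β turns the flags f' and the positions
    -- that u selects in them into those of f; on domain labels, α preserves the records of D and
    -- moves S to S'.
    obtain ⟨β, hβ1, hβ2, -⟩ := exists_perm_chain (hsub hf') (Finset.subset_univ _) (hsub hf)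
      (Finset.subset_univ _) ((hcard hf' 1).trans (hcard hf 1).symm)
      (hf'.card.trans hf.card.symm) rfl
    obtain ⟨α, hα1, hα2, -⟩ := exists_perm_chain hS (Finset.subset_univ _) hS'
      (Finset.subset_univ _) (hSV.trans hSV'.symm) rfl rfl
    refine ⟨fun π => α * π * β, fun π π' e => ?_, fun π _ e => ⟨Finset.mem_univ _, ?_⟩⟩
    · exact mul_left_cancel (mul_right_cancel e)
    · obtain ⟨rfl, e2⟩ := Prod.mk.inj e
      have e1 : (fun j => D ((α * π * β) j)) = f' := by
        refine eq_of_wellFormed_of_iff (wellFormed_comp h _) hf' fun i => ?_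
        have a1 := hα2 (π (β i))
        have a2 := hβ2 i
        simp only [records, Finset.mem_filter, Finset.mem_univ, true_and] at a1 a2
        exact a1.trans a2
      refine Prod.ext e1 ?_
      show chosen (fun j => D ((α * π * β) j)) (α * π * β) u = S'
      rw [e1]
      ext i
      obtain ⟨j, rfl⟩ := (α * π * β).surjective i
      rw [mem_chosen_iff, Equiv.symm_apply_apply, ← hβ1 j]
      refine Iff.trans ?_ (hα1 (π (β j))).symm
      rw [← e2, mem_chosen_iff (i := π (β j)), Equiv.symm_apply_apply]

/-- By `map_flags_chosen` the flags are uniform among all well-formed ones and independent of the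
subset. Their law does not depend on the dataset, so they may come from D₀ while the subset still
comes from D. -/
theorem honest_flags_bind {D D₀ : c.Hist} (h : WellFormed D) (h₀ : WellFormed D₀)
    {u : Fin c.N → Bool} (hu : u ∈ weightVec c) (F : c.Hist → Finset c.Label → PMF γ) :
    ((PMF.uniformOfFintype (Equiv.Perm c.Label)).bind fun π =>
      F (fun j => D (π j)) (chosen (fun j => D (π j)) π u)) =
    (PMF.uniformOfFintype (Equiv.Perm c.Label)).bind fun π =>
      (PMF.uniformOfFinset _ (subsets_nonempty h)).bind fun S => F (fun j => D₀ (π j)) S := by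
  classical
  have h1 := congrArg (fun μ => PMF.bind μ fun x => F x.1 x.2) (map_flags_chosen h hu)
  have h2 := congrArg (fun μ => PMF.bind μ fun x =>
    (PMF.uniformOfFinset _ (subsets_nonempty h)).bind fun S => F x.1 S) (map_flags_chosen h₀ hu)
  simp only [PMF.bind_map, Function.comp_def] at h1 h2
  have hW : (Finset.univ.filter (WellFormed (c := c))).Nonempty := ⟨D, by simpa using h⟩
  rw [h1, h2, ← bind_uniform_prod hW (subsets_nonempty h) fun f S => F f S,
    ← bind_uniform_prod hW (subsets_nonempty h₀)
    fun f _ => (PMF.uniformOfFinset _ (subsets_nonempty h)).bind fun S => F f S]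
  simp only [PMF.bind_const]

end Subset

/-! ### Vectors of ciphertexts -/

section Hybrid

/-- Hybrid argument: the plaintexts are changed one at a time, and each change costs the advantage
of an adversary that has all other plaintexts and nonces as advice. The ciphertexts are under a
joint key of which one share k is known. The bound is uniform in all advice and plaintexts. -/
theorem SemanticallySecure.exists_bound_vector {𝓔 : ECFamily} (h : SemanticallySecure 𝓔)
    {d : ℕ → ℕ} (hd : PB (fun z => z) d) {X : ℕ → Type} [∀ z, Finite (X z)]
    [∀ z, Nonempty (X z)] (k : ∀ z, X z → (𝓔 z).Scalar)
    (A : ∀ p : (Σ z, X z), (𝓔 p.1).Pt × (Fin (d p.1) → (𝓔 p.1).Cipher) → PMF Bool)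
    (hA : Eff (fun p : (Σ z, X z) => p.1) (fun p => 𝓔 p.1) A) :
    ∃ ε : ℕ → ℝ, Negligible ε ∧ ∀ z x (b b' : Fin (d z) → (𝓔 z).plain),
      |pr ((𝓔 z).nonce.bind fun k' => ((𝓔 z).nonces (d z)).bind fun t =>
          A ⟨z, x⟩ ((𝓔 z).mul k' (𝓔 z).B, fun i =>
            (𝓔 z).encrypt ((𝓔 z).mul (k z x) (𝓔 z).B + (𝓔 z).mul k' (𝓔 z).B) (b i).1 (t i))) -
        pr ((𝓔 z).nonce.bind fun k' => ((𝓔 z).nonces (d z)).bind fun t =>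
          A ⟨z, x⟩ ((𝓔 z).mul k' (𝓔 z).B, fun i =>
            (𝓔 z).encrypt ((𝓔 z).mul (k z x) (𝓔 z).B + (𝓔 z).mul k' (𝓔 z).B) (b' i).1 (t i)))| ≤
      ε z := by
  -- The advice of a hybrid adversary: data x, plaintexts, challenge position, nonces, and the pair
  -- of challenge plaintexts. Positions range over d + 1 values so that the type is nonempty also
  -- for d = 0.
  let I : ℕ → Type := fun z => (X z × (Fin (d z) → (𝓔 z).plain)) ×
    (Fin (d z + 1) × (Fin (d z) → (𝓔 z).Scalar)) × ((𝓔 z).plain × (𝓔 z).plain)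
  have : ∀ z, Nonempty (𝓔 z).plain := fun z => ⟨⟨0, (𝓔 z).zero_mem⟩⟩
  -- Adding k C₁ to the second component of the challenge turns it into a ciphertext under the joint
  -- key.
  let g : ∀ p : (Σ z, I z), (𝓔 p.1).Pt × (𝓔 p.1).Cipher → PMF Bool := fun p y =>
    A ⟨p.1, p.2.1.1⟩ (y.1, fun i => if (i : ℕ) = p.2.2.1.1 then
      (y.2.1, y.2.2 + (𝓔 p.1).mul (k p.1 p.2.1.1) y.2.1) else
      (𝓔 p.1).encrypt ((𝓔 p.1).mul (k p.1 p.2.1.1) (𝓔 p.1).B + y.1) (p.2.1.2 i).1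
        (p.2.2.1.2 i))
  have hg : Eff (fun p : (Σ z, I z) => p.1) (fun p => 𝓔 p.1) g := by
    refine (hA.reindex fun p : (Σ z, I z) => (⟨p.1, p.2.1.1⟩ : Σ z, X z)).comp
      (EffD.id.fst.pair (EffD.pi (hd.fin.reindex _) ?_))
    let r : (Σ p : (Σ z, I z), Fin (d p.1)) → ℕ := fun q => q.1.1
    refine EffD.ite ((PBC.pt ((poly_p 𝓔).reindex r)).prod (PBC.pt ((poly_p 𝓔).reindex r)))
      (EffP.const fun q : (Σ p : (Σ z, I z), Fin (d p.1)) => (q.2 : ℕ) = q.1.2.2.1.1)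
      (EffD.id.snd.fst.pair (EffD.id.snd.snd.add ((EffD.const fun q :
        (Σ p : (Σ z, I z), Fin (d p.1)) => k q.1.1 q.1.2.1.1).mul EffD.id.snd.fst)))
      (EffD.encrypt ((EffD.const fun q : (Σ p : (Σ z, I z), Fin (d p.1)) =>
        (𝓔 q.1.1).mul (k q.1.1 q.1.2.1.1) (𝓔 q.1.1).B).add EffD.id.fst)
        (EffD.const fun q : (Σ p : (Σ z, I z), Fin (d p.1)) => (q.1.2.1.2 q.2).1)
        (EffD.const fun q : (Σ p : (Σ z, I z), Fin (d p.1)) => q.1.2.2.1.2 q.2))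
  obtain ⟨ε, hε, H⟩ := h.exists_bound (I := I) (fun z i => i.2.2.1) (fun z i => i.2.2.2) g hg
  refine ⟨fun z => d z * ε z, hε.natCast_mul hd, fun z x b b' => ?_⟩
  let Q : (Fin (d z) → (𝓔 z).plain) → PMF Bool := fun b =>
    (𝓔 z).nonce.bind fun k' => ((𝓔 z).nonces (d z)).bind fun t =>
      A ⟨z, x⟩ ((𝓔 z).mul k' (𝓔 z).B, fun i =>
        (𝓔 z).encrypt ((𝓔 z).mul (k z x) (𝓔 z).B + (𝓔 z).mul k' (𝓔 z).B) (b i).1 (t i))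
  have hQ : ∀ (b : Fin (d z) → (𝓔 z).plain) (m : Fin (d z)) (x₀ x₁ y : (𝓔 z).plain),
      Q (Function.update b m y) = ((𝓔 z).nonces (d z)).bind fun t =>
        cpaGame (𝓔 z) y (g ⟨z, ((x, b), (m.castSucc, t), (x₀, x₁))⟩) := by
    intro b m x₀ x₁ y
    simp only [Q, cpaGame]
    conv_rhs => rw [PMF.bind_comm]
    refine congrArg (PMF.bind _) (funext fun k' => ?_)
    -- The nonce of the challenge takes the place of the m-th entry of t, which the adversary does
    -- not use.
    rw [← (𝓔 z).nonces_bind_update m]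
    refine congrArg (PMF.bind _) (funext fun t => ?_)
    refine congrArg (PMF.bind _) (funext fun r => ?_)
    refine congrArg (A ⟨z, x⟩) (Prod.ext rfl (funext fun i => ?_))
    by_cases hi : i = m
    · subst hi
      simp only [Function.update_self, Fin.val_castSucc, if_true, ECParams.encrypt]
      rw [ECParams.mul_add, ← add_assoc, add_right_comm, ECParams.mul_mul, ECParams.mul_mul,
        ECParams.mul_mul, mul_comm r (k z x)]
    · simp only [Function.update_of_ne hi, Fin.val_castSucc]
      rw [if_neg fun e => hi (Fin.ext e)]
  have step : ∀ (b : Fin (d z) → (𝓔 z).plain) (m : Fin (d z)) (y : (𝓔 z).plain),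
      |pr (Q b) - pr (Q (Function.update b m y))| ≤ ε z := by
    intro b m y
    have e := hQ b m y (b m) (b m)
    rw [Function.update_eq_self] at e
    rw [e, hQ b m y (b m)]
    exact abs_pr_bind_sub_le fun t _ => H z _
  -- The hybrids: the first m plaintexts are already the new ones.
  let mix : ℕ → Fin (d z) → (𝓔 z).plain := fun m i => if (i : ℕ) < m then b' i else b i
  have key : ∀ m ≤ d z, |pr (Q b) - pr (Q (mix m))| ≤ m * ε z := by
    intro m
    induction m with
    | zero =>
      intro _
      have : mix 0 = b := funext fun i => by simp [mix]
      simp [this]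
    | succ m ih =>
      intro hm
      have e : mix (m + 1) = Function.update (mix m) ⟨m, hm⟩ (b' ⟨m, hm⟩) := by
        funext i
        by_cases hi : i = ⟨m, hm⟩
        · subst hi
          simp [mix]
        · rw [Function.update_of_ne hi]
          have : (i : ℕ) ≠ m := fun e => hi (Fin.ext e)
          simp only [mix]
          congr 1
          rw [eq_iff_iff]
          omega
      have h1 := ih (by omega)
      have h2 := step (mix m) ⟨m, hm⟩ (b' ⟨m, hm⟩)
      rw [e]
      refine (abs_sub_le _ (pr (Q (mix m))) _).trans ?_
      push_cast
      linarith
  have e : mix (d z) = b' := funext fun i => by simp [mix]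
  have := key _ le_rfl
  rwa [e] at this

end Hybrid

end

section

open Common

/-! ### The executions -/

section Executions

variable {G : ECParams} {c : Common} {ℓa ℓB ℓC : ℕ}

/-- Fixes the second sample while the first stays random. In this way all samples except the honest
server's key and the encryption nonces become advice. -/
theorem abs_pr_bind_bind_sub_le {α β : Type} {p : PMF α} {q : PMF β} {F F' : α → β → PMF Bool}
    {ε : ℝ} (h : ∀ b, |pr (p.bind fun a => F a b) - pr (p.bind fun a => F' a b)| ≤ ε) :
    |pr (p.bind fun a => q.bind fun b => F a b) - pr (p.bind fun a => q.bind fun b => F' a b)| ≤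
      ε := by
  rw [PMF.bind_comm p q, PMF.bind_comm p q]
  exact abs_pr_bind_sub_le fun b _ => h b

/-- The ideal execution with the simulator, followed by a distinguisher. -/
def simExec (last : Server) (cP : Bool) (cS : Option Server)
    (advB : c.Hist × BitString ℓa × G.Pt × G.Pt → PMF (PMsg c × BitString ℓB))
    (adv₁ : View₁ G c × BitString ℓa → PMF (BitString ℓC))
    (adv₂ : View₂ G c × BitString ℓa → PMF (BitString ℓC)) (D₀ D : c.Hist)
    (L : Finset c.Label) (aux : BitString ℓa) (T : ExecOut c ℓB ℓC → PMF Bool) : PMF Bool :=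
  G.nonce.bind fun k₁ => G.nonce.bind fun k₂ =>
  (sendP cP advB (if cP then D else D₀) aux (G.mul k₁ G.B) (G.mul k₂ G.B)).bind fun m =>
  (trusted (if cP then fun i => m.1.1 (m.1.2.symm i) else D) L).bind fun a =>
  (simC last cP cS adv₁ adv₂ L aux k₁ k₂ m.1 a).bind fun o => T (mkOut cP cS a a m.2 o)

theorem ideal_bind (last : Server) (cP : Bool) (cS : Option Server)
    (advB : c.Hist × BitString ℓa × G.Pt × G.Pt → PMF (PMsg c × BitString ℓB))
    (adv₁ : View₁ G c × BitString ℓa → PMF (BitString ℓC))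
    (adv₂ : View₂ G c × BitString ℓa → PMF (BitString ℓC)) (D₀ D : c.Hist)
    (L : Finset c.Label) (aux : BitString ℓa) (T : ExecOut c ℓB ℓC → PMF Bool)
    {finish : BitString (Nat.card (BitEnc.Idx (SimState G c ℓa ℓB))) × Option c.Answer →
      PMF (BitString ℓB × BitString ℓC)}
    (hf : ∀ y a, finish (toBits y, a) = simFinish last cP cS adv₁ adv₂ (y, a)) :
    (ideal cP cS (fun x => (simSubmit cP advB D₀ x).map fun y => (y.1, toBits y.2)) finish
      D L aux).bind T = simExec last cP cS advB adv₁ adv₂ D₀ D L aux T := by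
  have h : ideal cP cS (fun x => (simSubmit cP advB D₀ x).map fun y => (y.1, toBits y.2)) finish
      D L aux = ((simSubmit cP advB D₀ ((if cP then some D else none,
        if cS.isSome then some L else none), aux)).map fun y => (y.1, toBits y.2)).bind fun y =>
      (trusted (if cP then y.1 else D) L).bind fun a =>
      (finish (y.2, if cS.isSome then some a else none)).bind fun o =>
      PMF.pure (mkOut cP cS a a o.1 o.2) := rfl
  rw [h]
  simp only [PMF.bind_bind, PMF.bind_map, Function.comp_def, hf, simSubmit, simFinish,
    PMF.pure_bind, simExec]
  cases cP <;> rcases cS with _ | _ | _ <;> rfl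

/-- The real execution, followed by a distinguisher. -/
def realExec (last : Server) (cP : Bool) (cS : Option Server)
    (advB : c.Hist × BitString ℓa × G.Pt × G.Pt → PMF (PMsg c × BitString ℓB))
    (adv₁ : View₁ G c × BitString ℓa → PMF (BitString ℓC))
    (adv₂ : View₂ G c × BitString ℓa → PMF (BitString ℓC)) (D : c.Hist)
    (L : Finset c.Label) (aux : BitString ℓa) (T : ExecOut c ℓB ℓC → PMF Bool) : PMF Bool :=
  (real last cP cS advB adv₁ adv₂ D L aux).bind T

/-- The output of the distinguisher, when `S₁` is corrupted. -/
def runS₁ (last : Server) (adv₁ : View₁ G c × BitString ℓa → PMF (BitString ℓC))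
    (T : c.Answer → BitString ℓC → PMF Bool) (L : Finset c.Label) (aux : BitString ℓa)
    (k₁ k₂ : G.Scalar) (flags : c.Hist) (u : Fin c.N → Bool) (ρ : Fin c.N → G.Scalar)
    (ζ : c.Label → G.Scalar) (a : c.Answer) (S : Finset c.Label) (t : c.Label → G.Scalar) :
    PMF Bool :=
  (adv₁ (view₁Of last L k₁ (G.mul k₂ G.B) flags u ρ ζ a fun i =>
    G.encrypt (G.mul k₁ G.B + G.mul k₂ G.B) (bit G S i) (t i), aux)).bind (T a)

/-- The output of the distinguisher, when `S₂` is corrupted. -/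
def runS₂ (last : Server) (adv₂ : View₂ G c × BitString ℓa → PMF (BitString ℓC))
    (T : c.Answer → BitString ℓC → PMF Bool) (L : Finset c.Label) (aux : BitString ℓa)
    (k₁ k₂ : G.Scalar) (π : Equiv.Perm c.Label) (τ : c.Label → G.Scalar) (a : c.Answer)
    (S : Finset c.Label) (r : c.Label → G.Scalar) : PMF Bool :=
  (adv₂ (view₂Of last L k₂ (G.mul k₁ G.B) π τ a fun j =>
    G.encrypt (G.mul k₁ G.B + G.mul k₂ G.B) (bit G S (π j)) (r j), aux)).bind (T a)

section

variable (last : Server) (cP : Bool)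
  (advB : c.Hist × BitString ℓa × G.Pt × G.Pt → PMF (PMsg c × BitString ℓB))
  (adv₁ : View₁ G c × BitString ℓa → PMF (BitString ℓC))
  (adv₂ : View₂ G c × BitString ℓa → PMF (BitString ℓC)) (D₀ D : c.Hist)
  (L : Finset c.Label) (aux : BitString ℓa) (T : ExecOut c ℓB ℓC → PMF Bool)

theorem simExec_none : simExec last cP none advB adv₁ adv₂ D₀ D L aux T =
    G.nonce.bind fun k₁ => G.nonce.bind fun k₂ =>
    (sendP cP advB (if cP then D else D₀) aux (G.mul k₁ G.B) (G.mul k₂ G.B)).bind fun m =>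
    (trusted (if cP then fun i => m.1.1 (m.1.2.symm i) else D) L).bind fun a =>
      T (mkOut cP none a a m.2 fun _ => false) := by
  simp only [simExec, simC, PMF.pure_bind]

theorem realExec_none : realExec last cP none advB adv₁ adv₂ D L aux T =
    G.nonce.bind fun k₁ => G.nonce.bind fun k₂ =>
    (sendP cP advB D aux (G.mul k₁ G.B) (G.mul k₂ G.B)).bind fun m =>
    (sampleVector c).bind fun u =>
      T (mkOut cP none (answerOf m.1.1 L (chosen m.1.1 m.1.2 u))
        (answerOf m.1.1 L (chosen m.1.1 m.1.2 u)) m.2 fun _ => false) := by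
  simp only [realExec, real_eq, advC, PMF.bind_bind, PMF.pure_bind, PMF.bind_const]

theorem simExec_S₁ : simExec last cP (some .S₁) advB adv₁ adv₂ D₀ D L aux T =
    G.nonce.bind fun k₁ => G.nonce.bind fun k₂ =>
    (sendP cP advB (if cP then D else D₀) aux (G.mul k₁ G.B) (G.mul k₂ G.B)).bind fun m =>
    (trusted (if cP then fun i => m.1.1 (m.1.2.symm i) else D) L).bind fun a =>
    (refill cP m.1 L a).bind fun Su => (G.nonces c.N).bind fun ρ => (G.nonces c.d).bind fun ζ =>
    (G.nonces c.d).bind fun t =>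
      runS₁ last adv₁ (fun a o => T (mkOut cP (some .S₁) a a m.2 o)) L aux k₁ k₂ m.1.1 Su.2 ρ ζ a
        Su.1 t := by
  simp only [simExec, simC, PMF.bind_bind]
  rfl

theorem realExec_S₁ : realExec last cP (some .S₁) advB adv₁ adv₂ D L aux T =
    G.nonce.bind fun k₁ => G.nonce.bind fun k₂ =>
    (sendP cP advB D aux (G.mul k₁ G.B) (G.mul k₂ G.B)).bind fun m =>
    (sampleVector c).bind fun u => (G.nonces c.N).bind fun ρ => (G.nonces c.d).bind fun ζ =>
    (G.nonces c.d).bind fun τ =>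
      runS₁ last adv₁ (fun a o => T (mkOut cP (some .S₁) a a m.2 o)) L aux k₁ k₂ m.1.1 u ρ ζ
        (answerOf m.1.1 L (chosen m.1.1 m.1.2 u)) (chosen m.1.1 m.1.2 u) fun i =>
          mergeNonces m.1.1 ρ ζ (m.1.2.symm i) + τ (m.1.2.symm i) := by
  simp only [realExec, real_eq, advC, PMF.bind_bind, PMF.pure_bind]
  rfl

theorem simExec_S₂ : simExec last cP (some .S₂) advB adv₁ adv₂ D₀ D L aux T =
    G.nonce.bind fun k₁ => G.nonce.bind fun k₂ =>
    (sendP cP advB (if cP then D else D₀) aux (G.mul k₁ G.B) (G.mul k₂ G.B)).bind fun m =>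
    (trusted (if cP then fun i => m.1.1 (m.1.2.symm i) else D) L).bind fun a =>
    (refill cP m.1 L a).bind fun Su => (G.nonces c.d).bind fun r => (G.nonces c.d).bind fun τ =>
      runS₂ last adv₂ (fun a o => T (mkOut cP (some .S₂) a a m.2 o)) L aux k₁ k₂ m.1.2 τ a
        Su.1 r := by
  simp only [simExec, simC, PMF.bind_bind]
  rfl

theorem realExec_S₂ : realExec last cP (some .S₂) advB adv₁ adv₂ D L aux T =
    G.nonce.bind fun k₁ => G.nonce.bind fun k₂ =>
    (sendP cP advB D aux (G.mul k₁ G.B) (G.mul k₂ G.B)).bind fun m =>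
    (sampleVector c).bind fun u => (G.nonces c.N).bind fun ρ => (G.nonces c.d).bind fun ζ =>
    (G.nonces c.d).bind fun τ =>
      runS₂ last adv₂ (fun a o => T (mkOut cP (some .S₂) a a m.2 o)) L aux k₁ k₂ m.1.2 τ
        (answerOf m.1.1 L (chosen m.1.1 m.1.2 u)) (chosen m.1.1 m.1.2 u)
        (mergeNonces m.1.1 ρ ζ) := by
  simp only [realExec, real_eq, advC, PMF.bind_bind, PMF.pure_bind]
  rfl

theorem bijective_shift (r : c.Label → G.Scalar) (π : Equiv.Perm c.Label) :
    Function.Bijective fun (τ : c.Label → G.Scalar) i => r (π.symm i) + τ (π.symm i) := by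
  refine ⟨fun τ τ' h => funext fun j => ?_, fun s => ⟨fun j => s (π j) - r j, funext fun i => ?_⟩⟩
  · simpa using congrFun h (π j)
  · simp

/-! ### A malicious participant -/

/-- The simulation is statistically close here: subset and vector have the correct joint law by
`refill_bind`. An error arises only for `S₁`, which knows the nonces r of the list, so the sums r +
τ with nonzero τ are not exactly fresh nonces. -/
theorem abs_pr_malicious_sub_le (cS : Option Server) :
    |pr (simExec last true cS advB adv₁ adv₂ D₀ D L aux T) -
      pr (realExec last true cS advB adv₁ adv₂ D L aux T)| ≤ 2 * (c.d * (1 / G.q)) := by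
  have h0 : (0 : ℝ) ≤ 2 * (c.d * (1 / G.q)) := by positivity
  rcases cS with _ | _ | _
  · rw [simExec_none, realExec_none]
    refine abs_pr_bind_sub_le fun k₁ _ => abs_pr_bind_sub_le fun k₂ _ =>
      abs_pr_bind_sub_le fun m _ => ?_
    have h := refill_bind m.1 L (fun a _ _ =>
      T (mkOut true none a a m.2 fun _ => false)) fun _ _ _ => rfl
    simp only [PMF.bind_const] at h
    simp only [if_true]
    rw [h, sub_self, abs_zero]
    exact h0
  · rw [simExec_S₁, realExec_S₁]
    refine abs_pr_bind_sub_le fun k₁ _ => abs_pr_bind_sub_le fun k₂ _ =>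
      abs_pr_bind_sub_le fun m _ => ?_
    simp only [if_true]
    rw [refill_bind m.1 L (fun a S u => (G.nonces c.N).bind fun ρ => (G.nonces c.d).bind fun ζ =>
      (G.nonces c.d).bind fun t =>
        runS₁ last adv₁ (fun a o => T (mkOut true (some .S₁) a a m.2 o)) L aux k₁ k₂ m.1.1 u ρ ζ a
          S t) fun _ _ _ => rfl]
    refine abs_pr_bind_sub_le fun u _ => abs_pr_bind_sub_le fun ρ _ =>
      abs_pr_bind_sub_le fun ζ _ => ?_
    rw [abs_sub_comm]
    exact G.abs_pr_nonces_comp_sub_le (bijective_shift (mergeNonces m.1.1 ρ ζ) m.1.2) _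
  · rw [simExec_S₂, realExec_S₂]
    refine abs_pr_bind_sub_le fun k₁ _ => abs_pr_bind_sub_le fun k₂ _ =>
      abs_pr_bind_sub_le fun m _ => ?_
    simp only [if_true]
    rw [refill_bind m.1 L (fun a S u => (G.nonces c.d).bind fun r => (G.nonces c.d).bind fun τ =>
        runS₂ last adv₂ (fun a o => T (mkOut true (some .S₂) a a m.2 o)) L aux k₁ k₂ m.1.2 τ a
          S r) fun _ _ _ => rfl]
    refine abs_pr_bind_sub_le fun u _ => ?_
    by_cases h : WellFormed m.1.1
    · rw [mergeNonces_bind h fun r => (G.nonces c.d).bind fun τ =>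
        runS₂ last adv₂ (fun a o => T (mkOut true (some .S₂) a a m.2 o)) L aux k₁ k₂ m.1.2 τ
          (answerOf m.1.1 L (chosen m.1.1 m.1.2 u)) (chosen m.1.1 m.1.2 u) r, sub_self, abs_zero]
      exact h0
    -- After the message that the dataset is invalid, the view of `S₂` contains no ciphertexts, so
    -- the nonces do not matter.
    · have ha : ∀ S, answerOf m.1.1 L S = none := fun S => by rw [answerOf, if_neg h]
      simp only [ha, runS₂, view₂Of, Option.map_none, PMF.bind_const, sub_self, abs_zero]
      exact h0

/-! ### An honest participant -/

variable {D₀ D}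

/-- The shuffle is undone by the permutation of the partial view, so the law of the subset involves
D only and the subset is independent of π. -/
theorem sampleVector_bind_honest {γ : Type} (h : WellFormed D) (π : Equiv.Perm c.Label)
    (F : Finset c.Label → PMF γ) :
    ((sampleVector c).bind fun u => F (chosen (fun j => D (π j)) π u)) =
      (PMF.uniformOfFinset _ (subsets_nonempty h)).bind F := by
  rw [sampleVector_bind (wellFormed_comp h π) π fun S _ => F S]
  congr 1
  refine uniform_congr _ ?_
  simp only [Equiv.apply_symm_apply]

theorem sendP_false (K₁ K₂ : G.Pt) : sendP false advB D aux K₁ K₂ =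
    (PMF.uniformOfFintype (Equiv.Perm c.Label)).map fun π =>
      (((fun j => D (π j)), π), fun _ => false) := by
  rw [sendP, if_neg Bool.false_ne_true, honestP_eq, PMF.map_comp]
  rfl

theorem refill_false (m : PMsg c) (a : c.Answer) :
    refill false m L a = (sampleVector c).map fun u => (a.getD ∅, u) := by
  simp only [refill, Bool.false_eq_true, if_false]
  rfl

theorem answerOf_honest (h : WellFormed D) (π : Equiv.Perm c.Label) (S : Finset c.Label) :
    answerOf (fun j => D (π j)) L S = some (L ∩ S) := by
  rw [answerOf, if_pos (wellFormed_comp h π)]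

theorem simExec_honest_none (h : WellFormed D) :
    simExec last false none advB adv₁ adv₂ D₀ D L aux T =
      realExec last false none advB adv₁ adv₂ D L aux T := by
  simp only [simExec_none, realExec_none, sendP_false, PMF.bind_map, Function.comp_def,
    Bool.false_eq_true, if_false, trusted_eq h, answerOf_honest L h]
  simp only [sampleVector_bind_honest h _ fun S =>
    T (mkOut false none (some (L ∩ S)) (some (L ∩ S)) (fun _ => false) fun _ => false)]

theorem simExec_honest_S₂ (h : WellFormed D) :
    simExec last false (some .S₂) advB adv₁ adv₂ D₀ D L aux T =
      G.nonce.bind fun k₁ => G.nonce.bind fun k₂ =>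
      (PMF.uniformOfFintype (Equiv.Perm c.Label)).bind fun π =>
      (PMF.uniformOfFinset _ (subsets_nonempty h)).bind fun S =>
      (G.nonces c.d).bind fun τ => (G.nonces c.d).bind fun r =>
        runS₂ last adv₂ (fun a o => T (mkOut false (some .S₂) a a (fun _ => false) o)) L aux
          k₁ k₂ π τ (some (L ∩ S)) (L ∩ S) r := by
  simp only [simExec_S₂, sendP_false, PMF.bind_map, Function.comp_def,
    Bool.false_eq_true, if_false, trusted_eq h, refill_false, Option.getD_some, PMF.bind_const]
  refine congrArg (PMF.bind _) (funext fun k₁ => congrArg (PMF.bind _) (funext fun k₂ =>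
    congrArg (PMF.bind _) (funext fun π => congrArg (PMF.bind _) (funext fun S => ?_))))
  rw [PMF.bind_comm]

theorem realExec_honest_S₂ (h : WellFormed D) :
    realExec last false (some .S₂) advB adv₁ adv₂ D L aux T =
      G.nonce.bind fun k₁ => G.nonce.bind fun k₂ =>
      (PMF.uniformOfFintype (Equiv.Perm c.Label)).bind fun π =>
      (PMF.uniformOfFinset _ (subsets_nonempty h)).bind fun S =>
      (G.nonces c.d).bind fun τ => (G.nonces c.d).bind fun r =>
        runS₂ last adv₂ (fun a o => T (mkOut false (some .S₂) a a (fun _ => false) o)) L aux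
          k₁ k₂ π τ (some (L ∩ S)) S r := by
  simp only [realExec_S₂, sendP_false, PMF.bind_map, Function.comp_def, answerOf_honest L h]
  refine congrArg (PMF.bind _) (funext fun k₁ => congrArg (PMF.bind _) (funext fun k₂ =>
    congrArg (PMF.bind _) (funext fun π => ?_)))
  rw [← sampleVector_bind_honest h π]
  refine congrArg (PMF.bind _) (funext fun u => ?_)
  rw [mergeNonces_bind (wellFormed_comp h π) fun r => (G.nonces c.d).bind fun τ =>
    runS₂ last adv₂ (fun a o => T (mkOut false (some .S₂) a a (fun _ => false) o)) L aux k₁ k₂ π τ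
      (some (L ∩ chosen (fun j => D (π j)) π u)) (chosen (fun j => D (π j)) π u) r, PMF.bind_comm]

theorem simExec_honest_S₁ (h : WellFormed D) :
    simExec last false (some .S₁) advB adv₁ adv₂ D₀ D L aux T =
      G.nonce.bind fun k₁ => G.nonce.bind fun k₂ => (sampleVector c).bind fun u =>
      (PMF.uniformOfFintype (Equiv.Perm c.Label)).bind fun π =>
      (PMF.uniformOfFinset _ (subsets_nonempty h)).bind fun S =>
      (G.nonces c.N).bind fun ρ => (G.nonces c.d).bind fun ζ => (G.nonces c.d).bind fun t =>
        runS₁ last adv₁ (fun a o => T (mkOut false (some .S₁) a a (fun _ => false) o)) L aux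
          k₁ k₂ (fun j => D₀ (π j)) u ρ ζ (some (L ∩ S)) (L ∩ S) t := by
  simp only [simExec_S₁, sendP_false, PMF.bind_map, Function.comp_def,
    Bool.false_eq_true, if_false, trusted_eq h, refill_false, Option.getD_some]
  refine congrArg (PMF.bind _) (funext fun k₁ => congrArg (PMF.bind _) (funext fun k₂ => ?_))
  rw [PMF.bind_comm (sampleVector c)]
  refine congrArg (PMF.bind _) (funext fun π => ?_)
  rw [PMF.bind_comm (sampleVector c)]

/-- The intermediate experiment has the simulator's flags, from D₀, but the true subset S in the
ciphertexts. Exchanging the flags is free for each fixed u; the error comes from the sums of nonces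
in the partial view. -/
theorem abs_pr_realExec_honest_S₁_sub_le (h : WellFormed D) (h₀ : WellFormed D₀) :
    |pr (G.nonce.bind fun k₁ => G.nonce.bind fun k₂ => (sampleVector c).bind fun u =>
      (PMF.uniformOfFintype (Equiv.Perm c.Label)).bind fun π =>
      (PMF.uniformOfFinset _ (subsets_nonempty h)).bind fun S =>
      (G.nonces c.N).bind fun ρ => (G.nonces c.d).bind fun ζ => (G.nonces c.d).bind fun t =>
        runS₁ last adv₁ (fun a o => T (mkOut false (some .S₁) a a (fun _ => false) o)) L aux
          k₁ k₂ (fun j => D₀ (π j)) u ρ ζ (some (L ∩ S)) S t) -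
      pr (realExec last false (some .S₁) advB adv₁ adv₂ D L aux T)| ≤ 2 * (c.d * (1 / G.q)) := by
  simp only [realExec_S₁, sendP_false, PMF.bind_map, Function.comp_def, answerOf_honest L h]
  refine abs_pr_bind_sub_le fun k₁ _ => abs_pr_bind_sub_le fun k₂ _ => ?_
  rw [PMF.bind_comm _ (sampleVector c)]
  refine abs_pr_bind_sub_le fun u hu => ?_
  rw [sampleVector_eq, PMF.mem_support_uniformOfFinset_iff] at hu
  rw [← honest_flags_bind h h₀ hu fun f S => (G.nonces c.N).bind fun ρ =>
    (G.nonces c.d).bind fun ζ => (G.nonces c.d).bind fun t =>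
      runS₁ last adv₁ (fun a o => T (mkOut false (some .S₁) a a (fun _ => false) o)) L aux
        k₁ k₂ f u ρ ζ (some (L ∩ S)) S t]
  refine abs_pr_bind_sub_le fun π _ => abs_pr_bind_sub_le fun ρ _ =>
    abs_pr_bind_sub_le fun ζ _ => ?_
  rw [abs_sub_comm]
  exact G.abs_pr_nonces_comp_sub_le (bijective_shift (mergeNonces _ ρ ζ) π) _

end

end Executions

end

section

open Common

/-! ### The simulation is indistinguishable from the protocol -/

/-- A bit as a plaintext. -/
def plainBit (G : ECParams) {c : Common} (S : Finset c.Label) (i : c.Label) : G.plain :=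
  ⟨bit G S i, by
    rw [bit]
    split_ifs
    · exact G.one_mem
    · exact G.zero_mem⟩

section Families

variable {𝓔 : ECFamily} {C : CommonFamily} {ℓa ℓB ℓC : ℕ → ℕ}

theorem polyParams (𝓔 : ECFamily) (C : CommonFamily) :
    PolyParams (fun z => z) (fun z => 𝓔 z) fun z => C z :=
  ⟨poly_p 𝓔, poly_q 𝓔, C.poly_d, C.poly_cap⟩

variable (last : Server)
  (advB : ∀ z, (C z).Hist × BitString (ℓa z) × (𝓔 z).Pt × (𝓔 z).Pt →
    PMF (PMsg (C z) × BitString (ℓB z)))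
  (adv₁ : ∀ z, View₁ (𝓔 z) (C z) × BitString (ℓa z) → PMF (BitString (ℓC z)))
  (adv₂ : ∀ z, View₂ (𝓔 z) (C z) × BitString (ℓa z) → PMF (BitString (ℓC z)))
  (D₀ D : ∀ z, (C z).Hist) (L : ∀ z, Finset (C z).Label) (aux : ∀ z, BitString (ℓa z))
  (T : ∀ z, ExecOut (C z) (ℓB z) (ℓC z) → PMF Bool)

/-- The two experiments differ only in the plaintexts, L ∩ S or S. The own key, flags, vector,
nonces of the list and answer are fixed as advice, as are the inputs; K₂ is the challenge key. -/
theorem SemanticallySecure.exists_bound_S₁ (h : SemanticallySecure 𝓔)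
    (h₁ : Eff (fun z => z) (fun z => 𝓔 z) adv₁) (hT : Eff (fun z => z) (fun z => 𝓔 z) T)
    (hD : ∀ z, WellFormed (D z)) :
    ∃ ε : ℕ → ℝ, Negligible ε ∧ ∀ z,
      |pr (simExec last false (some .S₁) (advB z) (adv₁ z) (adv₂ z) (D₀ z) (D z) (L z) (aux z)
          (T z)) -
        pr ((𝓔 z).nonce.bind fun k₁ => (𝓔 z).nonce.bind fun k₂ => (sampleVector (C z)).bind fun u =>
          (PMF.uniformOfFintype (Equiv.Perm (C z).Label)).bind fun π =>
          (PMF.uniformOfFinset _ (subsets_nonempty (hD z))).bind fun S =>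
          ((𝓔 z).nonces (C z).N).bind fun ρ => ((𝓔 z).nonces (C z).d).bind fun ζ =>
          ((𝓔 z).nonces (C z).d).bind fun t =>
            runS₁ last (adv₁ z) (fun a o => T z (mkOut false (some .S₁) a a (fun _ => false) o))
              (L z) (aux z) k₁ k₂ (fun j => D₀ z (π j)) u ρ ζ (some (L z ∩ S)) S t)| ≤ ε z := by
  let X : ℕ → Type := fun z => ((𝓔 z).Scalar × (C z).Hist) × ((Fin (C z).N → Bool) ×
    (Fin (C z).N → (𝓔 z).Scalar)) × (((C z).Label → (𝓔 z).Scalar) × Finset (C z).Label)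
  let A : ∀ p : (Σ z, X z), (𝓔 p.1).Pt × ((C p.1).Label → (𝓔 p.1).Cipher) → PMF Bool := fun p y =>
    (adv₁ p.1 (view₁Of last (L p.1) p.2.1.1 y.1 p.2.1.2 p.2.2.1.1 p.2.2.1.2 p.2.2.2.1
      (some p.2.2.2.2) y.2, aux p.1)).bind fun o =>
        T p.1 (mkOut false (some .S₁) (some p.2.2.2.2) (some p.2.2.2.2) (fun _ => false) o)
  have hA : Eff (fun p : (Σ z, X z) => p.1) (fun p => 𝓔 p.1) A := by
    let r : (Σ z, X z) → ℕ := fun p => p.1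
    refine Eff.bind ((h₁.reindex r).comp (EffD.pair (EffD.view₁Of ((polyParams 𝓔 C).reindex r) last
      (EffD.const _) (EffD.const _) EffD.id.fst (EffD.const _) (EffD.const _) (EffD.const _)
      (EffD.const _) (EffD.const _) EffD.id.snd) (EffD.const _))) ((hT.reindex r).comp ?_)
    exact (EffD.const fun p : (Σ z, X z) => ((none, some (some p.2.2.2.2)) :
      Option (C p.1).Answer × Option (C p.1).Answer)).pair ((EffD.const fun p : (Σ z, X z) =>
        (none : Option (BitString (ℓB p.1)))).pair EffD.id.snd.optionSome)
  obtain ⟨ε, hε, H⟩ := h.exists_bound_vector (polyParams 𝓔 C).d (fun z x => x.1.1) A hA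
  refine ⟨ε, hε, fun z => ?_⟩
  rw [simExec_honest_S₁ _ _ _ _ _ _ _ (hD z)]
  refine abs_pr_bind_sub_le fun k₁ _ => ?_
  refine abs_pr_bind_bind_sub_le fun u => abs_pr_bind_bind_sub_le fun π =>
    abs_pr_bind_bind_sub_le fun S => abs_pr_bind_bind_sub_le fun ρ =>
    abs_pr_bind_bind_sub_le fun ζ => ?_
  exact H z ((k₁, fun j => D₀ z (π j)), (u, ρ), (ζ, L z ∩ S)) (plainBit (𝓔 z) (L z ∩ S))
    (plainBit (𝓔 z) S)

theorem SemanticallySecure.exists_bound_S₂ (h : SemanticallySecure 𝓔)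
    (h₂ : Eff (fun z => z) (fun z => 𝓔 z) adv₂) (hT : Eff (fun z => z) (fun z => 𝓔 z) T)
    (hD : ∀ z, WellFormed (D z)) :
    ∃ ε : ℕ → ℝ, Negligible ε ∧ ∀ z,
      |pr (simExec last false (some .S₂) (advB z) (adv₁ z) (adv₂ z) (D₀ z) (D z) (L z) (aux z)
          (T z)) -
        pr (realExec last false (some .S₂) (advB z) (adv₁ z) (adv₂ z) (D z) (L z) (aux z)
          (T z))| ≤ ε z := by
  let X : ℕ → Type := fun z => ((𝓔 z).Scalar × Equiv.Perm (C z).Label) ×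
    (((C z).Label → (𝓔 z).Scalar) × Finset (C z).Label)
  let A : ∀ p : (Σ z, X z), (𝓔 p.1).Pt × ((C p.1).Label → (𝓔 p.1).Cipher) → PMF Bool := fun p y =>
    (adv₂ p.1 (view₂Of last (L p.1) p.2.1.1 y.1 p.2.1.2 p.2.2.1 (some p.2.2.2) y.2,
      aux p.1)).bind fun o =>
        T p.1 (mkOut false (some .S₂) (some p.2.2.2) (some p.2.2.2) (fun _ => false) o)
  have hA : Eff (fun p : (Σ z, X z) => p.1) (fun p => 𝓔 p.1) A := by
    let r : (Σ z, X z) → ℕ := fun p => p.1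
    refine Eff.bind ((h₂.reindex r).comp (EffD.pair (EffD.view₂Of ((polyParams 𝓔 C).reindex r) last
      (EffD.const _) (EffD.const _) EffD.id.fst (EffD.const _) (EffD.const _)
      (EffD.const _) EffD.id.snd) (EffD.const _))) ((hT.reindex r).comp ?_)
    exact (EffD.const fun p : (Σ z, X z) => ((some (some p.2.2.2), none) :
      Option (C p.1).Answer × Option (C p.1).Answer)).pair ((EffD.const fun p : (Σ z, X z) =>
        (none : Option (BitString (ℓB p.1)))).pair EffD.id.snd.optionSome)
  obtain ⟨ε, hε, H⟩ := h.exists_bound_vector (polyParams 𝓔 C).d (fun z x => x.1.1) A hA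
  refine ⟨ε, hε, fun z => ?_⟩
  rw [simExec_honest_S₂ _ _ _ _ _ _ _ (hD z), realExec_honest_S₂ _ _ _ _ _ _ _ (hD z)]
  refine abs_pr_bind_bind_sub_le fun k₂ => abs_pr_bind_bind_sub_le fun π =>
    abs_pr_bind_bind_sub_le fun S => abs_pr_bind_bind_sub_le fun τ => ?_
  -- The roles are exchanged: k₂ is the known share and K₁ the challenge key, so the summands of the
  -- joint key have to be commuted.
  have := H z ((k₂, π), (τ, L z ∩ S)) (fun j => plainBit (𝓔 z) (L z ∩ S) (π j))
    fun j => plainBit (𝓔 z) S (π j)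
  simp only [add_comm ((𝓔 z).mul k₂ (𝓔 z).B)] at this
  exact this

theorem SemanticallySecure.negligible_simExec_sub (h : SemanticallySecure 𝓔) (cP : Bool)
    (cS : Option Server) (h₁ : Eff (fun z => z) (fun z => 𝓔 z) adv₁)
    (h₂ : Eff (fun z => z) (fun z => 𝓔 z) adv₂) (hT : Eff (fun z => z) (fun z => 𝓔 z) T)
    (hD : ∀ z, WellFormed (D z)) (hD₀ : ∀ z, WellFormed (D₀ z)) :
    Negligible fun z =>
      |pr (simExec last cP cS (advB z) (adv₁ z) (adv₂ z) (D₀ z) (D z) (L z) (aux z) (T z)) -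
        pr (realExec last cP cS (advB z) (adv₁ z) (adv₂ z) (D z) (L z) (aux z) (T z))| := by
  have hs : Negligible fun z => 2 * ((C z).d * (1 / ((𝓔 z).q : ℝ))) :=
    (h.negligible_inv_q.natCast_mul (polyParams 𝓔 C).d).const_mul 2
  rcases cP with _ | _
  · rcases cS with _ | _ | _
    · refine hs.mono fun z => ?_
      rw [simExec_honest_none _ _ _ _ _ _ _ (hD z), sub_self, abs_zero, abs_zero]
      positivity
    · obtain ⟨ε, hε, H⟩ := h.exists_bound_S₁ last advB adv₁ adv₂ D₀ D L aux T h₁ hT hD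
      refine Negligible.mono (hε.add hs) fun z => ?_
      rw [abs_abs]
      exact (abs_sub_le _ _ _).trans (add_le_add (H z) (abs_pr_realExec_honest_S₁_sub_le
        _ _ _ _ _ _ _ (hD z) (hD₀ z)))
    · obtain ⟨ε, hε, H⟩ := h.exists_bound_S₂ last advB adv₁ adv₂ D₀ D L aux T h₂ hT hD
      refine hε.mono fun z => ?_
      rw [abs_abs]
      exact H z
  · refine hs.mono fun z => ?_
    rw [abs_abs]
    exact abs_pr_malicious_sub_le ..

theorem PBC.snd {J : Type} {κ : J → ℕ} {α β : J → Type} [∀ j, BitEnc (α j)] [∀ j, BitEnc (β j)]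
    (h : PBC κ fun j => α j × β j) : PBC κ β :=
  PB.mono h fun j => by
    change _ ≤ Nat.card (BitEnc.Idx (α j) ⊕ BitEnc.Idx (β j))
    rw [Nat.card_sum]
    exact Nat.le_add_left _ _

theorem enc_prod_surjective {α β : Type} [BitEnc α] [BitEnc β]
    (hα : Function.Surjective (BitEnc.enc (α := α)))
    (hβ : Function.Surjective (BitEnc.enc (α := β))) :
    Function.Surjective (BitEnc.enc (α := α × β)) := fun x => by
  obtain ⟨a, ha⟩ := hα (x ∘ Sum.inl)
  obtain ⟨b, hb⟩ := hβ (x ∘ Sum.inr)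
  refine ⟨(a, b), funext fun i => ?_⟩
  rcases i with i | i
  · exact congrFun ha i
  · exact congrFun hb i

open Classical in
theorem SemanticallySecure.securelyCollects (h : SemanticallySecure 𝓔) (C : CommonFamily)
    (last : Server) : SecurelyCollects 𝓔 C last := by
  intro cP cS ℓa ℓB ℓC advB adv₁ adv₂ ha hB h₁ h₂
  have P := polyParams 𝓔 C
  -- Any well-formed dataset, depending on the common inputs only; it is advice for the simulator.
  -- The fallback is never reached in the comparison, since D itself is well formed.
  let D₀ : ∀ z, (C z).Hist := fun z =>
    if h : ∃ D : (C z).Hist, WellFormed D then h.choose else fun _ => 0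
  have hba : PBC (fun z => z) fun z => BitString (ℓa z) := PBC.pi (PB.fin ha) PBC.bool
  have hbB : PBC (fun z => z) fun z => BitString (ℓB z) := hB.card_out.snd
  have hst : PBC (fun z => z) fun z => SimState (𝓔 z) (C z) (ℓa z) (ℓB z) :=
    ((P.labels.prod hba).prod ((PBC.scalar P.q).prod (PBC.scalar P.q))).prod
      ((P.hist.prod (PBC.perm P.d)).prod hbB)
  -- The state between the two stages must be a bit string, and the second stage must be defined on
  -- all bit strings.
  obtain ⟨finish, hf, hf'⟩ := Eff.exists_bits
    (fun z => enc_prod_surjective (enc_bitString_surjective (ℓB z)) (enc_bitString_surjective (ℓC z)))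
    (Eff.simFinish (ℓB := ℓB) P last cP cS h₁.eff h₂.eff)
  refine ⟨_, fun z x => (simSubmit cP (advB z) (D₀ z) x).map fun y => (y.1, toBits y.2), finish,
    ?_, ?_, fun D L aux hD => ?_⟩
  · refine Eff.ppt (Eff.map (Eff.simSubmit P cP hB.eff D₀)
      (EffD.id.snd.fst.pair (EffD.toBits EffD.id.snd.snd))) (P.hist.prod (PBC.bitString hst))
  · exact Eff.ppt hf (hbB.prod h₁.card_out)
  · intro T hT
    have hD₀ : ∀ z, WellFormed (D₀ z) := fun z => by
      have : ∃ D : (C z).Hist, WellFormed D := ⟨D z, hD z⟩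
      simp only [D₀, dif_pos this]
      exact this.choose_spec
    have := h.negligible_simExec_sub last advB adv₁ adv₂ D₀ D L aux T cP cS h₁.eff h₂.eff hT.eff
      hD hD₀
    refine this.mono fun z => le_of_eq ?_
    rw [abs_abs, ideal_bind last cP cS (advB z) (adv₁ z) (adv₂ z) (D₀ z) (D z) (L z) (aux z) (T z)
      (hf' z)]
    rfl

end Families

end

end PartialView

end

theorem mainTheorem1 (𝓔 : PartialView.ECFamily) (C : PartialView.CommonFamily)
    (last : PartialView.Server) :
    (PartialView.DDH 𝓔 → PartialView.SemanticallySecure 𝓔) ∧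
      (PartialView.SemanticallySecure 𝓔 → PartialView.SecurelyCollects 𝓔 C last) :=
  ⟨fun h => h.semanticallySecure, fun h => h.securelyCollects C last⟩
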